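/- Consider the infinite-horizon consumption/investment problem with constant relative risk aversion $R\in(0,\infty)\setminus\{1\}$, discount rate $\beta>0$, zero interest rate, one risky asset following an exponential Brownian motion with drift $\mu\in\mathbb R$ and volatility $\sigma>0$, and proportional transaction costs $\lambda\ge 0$ on purchases and $\gamma\in[0,1)$ on sales, $\lambda+\gamma>0$. Put $\epsilon=\mu/\beta$, $\delta=\sigma/\sqrt\beta$, $\xi=\frac{\lambda+\gamma}{1-\gamma}$ and $$m(q)=1-\epsilon(1-R)q+\tfrac{\delta^2}{2}R(1-R)q^2,\qquad \ell(q)=1+\left(\tfrac{\delta^2}{2}-\epsilon\right)(1-R)q-\tfrac{\delta^2}{2}(1-R)^2q^2 ,$$ $$O(q,n)=\frac{1-R}{R}\,\frac{n}{1-q}\,\frac{m(q)-n}{\ell(q)-n}.$$ The no-transaction wedge is $\{p_*\le p\le p^*\}$, where $p$ is the ratio of risky wealth to paper wealth (cash plus risky wealth), and its purchase boundary $p_*$ and sale boundary $p^*$ are given by $$p_*=\frac{q_*}{1+\lambda-\lambda q_*},\qquad p^*=\frac{q^*}{1-\gamma+\gamma q^*},$$ where $(q_*,q^*)$ is determined by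 the following free-boundary problem. If $\epsilon=0$, then $q_*=q^*=0$. If $\epsilon\ne0$, then $q_*<q^*$, with $q_*>0$ if $\epsilon>0$ and $q^*<0$ if $\epsilon<0$, and there is a positive continuous function $n$ on $[q_*,q^*]$ such that: for $q\in(q_*,q^*)\setminus\{1\}$, $n(q)\neq\ell(q)$, $n'(q)=O(q,n(q))$ and $(1-R)n(q)>(1-R)m(q)$; $n(q_*)=m(q_*)$ and $n(q^*)=m(q^*)$; the one-sided derivatives satisfy $n'(q^*)=0$, and $n'(q_*)=0$ unless $q_*=1$; and $$\int_{q_*}^{q^*}\frac{1}{q(1-q)}\,\frac{n(q)-m(q)}{\ell(q)-n(q)}\,dq=\ln(1+\xi)\quad\text{(with integrable integrand)}.$$ The problem is well-posed when either $R>1$, or $R<1$, $\epsilon<\frac1{1-R}+\frac{\delta^2R}{2}$ and at least one of $|\epsilon|\le\delta\sqrt{\tfrac{2R}{1-R}}$ and $\xi>\underline\xi$ holds, where $$\underline\xi=\exp\left(\int_{q_-}^{q_+}\frac{1}{q(1-q)}\frac{|m(q)|}{\ell(q)}\,dq\right)-1,\qquad q_\pm=\frac{\epsilon\pm\sqrt{\epsilon^2-\frac{2\delta^2R}{1-R}}}{\delta^2R}$$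 ($\underline\xi$ is only needed when $\epsilon^2>\frac{2\delta^2R}{1-R}$; then $q_\pm$ are the roots of $m$). **Theorem.** Fix $\beta,\sigma,R,\lambda,\gamma$ as above. For every $\epsilon$ for which the problem is well-posed there is exactly one pair $(q_*,q^*)=(q_*(\epsilon),q^*(\epsilon))$ as above. On the set of well-posed $\epsilon$ both $q_*$ and $q^*$ are strictly increasing functions of $\epsilon$; and on the set of well-posed drifts $\mu$ both the purchase boundary $p_*$ and the sale boundary $p^*$ are strictly increasing functions of the drift $\mu$. -/

import Mathlib

namespace TransactionCosts

noncomputable section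

/-- The quadratic `m(q) = 1 - ε (1 - R) q + (δ² / 2) R (1 - R) q²`; `δsq` stands for `δ² = σ² / β`
and `ε` for `μ / β`. -/
def mQuad (R δsq ε q : ℝ) : ℝ :=
  1 - ε * (1 - R) * q + δsq / 2 * R * (1 - R) * q ^ 2

/-- The quadratic `ℓ(q) = 1 + (δ² / 2 - ε) (1 - R) q - (δ² / 2) (1 - R)² q²`. -/
def ellQuad (R δsq ε q : ℝ) : ℝ :=
  1 + (δsq / 2 - ε) * (1 - R) * q - δsq / 2 * (1 - R) ^ 2 * q ^ 2

/-- The right-hand side `O(q, n)` of the first-order equation `n' = O(q, n)`. -/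
def odeField (R δsq ε q n : ℝ) : ℝ :=
  (1 - R) / R * (n / (1 - q)) *
    ((mQuad R δsq ε q - n) / (ellQuad R δsq ε q - n))

/-- The integrand of the round-trip cost condition,
`(1 / (q (1 - q))) * (n(q) - m(q)) / (ℓ(q) - n(q))`. -/
def costIntegrand (R δsq ε : ℝ) (n : ℝ → ℝ) (q : ℝ) : ℝ :=
  1 / (q * (1 - q)) * ((n q - mQuad R δsq ε q) / (ellQuad R δsq ε q - n q))

/-- `n` solves the free-boundary problem on `[a, b]` for the round-trip transaction cost `ξ`
(here `ε ≠ 0`; `a` is the purchase point and `b` the sale point). -/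
structure IsFreeBoundarySolution (R δsq ε ξ : ℝ) (n : ℝ → ℝ) (a b : ℝ) : Prop where
  lt : a < b
  /-- positive drift: the wedge is in the upper half plane, that is `0 < a` -/
  pos_of_pos : 0 < ε → 0 < a
  /-- negative drift: the wedge is in the fourth quadrant, that is `b < 0` -/
  neg_of_neg : ε < 0 → b < 0
  continuousOn : ContinuousOn n (Set.Icc a b)
  pos : ∀ q ∈ Set.Icc a b, 0 < n q
  /-- `n' = O(q, n)` away from the singular point `q = 1` of the equation -/
  ode : ∀ q ∈ Set.Ioo a b, q ≠ 1 →
    n q ≠ ellQuad R δsq ε q ∧ HasDerivAt n (odeField R δsq ε q (n q)) q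
  /-- `n` does not meet `m` again before the far end of the wedge (except at `q = 1`) -/
  side : ∀ q ∈ Set.Ioo a b, q ≠ 1 → (1 - R) * mQuad R δsq ε q < (1 - R) * n q
  /-- the boundary conditions -/
  left : n a = mQuad R δsq ε a
  right : n b = mQuad R δsq ε b
  /-- smooth fit at the purchase point; it is not required when that is the singular point -/
  smooth_left : a ≠ 1 → HasDerivWithinAt n 0 (Set.Icc a b) a
  /-- smooth fit at the sale point -/
  smooth_right : HasDerivWithinAt n 0 (Set.Icc a b) b
  /-- the round-trip cost condition -/
  integrable : IntervalIntegrable (costIntegrand R δsq ε n) MeasureTheory.volume a b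
  cost : ∫ q in a..b, costIntegrand R δsq ε n q = Real.log (1 + ξ)

/-- `(a, b)` is the pair `(q_*, q^*)` of free boundaries. If `ε = 0`, the wedge degenerates
to the half-line without risky holdings. -/
def IsFreeBoundary (R δsq ε ξ a b : ℝ) : Prop :=
  (ε = 0 ∧ a = 0 ∧ b = 0) ∨ (ε ≠ 0 ∧ ∃ n : ℝ → ℝ, IsFreeBoundarySolution R δsq ε ξ n a b)

/-- The roots `q_-`, `q_+` of `m` (used when `R < 1` and `ε² > 2 δ² R / (1 - R)`). -/
def mRootMinus (R δsq ε : ℝ) : ℝ :=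
  (ε - Real.sqrt (ε ^ 2 - 2 * δsq * R / (1 - R))) / (δsq * R)

def mRootPlus (R δsq ε : ℝ) : ℝ :=
  (ε + Real.sqrt (ε ^ 2 - 2 * δsq * R / (1 - R))) / (δsq * R)

/-- The threshold `exp (∫_{q_-}^{q_+} |m(q)| / (q (1 - q) ℓ(q)) dq) - 1` for the
round-trip transaction cost. -/
def costThreshold (R δsq ε : ℝ) : ℝ :=
  Real.exp (∫ q in (mRootMinus R δsq ε)..(mRootPlus R δsq ε),
    1 / (q * (1 - q)) * (|mQuad R δsq ε q| / ellQuad R δsq ε q)) - 1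

/-- Well-posedness: `R > 1`, or `R < 1`, `ε < 1 / (1 - R) + δ² R / 2` and either
`|ε| ≤ δ √(2 R / (1 - R))` or the round-trip transaction cost exceeds the threshold. -/
def WellPosed (R δsq ε ξ : ℝ) : Prop :=
  1 < R ∨
  (R < 1 ∧ ε < 1 / (1 - R) + δsq * R / 2 ∧
    (|ε| ≤ Real.sqrt (2 * δsq * R / (1 - R)) ∨ costThreshold R δsq ε < ξ))

/-- The round-trip transaction cost `ξ = (λ + γ) / (1 - γ)`. -/
def roundTrip (lam gam : ℝ) : ℝ := (lam + gam) / (1 - gam)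

/-- `p_* = q_* / (1 + λ - λ q_*)`. -/
def purchaseBoundary (lam q : ℝ) : ℝ := q / (1 + lam - lam * q)

/-- `p^* = q^* / (1 - γ + γ q^*)`. -/
def saleBoundary (gam q : ℝ) : ℝ := q / (1 - gam + gam * q)

end

end TransactionCosts

/-!
The problem is put into coordinates in which both signs of the drift and of `1 - R` look alike. A
sign `τ = ±1` carries the sign of the drift, so that the drift parameter `ε` and the position `q`
are positive, and `n = exp ((1 - R) z)`. With the gap `s = (n - m) / (1 - R)` and the cost integrand
`κ = rate τ D q s`, the equation becomes `z' = -(q / R) κ`; a solution starts on `m` (`s = 0`), has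
`s > 0` inside the wedge and returns to `m` at its end, with `s' = ε - δ² R q` at both ends
(structure `Wedge`). The rate `κ` increases with `s`, so the field decreases in the state `z`: this
one-sided monotonicity carries both halves of the proof, and it also takes care of the singular
point `q = τ`, where the equation is not Lipschitz and need not hold.

Uniqueness and monotonicity. The quotient `q / n` is nondecreasing along a wedge
(`Wedge.monotoneOn_mul_exp`; for `R > 1` this needs the barrier `Wedge.gap_barrier`). Therefore two
gaps belonging to drifts `ε₁ ≤ ε₂` keep their order once the second is the larger one
(`Wedge.gap_le_gap`). If the second wedge started no later than the first, it would have the larger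
gap throughout and end no earlier, hence cost more, unless the two coincide
(`Wedge.eq_of_left_le`). With equal drifts this is uniqueness; with different drifts coincidence
contradicts the slopes `ε - δ² R b` of the gaps at the common end. The sale points are compared in
the same way (`Wedge.lt_and_lt`).

Existence. The rate is extended by zero to negative gaps and capped at a level `k`. Trajectories of
the capped equation exist and depend on their initial value in a nonexpansive way
(`exists_trajectory`, `IsTrajectory.abs_sub_le`), and for large `k` the cap is never active
(`exists_cap`); this is where the bound `ε < 1 / (1 - R) + δ² R / 2` enters. A trajectory stays
constant until it meets `m` at some point `a` below the Merton line `ε / (δ² R)`, leaves `m` there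
and returns at some `b` beyond that line, so it is a wedge (`IsTrajectory.exists_wedge`) whose cost
depends continuously on `a`. The cost is arbitrarily large for `a` near the origin
(`exists_start`). At the other extreme it tends to zero if `m` is positive up to the Merton line,
and otherwise `a` can approach the smaller root of `m`, where the cost is at most the threshold,
the cost of the function `n = 0` (`Wedge.exists_of_roots`). The intermediate value theorem gives a
wedge of the prescribed cost.

The boundaries `p_*` and `p^*` are increasing functions of `q_*` and `q^*` as long as their
denominators are positive, and that follows from comparing the cost with `∫ dq / (q (q - τ))`
(`Wedge.cost_lt`).
-/

/-! ### Monotonicity with an exceptional point -/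

/-- A continuous function whose derivative is nonpositive except possibly at one point `p` is
antitone. -/
theorem antitoneOn_Icc_of_hasDerivAt_nonpos_off {f : ℝ → ℝ} {a b : ℝ} (p : ℝ)
    (hf : ContinuousOn f (Set.Icc a b))
    (h : ∀ q ∈ Set.Ioo a b, q ≠ p → ∃ f', f' ≤ 0 ∧ HasDerivAt f f' q) :
    AntitoneOn f (Set.Icc a b) := by
  have key : ∀ c d, a ≤ c → d ≤ b → p ∉ Set.Ioo c d → AntitoneOn f (Set.Icc c d) := by
    intro c d hc hd hp
    have hne : ∀ q ∈ Set.Ioo c d, ∃ f', f' ≤ 0 ∧ HasDerivAt f f' q := fun q hq =>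
      h q ⟨hc.trans_lt hq.1, hq.2.trans_le hd⟩ (fun e => hp (e ▸ hq))
    refine antitoneOn_of_deriv_nonpos (convex_Icc c d) (hf.mono (Set.Icc_subset_Icc hc hd)) ?_ ?_
    · rw [interior_Icc]
      intro q hq
      obtain ⟨f', -, h2⟩ := hne q hq
      exact h2.differentiableAt.differentiableWithinAt
    · rw [interior_Icc]
      intro q hq
      obtain ⟨f', h1, h2⟩ := hne q hq
      rwa [h2.deriv]
  intro x hx y hy hxy
  by_cases hp : p ∈ Set.Ioo x y
  · exact (key p y (hx.1.trans hp.1.le) hy.2 (fun h => lt_irrefl _ h.1) ⟨le_rfl, hp.2.le⟩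
      ⟨hp.2.le, le_rfl⟩ hp.2.le).trans
      (key x p hx.1 (hp.2.le.trans hy.2) (fun h => lt_irrefl _ h.2) ⟨le_rfl, hp.1.le⟩
      ⟨hp.1.le, le_rfl⟩ hp.1.le)
  · exact key x y hx.1 hy.2 hp ⟨le_rfl, hxy⟩ ⟨hxy, le_rfl⟩ hxy

theorem monotoneOn_Icc_of_hasDerivAt_nonneg_off {f : ℝ → ℝ} {a b : ℝ} (p : ℝ)
    (hf : ContinuousOn f (Set.Icc a b))
    (h : ∀ q ∈ Set.Ioo a b, q ≠ p → ∃ f', 0 ≤ f' ∧ HasDerivAt f f' q) :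
    MonotoneOn f (Set.Icc a b) := by
  have := antitoneOn_Icc_of_hasDerivAt_nonpos_off p hf.neg (fun q hq hp => by
    obtain ⟨f', h1, h2⟩ := h q hq hp
    exact ⟨-f', by linarith, h2.neg⟩)
  intro x hx y hy hxy
  have := this hx hy hxy
  simpa using this

theorem exists_last_nonpos {f : ℝ → ℝ} {a b : ℝ} (hab : a ≤ b)
    (hf : ContinuousOn f (Set.Icc a b)) (ha : f a ≤ 0) (hb : 0 < f b) :
    ∃ c ∈ Set.Ico a b, f c ≤ 0 ∧ ∀ t ∈ Set.Ioc c b, 0 < f t := by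
  have hcl : IsClosed (Set.Icc a b ∩ f ⁻¹' Set.Iic 0) :=
    hf.preimage_isClosed_of_isClosed isClosed_Icc isClosed_Iic
  have hK : IsCompact (Set.Icc a b ∩ f ⁻¹' Set.Iic 0) :=
    isCompact_Icc.of_isClosed_subset hcl Set.inter_subset_left
  obtain ⟨c, hc, hcm⟩ := hK.exists_isGreatest ⟨a, ⟨le_rfl, hab⟩, ha⟩
  have hc2 : f c ≤ 0 := hc.2
  refine ⟨c, ⟨hc.1.1, lt_of_le_of_ne hc.1.2 (fun e => ?_)⟩, hc2, fun t ht => ?_⟩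
  · rw [e] at hc2; linarith
  · by_contra hneg
    have : t ≤ c := hcm ⟨⟨hc.1.1.trans ht.1.le, ht.2⟩, not_lt.mp hneg⟩
    exact absurd ht.1 (not_lt.mpr this)

/-- A function that starts nonpositive and does not increase where it is positive stays
nonpositive. -/
theorem nonpos_of_hasDerivAt_nonpos_of_pos {f : ℝ → ℝ} {a b : ℝ} (p : ℝ)
    (hf : ContinuousOn f (Set.Icc a b)) (ha : f a ≤ 0)
    (h : ∀ q ∈ Set.Ioo a b, q ≠ p → 0 < f q → ∃ f', f' ≤ 0 ∧ HasDerivAt f f' q) :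
    ∀ q ∈ Set.Icc a b, f q ≤ 0 := by
  intro q hq
  by_contra hneg
  obtain ⟨c, hc, hc0, hc1⟩ := exists_last_nonpos hq.1
    (hf.mono (Set.Icc_subset_Icc le_rfl hq.2)) ha (not_le.mp hneg)
  have := antitoneOn_Icc_of_hasDerivAt_nonpos_off (f := f) (a := c) (b := q) p
    (hf.mono (Set.Icc_subset_Icc hc.1 hq.2)) (fun t ht htp =>
      h t ⟨hc.1.trans_lt ht.1, ht.2.trans_le hq.2⟩ htp (hc1 t ⟨ht.1, ht.2.le⟩))
    ⟨le_rfl, hc.2.le⟩ ⟨hc.2.le, le_rfl⟩ hc.2.le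
  linarith

/-- At the right end of an interval on which `f` is nonnegative, with `f b = 0`, the one-sided
derivative is nonpositive. -/
theorem hasDerivWithinAt_right_nonpos {f : ℝ → ℝ} {a b c f' : ℝ} (hac : a ≤ c) (hcb : c < b)
    (hd : HasDerivWithinAt f f' (Set.Icc a b) b) (hb : f b = 0)
    (hpos : ∀ q ∈ Set.Ioo c b, 0 ≤ f q) : f' ≤ 0 := by
  have h1 : HasDerivWithinAt f f' (Set.Ioo c b) b :=
    hd.mono (fun q hq => ⟨hac.trans hq.1.le, hq.2.le⟩)
  rw [hasDerivWithinAt_iff_tendsto_slope' (by simp)] at h1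
  have : (nhdsWithin b (Set.Ioo c b)).NeBot := right_nhdsWithin_Ioo_neBot hcb
  refine le_of_tendsto h1 (eventually_nhdsWithin_of_forall fun q hq => ?_)
  rw [slope_def_field, hb]
  have := hpos q hq
  exact div_nonpos_of_nonneg_of_nonpos (by linarith) (by linarith [hq.2])

/-! ### The problem in logarithmic coordinates -/

namespace TransactionCosts

/-- The isoelastic function `(e ^ ((1 - R) z) - 1) / (1 - R)`: the free-boundary function is
`n = e ^ ((1 - R) z)`, so this is `(n - 1) / (1 - R)`, increasing in `z` whatever the sign
of `1 - R`. -/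
noncomputable def crra (R z : ℝ) : ℝ := (Real.exp ((1 - R) * z) - 1) / (1 - R)

/-- The normalized gap `(n - m) / (1 - R)` between `n = e ^ ((1 - R) z)` and the quadratic `m`. -/
noncomputable def gap (R D ε z q : ℝ) : ℝ := crra R z + ε * q - D * R / 2 * q ^ 2

/-- The denominator of the cost rate. The sign `τ = ±1` is that of the risky position: the
variable `q > 0` stands for the point `τ q` of the original problem. -/
noncomputable def den (τ D q s : ℝ) : ℝ :=
  D / 2 * (q * (1 - τ * q)) ^ 2 - τ * (q * (1 - τ * q)) * s

/-- The cost rate, the integrand of the round-trip cost as a function of position and gap. -/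
noncomputable def rate (τ D q s : ℝ) : ℝ := s / den τ D q s

/-- The free-boundary problem in the coordinates `q > 0` and `z = log n / (1 - R)`, with total
cost `L`. Positive drift corresponds to `τ = 1`, negative drift to `τ = -1`; in both cases the
drift parameter `ε` is positive here. The point `q = τ` is singular for the equation; the value of
`rate` there is `0` by division by zero. Positivity of `den` says that `n` stays on one side of `ℓ`,
and the one-sided derivatives `ε - D R q` of the gap express the smooth fit `n' = 0`. -/
structure Wedge (τ R D ε L : ℝ) (z : ℝ → ℝ) (a b : ℝ) : Prop where
  pos : 0 < a
  lt : a < b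
  cont : ContinuousOn z (Set.Icc a b)
  gap_pos : ∀ q ∈ Set.Ioo a b, q ≠ τ → 0 < gap R D ε (z q) q
  den_pos : ∀ q ∈ Set.Ioo a b, q ≠ τ → 0 < den τ D q (gap R D ε (z q) q)
  deriv : ∀ q ∈ Set.Ioo a b, q ≠ τ →
    HasDerivAt z (-(q / R) * rate τ D q (gap R D ε (z q) q)) q
  left : gap R D ε (z a) a = 0
  right : gap R D ε (z b) b = 0
  left_deriv : a ≠ τ → HasDerivWithinAt (fun q => gap R D ε (z q) q) (ε - D * R * a) (Set.Icc a b) a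
  right_deriv : HasDerivWithinAt (fun q => gap R D ε (z q) q) (ε - D * R * b) (Set.Icc a b) b
  integrable : IntervalIntegrable (fun q => rate τ D q (gap R D ε (z q) q)) MeasureTheory.volume a b
  cost : ∫ q in a..b, rate τ D q (gap R D ε (z q) q) = L

theorem hasDerivAt_crra {R : ℝ} (hR1 : R ≠ 1) (z : ℝ) :
    HasDerivAt (crra R) (Real.exp ((1 - R) * z)) z := by
  have h : (1 - R) ≠ 0 := sub_ne_zero.mpr hR1.symm
  have := ((((hasDerivAt_id z).const_mul (1 - R)).exp).sub_const 1).div_const (1 - R)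
  refine this.congr_deriv ?_
  simp only [id_eq, mul_one]
  field_simp

theorem continuous_crra {R : ℝ} : Continuous (crra R) := by
  unfold crra; fun_prop

theorem one_add_crra {R : ℝ} (hR1 : R ≠ 1) (z : ℝ) :
    1 + (1 - R) * crra R z = Real.exp ((1 - R) * z) := by
  have h : (1 - R) ≠ 0 := sub_ne_zero.mpr hR1.symm
  unfold crra; field_simp; ring

theorem crra_strictMono {R : ℝ} (hR1 : R ≠ 1) : StrictMono (crra R) :=
  strictMono_of_deriv_pos fun z => by
    rw [(hasDerivAt_crra hR1 z).deriv]; positivity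

theorem crra_sub {R : ℝ} (hR1 : R ≠ 1) (x y : ℝ) :
    crra R y - crra R x = Real.exp ((1 - R) * x) * crra R (y - x) := by
  have h : (1 - R) ≠ 0 := sub_ne_zero.mpr hR1.symm
  have e : Real.exp ((1 - R) * y) = Real.exp ((1 - R) * x) * Real.exp ((1 - R) * (y - x)) := by
    rw [← Real.exp_add]; congr 1; ring
  unfold crra; rw [e]; field_simp; ring

theorem continuousOn_gap {R D ε : ℝ} {z : ℝ → ℝ} {s : Set ℝ} (hz : ContinuousOn z s) :
    ContinuousOn (fun q => gap R D ε (z q) q) s := by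
  have := continuous_crra (R := R).comp_continuousOn hz
  unfold gap
  exact (this.add (by fun_prop)).sub (by fun_prop)

theorem hasDerivAt_gap {R D ε q z' : ℝ} {z : ℝ → ℝ} (hR1 : R ≠ 1) (hz : HasDerivAt z z' q) :
    HasDerivAt (fun q => gap R D ε (z q) q)
      (Real.exp ((1 - R) * z q) * z' + (ε - D * R * q)) q := by
  have h1 := (hasDerivAt_crra hR1 (z q)).comp q hz
  have h2 := (h1.add ((hasDerivAt_id q).const_mul ε)).sub
    (((hasDerivAt_id q).pow 2).const_mul (D * R / 2))
  refine h2.congr_deriv ?_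
  simp; ring

theorem rate_nonneg {τ D q s : ℝ} (hs : 0 ≤ s) (hd : 0 ≤ den τ D q s) : 0 ≤ rate τ D q s :=
  div_nonneg hs hd

/-- The cost rate increases with the gap. -/
theorem rate_le_rate {τ D q s t : ℝ} (hD : 0 < D) (hst : s ≤ t)
    (hs : 0 < den τ D q s) (ht : 0 < den τ D q t) : rate τ D q s ≤ rate τ D q t := by
  unfold rate
  rw [div_le_div_iff₀ hs ht]
  unfold den
  nlinarith [mul_nonneg (sub_nonneg.mpr hst) (mul_nonneg hD.le (sq_nonneg (q * (1 - τ * q))))]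

end TransactionCosts

namespace TransactionCosts

/-! ### Elementary properties of wedges -/

theorem rate_of_singular {τ D q s : ℝ} (h : τ * q = 1) : rate τ D q s = 0 := by
  simp [rate, den, h]

theorem sign_mul_eq_one {τ q : ℝ} (hτ : τ = 1 ∨ τ = -1) (h : q = τ) : τ * q = 1 := by
  rcases hτ with rfl | rfl <;> rw [h] <;> norm_num

theorem one_sub_sign_mul_ne_zero {τ q : ℝ} (hτ : τ = 1 ∨ τ = -1) (h : q ≠ τ) : 1 - τ * q ≠ 0 := by
  rcases hτ with rfl | rfl
  · intro h'; apply h; linarith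
  · intro h'; apply h; linarith

theorem rate_zero {τ D q : ℝ} : rate τ D q 0 = 0 := by simp [rate]

namespace Wedge

variable {τ R D ε L a b : ℝ} {z : ℝ → ℝ}

theorem rate_nonneg (hτ : τ = 1 ∨ τ = -1) (W : Wedge τ R D ε L z a b) {q : ℝ}
    (hq : q ∈ Set.Icc a b) : 0 ≤ rate τ D q (gap R D ε (z q) q) := by
  by_cases hqτ : q = τ
  · rw [rate_of_singular (sign_mul_eq_one hτ hqτ)]
  rcases eq_or_lt_of_le hq.1 with h | h
  · rw [← h, W.left, rate_zero]
  rcases eq_or_lt_of_le hq.2 with h' | h'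
  · rw [h', W.right, rate_zero]
  exact TransactionCosts.rate_nonneg (W.gap_pos q ⟨h, h'⟩ hqτ).le (W.den_pos q ⟨h, h'⟩ hqτ).le

theorem rate_pos (W : Wedge τ R D ε L z a b) {q : ℝ}
    (hq : q ∈ Set.Ioo a b) (hqτ : q ≠ τ) : 0 < rate τ D q (gap R D ε (z q) q) :=
  div_pos (W.gap_pos q hq hqτ) (W.den_pos q hq hqτ)

theorem antitoneOn (hτ : τ = 1 ∨ τ = -1) (hR : 0 < R) (W : Wedge τ R D ε L z a b) :
    AntitoneOn z (Set.Icc a b) :=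
  antitoneOn_Icc_of_hasDerivAt_nonpos_off τ W.cont fun q hq hqτ =>
    ⟨_, by
      have := W.rate_nonneg hτ ⟨hq.1.le, hq.2.le⟩
      have : 0 < q := W.pos.trans hq.1
      rw [neg_mul]
      exact neg_nonpos.mpr (by positivity), W.deriv q hq hqτ⟩

theorem contGap (W : Wedge τ R D ε L z a b) :
    ContinuousOn (fun q => gap R D ε (z q) q) (Set.Icc a b) := continuousOn_gap W.cont

/-- The gap is also nonnegative at the singular point, by continuity. -/
theorem gap_nonneg (W : Wedge τ R D ε L z a b) {q : ℝ} (hq : q ∈ Set.Icc a b) :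
    0 ≤ gap R D ε (z q) q := by
  have : q ∈ closure (Set.Ioo a b ∩ ({τ}ᶜ : Set ℝ)) := by
    have h1 : closure (Set.Ioo a b) ⊆ closure (Set.Ioo a b ∩ ({τ}ᶜ : Set ℝ)) :=
      closure_minimal ((dense_compl_singleton τ).open_subset_closure_inter isOpen_Ioo)
        isClosed_closure
    rw [closure_Ioo W.lt.ne] at h1
    exact h1 hq
  have h := W.contGap q hq
  have h2 : (nhdsWithin q (Set.Ioo a b ∩ ({τ}ᶜ : Set ℝ))).NeBot := mem_closure_iff_nhdsWithin_neBot.mp this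
  refine ge_of_tendsto (h.tendsto.mono_left (nhdsWithin_mono q
    ((Set.inter_subset_left (t := {τ}ᶜ)).trans Set.Ioo_subset_Icc_self))) ?_
  exact eventually_nhdsWithin_of_forall fun t ht => (W.gap_pos t ht.1 ht.2).le

theorem gap_le (hτ : τ = 1 ∨ τ = -1) (hR : 0 < R) (hR1 : R ≠ 1) (W : Wedge τ R D ε L z a b)
    {p q : ℝ} (hp : p ∈ Set.Icc a b) (hq : q ∈ Set.Icc a b) (hpq : p ≤ q) :
    gap R D ε (z q) q ≤ gap R D ε (z p) p + (q - p) * (ε - D * R / 2 * (p + q)) := by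
  have := (crra_strictMono hR1).monotone (W.antitoneOn hτ hR hp hq hpq)
  unfold gap
  nlinarith

/-- The purchase point lies below the Merton line. -/
theorem left_lt (hτ : τ = 1 ∨ τ = -1) (hR : 0 < R) (hR1 : R ≠ 1) (hD : 0 < D)
    (W : Wedge τ R D ε L z a b) : D * R * a < ε := by
  obtain ⟨q, hq, hqτ⟩ : ∃ q ∈ Set.Ioo a b, q ≠ τ :=
    ((Set.Ioo_infinite W.lt).sdiff (Set.finite_singleton τ)).nonempty
  have h1 := W.gap_le hτ hR hR1 ⟨le_rfl, W.lt.le⟩ ⟨hq.1.le, hq.2.le⟩ hq.1.le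
  rw [W.left, zero_add] at h1
  have h2 := pos_of_mul_pos_right ((W.gap_pos q hq hqτ).trans_le h1) (sub_pos.mpr hq.1).le
  have : D * R * a < D * R * q := mul_lt_mul_of_pos_left hq.1 (mul_pos hD hR)
  linarith

/-- The sale point does not lie below the Merton line. -/
theorem le_right (W : Wedge τ R D ε L z a b) : ε ≤ D * R * b := by
  have := hasDerivWithinAt_right_nonpos le_rfl W.lt W.right_deriv W.right
    fun q hq => W.gap_nonneg ⟨hq.1.le, hq.2.le⟩
  linarith

/-- A wedge around the singular point touches `m` there: to the left of `1` positivity of the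
denominator keeps the gap below `D / 2 * (q * (1 - q))`. -/
theorem gap_singular (hτ : τ = 1 ∨ τ = -1)
    (W : Wedge τ R D ε L z a b) (ha : a < τ) (hb : τ < b) : gap R D ε (z τ) τ = 0 := by
  have hτ1 : τ = 1 := by
    rcases hτ with h | h
    · exact h
    · have := W.pos; linarith
  subst hτ1
  refine le_antisymm ?_ (W.gap_nonneg ⟨ha.le, hb.le⟩)
  have h := (W.contGap 1 ⟨ha.le, hb.le⟩).mono_left
    (nhdsWithin_mono 1 (fun q (hq : q ∈ Set.Ioo a 1) => ⟨hq.1.le, hq.2.le.trans hb.le⟩))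
  have : (nhdsWithin 1 (Set.Ioo a 1)).NeBot := right_nhdsWithin_Ioo_neBot ha
  have h2 : Filter.Tendsto (fun q : ℝ => D / 2 * (q * (1 - q))) (nhdsWithin 1 (Set.Ioo a 1))
      (nhds 0) := by
    have : Filter.Tendsto (fun q : ℝ => D / 2 * (q * (1 - q))) (nhds 1)
      (nhds (D / 2 * (1 * (1 - 1)))) := by
      apply Continuous.tendsto; fun_prop
    simp only [sub_self, mul_zero] at this
    exact this.mono_left nhdsWithin_le_nhds
  refine le_of_tendsto_of_tendsto h h2 (eventually_nhdsWithin_of_forall fun q hq => ?_)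
  have h3 := W.den_pos q ⟨hq.1, hq.2.trans hb⟩ hq.2.ne
  have h0 : 0 < q := W.pos.trans hq.1
  unfold den at h3
  have h4 : 0 < (q * (1 - q)) * (D / 2 * (q * (1 - q)) - gap R D ε (z q) q) := by
    nlinarith
  have := pos_of_mul_pos_right h4 (mul_pos h0 (by linarith [hq.2])).le
  linarith

/-- If the singular point is inside the wedge, it lies below the Merton line, since the gap becomes
positive again beyond it. -/
theorem lt_of_singular (hτ : τ = 1 ∨ τ = -1) (hR : 0 < R) (hR1 : R ≠ 1) (hD : 0 < D)
    (W : Wedge τ R D ε L z a b) (ha : a < τ) (hb : τ < b) : D * R * τ < ε := by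
  obtain ⟨q, hq⟩ := exists_between hb
  have h1 := W.gap_le hτ hR hR1 ⟨ha.le, hb.le⟩ ⟨ha.le.trans hq.1.le, hq.2.le⟩ hq.1.le
  rw [W.gap_singular hτ ha hb, zero_add] at h1
  have h2 := pos_of_mul_pos_right ((W.gap_pos q ⟨ha.trans hq.1, hq.2⟩ hq.1.ne').trans_le h1)
    (sub_pos.mpr hq.1).le
  have : D * R * τ < D * R * q := mul_lt_mul_of_pos_left hq.1 (mul_pos hD hR)
  linarith

/-- If the sale point is the singular point, it is the Merton line: otherwise the gap would
vanish there only to first order, the cost rate would be unbounded, and smooth fit would fail. -/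
theorem eq_of_right_singular (hτ : τ = 1 ∨ τ = -1) (hR : 0 < R) (hR1 : R ≠ 1) (hD : 0 < D)
    (W : Wedge τ R D ε L z a b) (hb : b = τ) : ε = D * R * b := by
  have hτ1 : τ = 1 := by
    rcases hτ with h | h
    · exact h
    · have := W.pos; have := W.lt; linarith
  subst hτ1; subst hb
  refine le_antisymm W.le_right (not_lt.mp fun hlt => ?_)
  obtain ⟨ν, hν, hn⟩ : ∃ ν > 0, ∀ q ∈ Set.Icc a 1, ν ≤ Real.exp ((1 - R) * z q) := by
    have hc : ContinuousOn (fun q => Real.exp ((1 - R) * z q)) (Set.Icc a 1) :=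
      Real.continuous_exp.comp_continuousOn (continuousOn_const.mul W.cont)
    obtain ⟨x, -, hx⟩ := isCompact_Icc.exists_isMinOn ⟨1, W.lt.le, le_rfl⟩ hc
    exact ⟨_, Real.exp_pos _, fun q hq => hx hq⟩
  have ha := W.pos
  have ha1 := W.lt
  set c := (D * R - ε) / 2 with hc
  have hc0 : 0 < c := by rw [hc]; linarith
  -- near the singular point the gap is at least `c * (1 - q)`
  obtain ⟨p, hap, hp1, hp⟩ : ∃ p, a ≤ p ∧ p < 1 ∧ ∀ q ∈ Set.Ioo p 1,
      c * (1 - q) ≤ gap R D ε (z q) q := by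
    have h1 : HasDerivWithinAt (fun q => gap R D ε (z q) q) (ε - D * R * 1) (Set.Ioo a 1) 1 :=
      W.right_deriv.mono Set.Ioo_subset_Icc_self
    rw [hasDerivWithinAt_iff_tendsto_slope' (by simp)] at h1
    have h2 := h1.eventually_lt_const (u := -c) (by rw [hc]; linarith)
    rw [nhdsWithin_Ioo_eq_nhdsLT ha1] at h2
    obtain ⟨p, hp, hp2⟩ := (mem_nhdsLT_iff_exists_mem_Ico_Ioo_subset ha1).mp h2
    refine ⟨p, hp.1, hp.2, fun q hq => ?_⟩
    have := hp2 hq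
    simp only [Set.mem_ofPred_eq, slope_def_field, W.right] at this
    rw [div_lt_iff_of_neg (by linarith [hq.2])] at this
    linarith
  have hD' : 0 < 2 * c / D := by positivity
  set κ := ν * (a / R) * (2 * c / D) with hκ
  have hκ0 : 0 < κ := by positivity
  -- hence the cost rate is bounded below and `z` decreases at a positive speed towards `1`
  have hanti : AntitoneOn (fun q => crra R (z q) + κ * q) (Set.Icc p 1) := by
    refine antitoneOn_Icc_of_hasDerivAt_nonpos_off 1 ?_ fun q hq hq1 => ?_
    · exact (continuous_crra.comp_continuousOn (W.cont.mono
        (Set.Icc_subset_Icc hap le_rfl))).add (by fun_prop)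
    · have hq' : q ∈ Set.Ioo a 1 := ⟨hap.trans_lt hq.1, hq.2⟩
      have hd := ((hasDerivAt_crra hR1 (z q)).comp q (W.deriv q hq' hq1)).add
        ((hasDerivAt_id q).const_mul κ)
      refine ⟨_, ?_, hd⟩
      have hq0 : 0 < q := ha.trans hq'.1
      have hgp := hp q hq
      have hden := W.den_pos q hq' hq1
      have hrate : 2 * c / D ≤ rate 1 D q (gap R D ε (z q) q) := by
        unfold rate
        rw [div_le_div_iff₀ hD hden]
        unfold den
        have e1 : 0 ≤ q * (1 - q) := mul_nonneg hq0.le (by linarith [hq'.2])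
        have e2 : q ^ 2 * (1 - q) ≤ 1 := by nlinarith [hq'.2, sq_nonneg q]
        have e3 : 0 ≤ c * (1 - q) := mul_nonneg hc0.le (by linarith [hq'.2])
        have e4 : 0 ≤ c * (1 - q) * D := mul_nonneg e3 hD.le
        have e5 : 0 ≤ c * (q * (1 - q)) * gap R D ε (z q) q :=
          mul_nonneg (mul_nonneg hc0.le e1) (e3.trans hgp)
        nlinarith [mul_le_mul_of_nonneg_right hgp hD.le, mul_le_mul_of_nonneg_left e2 e4]
      have h3 : κ ≤ Real.exp ((1 - R) * z q) * (q / R) * rate 1 D q (gap R D ε (z q) q) := by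
        rw [hκ]
        gcongr
        · exact hn q ⟨hq'.1.le, hq'.2.le⟩
        · exact hq'.1.le
      simp only [mul_one]
      nlinarith
  -- smooth fit forces the speed of `z` to vanish at `1`
  have hd2 : HasDerivWithinAt (fun q => crra R (z q) + κ * q - (crra R (z 1) + κ)) κ
      (Set.Icc a 1) 1 := by
    have := (W.right_deriv.sub ((((hasDerivAt_id (1:ℝ)).const_mul ε).sub
      (((hasDerivAt_id (1:ℝ)).pow 2).const_mul (D * R / 2))).hasDerivWithinAt (s := Set.Icc a 1))).add
      (((hasDerivAt_id (1:ℝ)).const_mul κ).hasDerivWithinAt (s := Set.Icc a 1))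
    have := this.sub_const (crra R (z 1) + κ)
    refine (this.congr_deriv ?_).congr_of_mem (fun q _ => ?_) ⟨ha1.le, le_rfl⟩
    · simp
    · simp [gap]
  have := hasDerivWithinAt_right_nonpos hap hp1 hd2 (by simp) (fun q hq => by
    have := hanti ⟨hq.1.le, hq.2.le⟩ ⟨hp1.le, le_rfl⟩ hq.2.le
    simp only at this
    linarith)
  linarith

end Wedge
end TransactionCosts

namespace TransactionCosts

/-! ### Order preservation -/

namespace Wedge

variable {τ R D ε L a b : ℝ} {z : ℝ → ℝ}

/-- For `R > 1` and `q < R` the gap stays below the curve on which the tangent to the graph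
of `n` passes through the origin. -/
theorem gap_barrier (hR1 : 1 < R) (hD : 0 < D) (W : Wedge 1 R D ε L z a b) {q : ℝ}
    (hq : q ∈ Set.Icc a b) (hqR : q < R) :
    2 * gap R D ε (z q) q * (R - q) ≤ q * (R * D * (1 - q) ^ 2) := by
  have ha := W.pos
  have hcont : ContinuousOn (fun q => 2 * gap R D ε (z q) q * (R / q - 1) - R * D * (1 - q) ^ 2)
      (Set.Icc a q) := by
    have h1 := W.contGap.mono (Set.Icc_subset_Icc le_rfl hq.2)
    have h2 : ContinuousOn (fun q : ℝ => R / q - 1) (Set.Icc a q) :=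
      (continuousOn_const.div continuousOn_id fun x hx => (ha.trans_le hx.1).ne').sub
        continuousOn_const
    exact ((continuousOn_const.mul h1).mul h2).sub (by fun_prop)
  have h := nonpos_of_hasDerivAt_nonpos_of_pos 1 hcont (by
    simp only [W.left, mul_zero, zero_mul, zero_sub, Left.neg_nonpos_iff]; positivity) ?_ q
    ⟨hq.1, le_rfl⟩
  · have hq0 : 0 < q := ha.trans_le hq.1
    have e : 2 * gap R D ε (z q) q * (R - q) - q * (R * D * (1 - q) ^ 2)
      = q * (2 * gap R D ε (z q) q * (R / q - 1) - R * D * (1 - q) ^ 2) := by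
      field_simp
    nlinarith [mul_nonpos_of_nonneg_of_nonpos hq0.le h]
  · intro t ht ht1 hpos
    have htab : t ∈ Set.Ioo a b := ⟨ht.1, ht.2.trans_le hq.2⟩
    have ht0 : 0 < t := ha.trans ht.1
    have htR : t < R := ht.2.trans hqR
    have hd := hasDerivAt_gap (D := D) (ε := ε) hR1.ne' (W.deriv t htab ht1)
    have hd2 := ((hd.const_mul 2).mul (((hasDerivAt_const t R).div (hasDerivAt_id t)
      ht0.ne').sub_const 1)).sub ((((hasDerivAt_id t).const_sub 1).pow 2).const_mul (R * D))
    refine ⟨_, ?_, hd2⟩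
    set s := gap R D ε (z t) t with hs
    have hs0 : 0 < s := W.gap_pos t htab ht1
    have hden := W.den_pos t htab ht1
    rw [← hs] at hden
    set n := Real.exp ((1 - R) * z t) with hn
    have hn0 : 0 < n := Real.exp_pos _
    have hns : n = 1 + (1 - R) * (s - ε * t + D * R / 2 * t ^ 2) := by
      rw [hn, ← one_add_crra hR1.ne', hs]; unfold gap; ring
    have e1 : R / t - 1 = (R - t) / t := by field_simp
    have hpos' : R * D * (1 - t) ^ 2 * t < 2 * s * (R - t) := by
      rw [e1] at hpos
      have := mul_pos hpos ht0
      field_simp at this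
      linarith
    -- beyond the barrier the rate exceeds `R / ((R - 1) t²)`
    have hr : R / ((R - 1) * t ^ 2) ≤ rate 1 D t s := by
      unfold rate
      rw [div_le_div_iff₀ (mul_pos (by linarith) (by positivity)) hden]
      unfold den
      nlinarith
    have hR0 : 0 < R := by linarith
    have hs' : n * (-(t / R) * rate 1 D t s) + (ε - D * R * t)
        ≤ -(1 / ((R - 1) * t)) + s / t - D * R / 2 * t := by
      have h1 : n * (t / R) * (R / ((R - 1) * t ^ 2)) ≤ n * (t / R) * rate 1 D t s :=
        mul_le_mul_of_nonneg_left hr (by positivity)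
      have h2 : n * (t / R) * (R / ((R - 1) * t ^ 2)) = n / ((R - 1) * t) := by
        field_simp
      have h3 : n / ((R - 1) * t) = 1 / ((R - 1) * t) - s / t + ε - D * R / 2 * t := by
        have : R - 1 ≠ 0 := by linarith
        rw [hns]; field_simp; ring
      nlinarith
    have hA : 0 ≤ 1 / ((R - 1) * t) :=
      div_nonneg zero_le_one (mul_nonneg (by linarith) ht0.le)
    have hRt : 0 ≤ R / t - 1 := by rw [e1]; exact div_nonneg (by linarith) ht0.le
    have h4 : (n * (-(t / R) * rate 1 D t s) + (ε - D * R * t)) * (R / t - 1)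
        ≤ (s / t - D * R / 2 * t) * (R / t - 1) :=
      mul_le_mul_of_nonneg_right (by linarith) hRt
    have h5 : 2 * ((s / t - D * R / 2 * t) * (R / t - 1)) - 2 * s * R / t ^ 2
        + 2 * R * D * (1 - t) = -(2 * s / t + D * R * (R - 2 + t)) := by
      field_simp; ring
    -- this uses once more that the gap is above the barrier
    have h6 : 0 ≤ 2 * s / t + D * R * (R - 2 + t) := by
      have e2 : 0 < R - t := by linarith
      have : 0 ≤ (2 * s / t + D * R * (R - 2 + t)) * (t * (R - t)) := by
        have e3 : (2 * s / t + D * R * (R - 2 + t)) * (t * (R - t))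
          = 2 * s * (R - t) + D * R * (R - 2 + t) * (t * (R - t)) := by field_simp
        rw [e3]
        have e4 : 0 ≤ D * R * t * (R - 1) ^ 2 := by positivity
        nlinarith
      exact nonneg_of_mul_nonneg_left this (mul_pos ht0 e2)
    simp only [id_eq, Nat.cast_ofNat, Nat.add_one_sub_one, pow_one, zero_mul, mul_one, zero_sub,
      mul_neg, sub_neg_eq_add]
    have e5 : 2 * s * (-R / t ^ 2) = - (2 * s * R / t ^ 2) := by ring
    rw [show ((fun _ => R) / id : ℝ → ℝ) t = R / t from rfl, e5]
    linarith

/-- The upper bound `R / ((R - 1) q²)` of the cost rate for `R > 1`; it says that `q / n` does not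
decrease. -/
theorem rate_mul_sq_le (hτ : τ = 1 ∨ τ = -1) (hR1 : 1 < R) (hD : 0 < D)
    (W : Wedge τ R D ε L z a b) {q : ℝ} (hq : q ∈ Set.Ioo a b) (hqτ : q ≠ τ) :
    (R - 1) * q ^ 2 * rate τ D q (gap R D ε (z q) q) ≤ R := by
  have hden := W.den_pos q hq hqτ
  have hs := W.gap_pos q hq hqτ
  have hq0 : 0 < q := W.pos.trans hq.1
  unfold rate
  rw [mul_div_assoc', div_le_iff₀ hden]
  rcases hτ with rfl | rfl
  · unfold den
    by_cases hqR : q < R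
    · have := W.gap_barrier hR1 hD ⟨hq.1.le, hq.2.le⟩ hqR
      nlinarith
    · have h1 : 0 ≤ q * gap R D ε (z q) q * (q - R) :=
        mul_nonneg (by positivity) (by linarith)
      have h2 : 0 ≤ R * (D / 2 * (q * (1 - 1 * q)) ^ 2) := by positivity
      nlinarith
  · unfold den
    have h1 : 0 ≤ q * gap R D ε (z q) q * (q + R) := by positivity
    have h2 : 0 ≤ R * (D / 2 * (q * (1 - -1 * q)) ^ 2) := by positivity
    nlinarith

/-- The quotient `q / n(q)` is nondecreasing along a wedge. -/
theorem monotoneOn_mul_exp (hτ : τ = 1 ∨ τ = -1) (hR : 0 < R) (hR1 : R ≠ 1) (hD : 0 < D)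
    (W : Wedge τ R D ε L z a b) :
    MonotoneOn (fun q => q * Real.exp (-((1 - R) * z q))) (Set.Icc a b) := by
  refine monotoneOn_Icc_of_hasDerivAt_nonneg_off τ ?_ fun q hq hqτ => ?_
  · exact continuousOn_id.mul (Real.continuous_exp.comp_continuousOn
      (continuousOn_const.mul W.cont).neg)
  · have hd := (hasDerivAt_id q).mul (((W.deriv q hq hqτ).const_mul (1 - R)).neg.exp)
    refine ⟨_, ?_, hd⟩
    have hq0 : 0 < q := W.pos.trans hq.1
    have hr := W.rate_pos hq hqτ
    set κ := rate τ D q (gap R D ε (z q) q) with hκ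
    have key : 0 ≤ 1 + (1 - R) * q ^ 2 * κ / R := by
      rcases lt_or_gt_of_ne hR1 with h | h
      · have : 0 < 1 - R := by linarith
        positivity
      · have := W.rate_mul_sq_le hτ h hD hq hqτ
        rw [← hκ] at this
        have h2 : 1 + (1 - R) * q ^ 2 * κ / R = (R - (R - 1) * q ^ 2 * κ) / R := by
          field_simp; ring
        rw [h2]; exact div_nonneg (by linarith) hR.le
    have e : 1 * Real.exp (-((1 - R) * z q)) + id q * (Real.exp (-((1 - R) * z q)) *
      -((1 - R) * (-(q / R) * κ))) = Real.exp (-((1 - R) * z q)) * (1 + (1 - R) * q ^ 2 * κ / R) := by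
      simp only [id_eq]; ring
    rw [show (-fun y => (1 - R) * z y) q = -((1 - R) * z q) from rfl, e]
    positivity

/-- Order preservation: for drifts `ε₁ ≤ ε₂`, once the second gap is at least the first, it
remains so. Where the second gap is smaller, `log (n₂ / n₁) / (1 - R)` does not decrease, which
is incompatible with the monotonicity of `q / n₁`. -/
theorem gap_le_gap {ε₁ ε₂ L₁ L₂ a₁ b₁ a₂ b₂ : ℝ} {z₁ z₂ : ℝ → ℝ} (hτ : τ = 1 ∨ τ = -1)
    (hR : 0 < R) (hR1 : R ≠ 1) (hD : 0 < D) (W₁ : Wedge τ R D ε₁ L₁ z₁ a₁ b₁)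
    (W₂ : Wedge τ R D ε₂ L₂ z₂ a₂ b₂) (hε : ε₁ ≤ ε₂) {p q : ℝ} (hp₁ : a₁ ≤ p) (hp₂ : a₂ ≤ p)
    (hpq : p ≤ q) (hq₁ : q ≤ b₁) (hq₂ : q ≤ b₂)
    (hp : gap R D ε₁ (z₁ p) p ≤ gap R D ε₂ (z₂ p) p) :
    gap R D ε₁ (z₁ q) q ≤ gap R D ε₂ (z₂ q) q := by
  by_contra hneg
  obtain ⟨c, hc, hc0, hlt⟩ := exists_last_nonpos
    (f := fun q => gap R D ε₁ (z₁ q) q - gap R D ε₂ (z₂ q) q) hpq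
    ((W₁.contGap.mono (Set.Icc_subset_Icc hp₁ hq₁)).sub
      (W₂.contGap.mono (Set.Icc_subset_Icc hp₂ hq₂))) (by linarith) (by linarith)
  have hm : MonotoneOn (fun q => z₂ q - z₁ q) (Set.Icc c q) := by
    refine monotoneOn_Icc_of_hasDerivAt_nonneg_off τ
      ((W₂.cont.mono (Set.Icc_subset_Icc (hp₂.trans hc.1) hq₂)).sub
        (W₁.cont.mono (Set.Icc_subset_Icc (hp₁.trans hc.1) hq₁))) fun t ht htτ => ?_
    have ht₁ : t ∈ Set.Ioo a₁ b₁ := ⟨(hp₁.trans hc.1).trans_lt ht.1, ht.2.trans_le hq₁⟩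
    have ht₂ : t ∈ Set.Ioo a₂ b₂ := ⟨(hp₂.trans hc.1).trans_lt ht.1, ht.2.trans_le hq₂⟩
    refine ⟨_, ?_, (W₂.deriv t ht₂ htτ).sub (W₁.deriv t ht₁ htτ)⟩
    have hr := rate_le_rate hD (sub_pos.mp (hlt t ⟨ht.1, ht.2.le⟩)).le (W₂.den_pos t ht₂ htτ)
      (W₁.den_pos t ht₁ htτ)
    have : 0 ≤ t / R := (div_pos (W₁.pos.trans ht₁.1) hR).le
    nlinarith [mul_le_mul_of_nonneg_left hr this]
  have h1 := (crra_strictMono hR1).monotone (hm ⟨le_rfl, hc.2.le⟩ ⟨hc.2.le, le_rfl⟩ hc.2.le)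
  have h2 := W₁.monotoneOn_mul_exp hτ hR hR1 hD ⟨hp₁.trans hc.1, hc.2.le.trans hq₁⟩
    ⟨(hp₁.trans hc.1).trans hc.2.le, hq₁⟩ hc.2.le
  have key : ∀ t, crra R (z₂ t - z₁ t) = Real.exp (-((1 - R) * z₁ t)) *
      (gap R D ε₂ (z₂ t) t - gap R D ε₁ (z₁ t) t) - (ε₂ - ε₁) *
        (t * Real.exp (-((1 - R) * z₁ t))) := by
    intro t
    have e1 : gap R D ε₂ (z₂ t) t - gap R D ε₁ (z₁ t) t
        = Real.exp ((1 - R) * z₁ t) * crra R (z₂ t - z₁ t) + (ε₂ - ε₁) * t := by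
      rw [← crra_sub hR1]; unfold gap; ring
    rw [e1, Real.exp_neg]
    field_simp; ring
  simp only [key] at h1
  have h3 := mul_le_mul_of_nonneg_left h2 (sub_nonneg.mpr hε)
  have h4 : 0 ≤ Real.exp (-((1 - R) * z₁ c)) *
      (gap R D ε₂ (z₂ c) c - gap R D ε₁ (z₁ c) c) :=
    mul_nonneg (Real.exp_pos _).le (by linarith)
  have h5 : 0 < Real.exp (-((1 - R) * z₁ q)) *
      (gap R D ε₁ (z₁ q) q - gap R D ε₂ (z₂ q) q) :=
    mul_pos (Real.exp_pos _) (hlt q ⟨hc.2, le_rfl⟩)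
  simp only at h3
  linarith

end Wedge
end TransactionCosts

namespace TransactionCosts

/-! ### Uniqueness and monotonicity of the boundaries -/

namespace Wedge

variable {τ R D ε L a b : ℝ} {z : ℝ → ℝ}

theorem intervalIntegrable_sub (W : Wedge τ R D ε L z a b) {c d : ℝ} (hc : a ≤ c)
    (hcd : c ≤ d) (hd : d ≤ b) : IntervalIntegrable (fun q => rate τ D q (gap R D ε (z q) q))
      MeasureTheory.volume c d :=
  W.integrable.mono_set (by
    rw [Set.uIcc_of_le hcd, Set.uIcc_of_le W.lt.le]; exact Set.Icc_subset_Icc hc hd)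

theorem integral_nonneg (hτ : τ = 1 ∨ τ = -1) (W : Wedge τ R D ε L z a b) {c d : ℝ} (hc : a ≤ c)
    (hcd : c ≤ d) (hd : d ≤ b) : 0 ≤ ∫ q in c..d, rate τ D q (gap R D ε (z q) q) :=
  intervalIntegral.integral_nonneg hcd fun _ hq => W.rate_nonneg hτ ⟨hc.trans hq.1, hq.2.trans hd⟩

theorem integral_pos (W : Wedge τ R D ε L z a b) {c d : ℝ} (hc : a ≤ c)
    (hcd : c < d) (hd : d ≤ b) : 0 < ∫ q in c..d, rate τ D q (gap R D ε (z q) q) := by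
  have key : ∀ c d, a ≤ c → c < d → d ≤ b → τ ∉ Set.Ioo c d →
      0 < ∫ q in c..d, rate τ D q (gap R D ε (z q) q) := fun c d hc hcd hd hτ =>
    intervalIntegral.intervalIntegral_pos_of_pos_on (W.intervalIntegrable_sub hc hcd.le hd)
      (fun q hq => W.rate_pos ⟨hc.trans_lt hq.1, hq.2.trans_le hd⟩ fun h => hτ (h ▸ hq)) hcd
  by_cases hm : τ ∈ Set.Ioo c d
  · rw [← intervalIntegral.integral_add_adjacent_intervals
      (W.intervalIntegrable_sub hc hm.1.le (hm.2.le.trans hd))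
      (W.intervalIntegrable_sub (hc.trans hm.1.le) hm.2.le hd)]
    exact add_pos (key c τ hc hm.1 (hm.2.le.trans hd) fun h => lt_irrefl _ h.2)
      (key τ d (hc.trans hm.1.le) hm.2 hd fun h => lt_irrefl _ h.1)
  · exact key c d hc hcd hd hm

theorem integral_le_cost (hτ : τ = 1 ∨ τ = -1) (W : Wedge τ R D ε L z a b) {c d : ℝ} (hc : a ≤ c)
    (hcd : c ≤ d) (hd : d ≤ b) :
    (∫ q in c..d, rate τ D q (gap R D ε (z q) q)) ≤ L ∧
    ((∫ q in c..d, rate τ D q (gap R D ε (z q) q)) = L → a = c ∧ b = d) := by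
  have e := W.cost
  rw [← intervalIntegral.integral_add_adjacent_intervals
      (W.intervalIntegrable_sub le_rfl hc (hcd.trans hd))
      (W.intervalIntegrable_sub hc (hcd.trans hd) le_rfl),
    ← intervalIntegral.integral_add_adjacent_intervals
      (W.intervalIntegrable_sub hc hcd hd) (W.intervalIntegrable_sub (hc.trans hcd) hd le_rfl)] at e
  have h1 := W.integral_nonneg hτ le_rfl hc (hcd.trans hd)
  have h2 := W.integral_nonneg hτ (hc.trans hcd) hd le_rfl
  refine ⟨by linarith, fun h => ⟨?_, ?_⟩⟩
  · by_contra hne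
    have := W.integral_pos le_rfl (lt_of_le_of_ne hc hne) (hcd.trans hd)
    linarith
  · by_contra hne
    have := W.integral_pos (hc.trans hcd) (lt_of_le_of_ne hd (Ne.symm hne)) le_rfl
    linarith

variable {ε₁ ε₂ L₁ L₂ a₁ b₁ a₂ b₂ : ℝ} {z₁ z₂ : ℝ → ℝ}

theorem integral_rate_le (hτ : τ = 1 ∨ τ = -1) (hD : 0 < D) (W₁ : Wedge τ R D ε₁ L₁ z₁ a₁ b₁)
    (W₂ : Wedge τ R D ε₂ L₂ z₂ a₂ b₂) {c d : ℝ} (hcd : c ≤ d) (hc₁ : a₁ ≤ c) (hc₂ : a₂ ≤ c)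
    (hd₁ : d ≤ b₁) (hd₂ : d ≤ b₂)
    (h : ∀ q ∈ Set.Ioo c d, gap R D ε₁ (z₁ q) q ≤ gap R D ε₂ (z₂ q) q) :
    (∫ q in c..d, rate τ D q (gap R D ε₁ (z₁ q) q)) ≤
      ∫ q in c..d, rate τ D q (gap R D ε₂ (z₂ q) q) := by
  refine intervalIntegral.integral_mono_on_of_le_Ioo hcd (W₁.intervalIntegrable_sub hc₁ hcd hd₁)
    (W₂.intervalIntegrable_sub hc₂ hcd hd₂) fun q hq => ?_
  by_cases hqτ : q = τ
  · rw [rate_of_singular (sign_mul_eq_one hτ hqτ), rate_of_singular (sign_mul_eq_one hτ hqτ)]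
  · exact rate_le_rate hD (h q hq) (W₁.den_pos q ⟨hc₁.trans_lt hq.1, hq.2.trans_le hd₁⟩ hqτ)
      (W₂.den_pos q ⟨hc₂.trans_lt hq.1, hq.2.trans_le hd₂⟩ hqτ)

/-- If the sale point of the second wedge lies inside the first wedge, the first gap is positive
there: the only conceivable exception, the singular point, is excluded by the position of the
Merton lines. -/
theorem gap_pos_at_right (hτ : τ = 1 ∨ τ = -1) (hR : 0 < R) (hR1 : R ≠ 1) (hD : 0 < D)
    (W₁ : Wedge τ R D ε₁ L₁ z₁ a₁ b₁) (W₂ : Wedge τ R D ε₂ L₂ z₂ a₂ b₂) (hε : ε₁ ≤ ε₂)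
    (ha : a₁ < b₂) (hb : b₂ < b₁) : 0 < gap R D ε₁ (z₁ b₂) b₂ := by
  refine W₁.gap_pos b₂ ⟨ha, hb⟩ fun h => ?_
  have h1 := W₂.eq_of_right_singular hτ hR hR1 hD h
  have h2 := W₁.lt_of_singular hτ hR hR1 hD (h ▸ ha) (h ▸ hb)
  rw [← h] at h2
  linarith

/-- With the same cost, a wedge of the larger drift cannot start earlier: its gap would be
larger throughout, and so would be its cost. -/
theorem eq_of_left_le (hτ : τ = 1 ∨ τ = -1) (hR : 0 < R) (hR1 : R ≠ 1) (hD : 0 < D)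
    (W₁ : Wedge τ R D ε₁ L z₁ a₁ b₁) (W₂ : Wedge τ R D ε₂ L z₂ a₂ b₂) (hε : ε₁ ≤ ε₂)
    (ha : a₂ ≤ a₁) : a₂ = a₁ ∧ b₂ = b₁ ∧
      ∀ q ∈ Set.Icc a₁ b₁, gap R D ε₁ (z₁ q) q ≤ gap R D ε₂ (z₂ q) q := by
  have hab : a₁ < b₂ := by
    have h1 := W₁.left_lt hτ hR hR1 hD
    have h2 := W₂.le_right
    exact lt_of_mul_lt_mul_left (by linarith) (mul_pos hD hR).le
  have hp : gap R D ε₁ (z₁ a₁) a₁ ≤ gap R D ε₂ (z₂ a₁) a₁ := by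
    rw [W₁.left]; exact W₂.gap_nonneg ⟨ha, hab.le⟩
  have hb : b₁ ≤ b₂ := by
    by_contra hb
    have h1 := gap_le_gap hτ hR hR1 hD W₁ W₂ hε le_rfl ha hab.le (not_le.mp hb).le le_rfl hp
    rw [W₂.right] at h1
    exact absurd h1 (not_le.mpr (gap_pos_at_right hτ hR hR1 hD W₁ W₂ hε hab (not_le.mp hb)))
  have hle : ∀ q ∈ Set.Icc a₁ b₁, gap R D ε₁ (z₁ q) q ≤ gap R D ε₂ (z₂ q) q := fun q hq =>
    gap_le_gap hτ hR hR1 hD W₁ W₂ hε le_rfl ha hq.1 hq.2 (hq.2.trans hb) hp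
  have h1 := integral_rate_le hτ hD W₁ W₂ W₁.lt.le le_rfl ha le_rfl hb
    fun q hq => hle q ⟨hq.1.le, hq.2.le⟩
  rw [W₁.cost] at h1
  obtain ⟨h2, h3⟩ := W₂.integral_le_cost hτ ha W₁.lt.le hb
  obtain ⟨h4, h5⟩ := h3 (le_antisymm h2 h1)
  exact ⟨h4, h5, hle⟩

theorem unique (hτ : τ = 1 ∨ τ = -1) (hR : 0 < R) (hR1 : R ≠ 1) (hD : 0 < D)
    (W₁ : Wedge τ R D ε L z₁ a₁ b₁) (W₂ : Wedge τ R D ε L z₂ a₂ b₂) : a₁ = a₂ ∧ b₁ = b₂ := by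
  rcases le_total a₁ a₂ with h | h
  · obtain ⟨h1, h2, -⟩ := eq_of_left_le hτ hR hR1 hD W₂ W₁ le_rfl h
    exact ⟨h1, h2⟩
  · obtain ⟨h1, h2, -⟩ := eq_of_left_le hτ hR hR1 hD W₁ W₂ le_rfl h
    exact ⟨h1.symm, h2.symm⟩

/-- Two wedges with the same sale point and different drifts: near that point the gap of the
larger drift is the smaller one. -/
theorem not_gap_le_of_right_eq (hε : ε₁ < ε₂) (W₁ : Wedge τ R D ε₁ L₁ z₁ a₁ b)
    (W₂ : Wedge τ R D ε₂ L₂ z₂ a₂ b) {c : ℝ} (hc₁ : a₁ ≤ c) (hc₂ : a₂ ≤ c) (hcb : c < b)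
    (h : ∀ q ∈ Set.Ioo c b, gap R D ε₁ (z₁ q) q ≤ gap R D ε₂ (z₂ q) q) : False := by
  have := hasDerivWithinAt_right_nonpos le_rfl hcb
    ((W₂.right_deriv.mono (Set.Icc_subset_Icc hc₂ le_rfl)).sub
      (W₁.right_deriv.mono (Set.Icc_subset_Icc hc₁ le_rfl)))
    (by simp only [Pi.sub_apply, W₂.right, W₁.right, sub_zero])
    (fun q hq => sub_nonneg.mpr (h q hq))
  linarith

/-- Both boundaries increase strictly with the drift. -/
theorem lt_and_lt (hτ : τ = 1 ∨ τ = -1) (hR : 0 < R) (hR1 : R ≠ 1) (hD : 0 < D)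
    (W₁ : Wedge τ R D ε₁ L z₁ a₁ b₁) (W₂ : Wedge τ R D ε₂ L z₂ a₂ b₂) (hε : ε₁ < ε₂) :
    a₁ < a₂ ∧ b₁ < b₂ := by
  have ha : a₁ < a₂ := by
    by_contra ha
    obtain ⟨rfl, rfl, h⟩ := eq_of_left_le hτ hR hR1 hD W₁ W₂ hε.le (not_lt.mp ha)
    exact not_gap_le_of_right_eq hε W₁ W₂ le_rfl le_rfl W₁.lt
      fun q hq => h q ⟨hq.1.le, hq.2.le⟩
  refine ⟨ha, ?_⟩
  by_contra hb
  rw [not_lt] at hb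
  -- either the gaps cross, and the second one stays above, or the first wedge costs more
  by_cases hex : ∃ p ∈ Set.Ioo a₂ b₂, gap R D ε₁ (z₁ p) p ≤ gap R D ε₂ (z₂ p) p
  · obtain ⟨p, hp, hp2⟩ := hex
    have hle : ∀ q ∈ Set.Icc p b₂, gap R D ε₁ (z₁ q) q ≤ gap R D ε₂ (z₂ q) q := fun q hq =>
      gap_le_gap hτ hR hR1 hD W₁ W₂ hε.le (ha.le.trans hp.1.le) hp.1.le hq.1 (hq.2.trans hb) hq.2
        hp2
    have hbb : b₂ = b₁ := by
      by_contra hne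
      have h1 := hle b₂ ⟨hp.2.le, le_rfl⟩
      rw [W₂.right] at h1
      exact absurd h1 (not_le.mpr (gap_pos_at_right hτ hR hR1 hD W₁ W₂ hε.le
        (ha.trans W₂.lt) (lt_of_le_of_ne hb hne)))
    subst hbb
    exact not_gap_le_of_right_eq hε W₁ W₂ (ha.le.trans hp.1.le) hp.1.le hp.2
      fun q hq => hle q ⟨hq.1.le, hq.2.le⟩
  · push Not at hex
    have h1 := integral_rate_le hτ hD W₂ W₁ W₂.lt.le le_rfl ha.le le_rfl hb
      fun q hq => (hex q hq).le
    rw [W₂.cost] at h1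
    obtain ⟨h2, h3⟩ := W₁.integral_le_cost hτ ha.le W₂.lt.le hb
    exact ha.ne (h3 (le_antisymm h2 h1)).1

/-- Beyond the singular point the cost rate is below `1 / (q (q - τ))`, which bounds the total
cost in terms of the purchase point. -/
theorem cost_lt (hτ : τ = 1 ∨ τ = -1) (hD : 0 < D) (W : Wedge τ R D ε L z a b)
    (ha : τ < a) : L < τ * (Real.log a - Real.log (a - τ)) := by
  have ha0 := W.pos
  have hpos : ∀ q ∈ Set.Icc a b, 0 < q ∧ 0 < q - τ := fun q hq =>
    ⟨ha0.trans_le hq.1, sub_pos.mpr (ha.trans_le hq.1)⟩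
  have hF : ∀ q ∈ Set.uIcc a b, HasDerivAt (fun q => τ * (Real.log (q - τ) - Real.log q))
      (1 / (q * (q - τ))) q := by
    intro q hq
    rw [Set.uIcc_of_le W.lt.le] at hq
    obtain ⟨h1, h2⟩ := hpos q hq
    refine (((((hasDerivAt_id q).sub_const τ).log h2.ne').sub
      (Real.hasDerivAt_log h1.ne')).const_mul τ).congr_deriv ?_
    have h2' := h2.ne'
    simp only [id_eq]
    rcases hτ with rfl | rfl
    · field_simp; ring
    · field_simp; ring
  have hint : IntervalIntegrable (fun q => 1 / (q * (q - τ))) MeasureTheory.volume a b := by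
    apply ContinuousOn.intervalIntegrable
    rw [Set.uIcc_of_le W.lt.le]
    exact continuousOn_const.div (by fun_prop) fun q hq => (mul_pos (hpos q hq).1 (hpos q hq).2).ne'
  have hle : L ≤ ∫ q in a..b, 1 / (q * (q - τ)) := by
    rw [← W.cost]
    refine intervalIntegral.integral_mono_on_of_le_Ioo W.lt.le W.integrable hint fun q hq => ?_
    have hqτ : q ≠ τ := (ha.trans hq.1).ne'
    obtain ⟨h1, h2⟩ := hpos q ⟨hq.1.le, hq.2.le⟩
    unfold rate
    rw [div_le_div_iff₀ (W.den_pos q hq hqτ) (mul_pos h1 h2)]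
    unfold den
    have e : 0 ≤ D / 2 * (q * (1 - τ * q)) ^ 2 := by positivity
    rcases hτ with rfl | rfl <;> linarith
  rw [intervalIntegral.integral_eq_sub_of_hasDerivAt hF hint] at hle
  obtain ⟨h1, h2⟩ := hpos b ⟨W.lt.le, le_rfl⟩
  have hb : τ * (Real.log (b - τ) - Real.log b) < 0 := by
    rcases hτ with rfl | rfl
    · have := Real.log_lt_log h2 (by linarith : b - 1 < b)
      linarith
    · have := Real.log_lt_log h1 (by linarith : b < b - -1)
      linarith
  linarith

end Wedge
end TransactionCosts

namespace TransactionCosts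

/-! ### The capped cost rate -/

/-- The cost rate, set to zero where the gap is negative, capped at the level `k` and regularized
by `δ ≥ 0` in the denominator. The cap removes the singularity of the rate at its poles, and `δ > 0`
makes it Lipschitz in the gap. -/
noncomputable def capRate (τ D k δ q s : ℝ) : ℝ :=
  max s 0 / (max (den τ D q (max s 0)) (max s 0 / k) + δ)

variable {τ R D ε k δ q s : ℝ}

theorem capDen_nonneg (hk : 0 < k) : 0 ≤ max (den τ D q (max s 0)) (max s 0 / k) :=
  le_max_of_le_right (by positivity)

theorem capDen_pos (hD : 0 < D) (hk : 0 < k) (hq : q * (1 - τ * q) ≠ 0) :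
    0 < max (den τ D q (max s 0)) (max s 0 / k) := by
  rcases le_or_gt s 0 with h | h
  · rw [max_eq_right h]
    refine lt_max_of_lt_left ?_
    simp only [den, mul_zero, sub_zero]; positivity
  · rw [max_eq_left h.le]
    exact lt_max_of_lt_right (by positivity)

theorem capRate_nonneg (hk : 0 < k) (hδ : 0 ≤ δ) : 0 ≤ capRate τ D k δ q s :=
  div_nonneg (le_max_right _ _) (add_nonneg (capDen_nonneg hk) hδ)

theorem capRate_of_nonpos (hs : s ≤ 0) : capRate τ D k δ q s = 0 := by
  simp [capRate, max_eq_right hs]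

theorem capRate_le (hk : 0 < k) (hδ : 0 ≤ δ) : capRate τ D k δ q s ≤ k := by
  rcases le_or_gt s 0 with h | h
  · rw [capRate_of_nonpos h]; exact hk.le
  · unfold capRate
    have h1 : max s 0 / k ≤ max (den τ D q (max s 0)) (max s 0 / k) := le_max_right _ _
    have h2 : 0 < max s 0 / k := by rw [max_eq_left h.le]; positivity
    rw [div_le_iff₀ (by linarith)]
    have h3 : max s 0 = k * (max s 0 / k) := by field_simp
    nlinarith

theorem capRate_mono (hD : 0 < D) (hk : 0 < k) (hδ : 0 ≤ δ) {t : ℝ} (hst : s ≤ t) :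
    capRate τ D k δ q s ≤ capRate τ D k δ q t := by
  rcases le_or_gt s 0 with h | h
  · rw [capRate_of_nonpos h]; exact capRate_nonneg hk hδ
  have ht : 0 < t := h.trans_le hst
  unfold capRate
  rw [max_eq_left h.le, max_eq_left ht.le]
  have h1 : 0 < max (den τ D q s) (s / k) := lt_max_of_lt_right (by positivity)
  have h2 : 0 < max (den τ D q t) (t / k) := lt_max_of_lt_right (by positivity)
  rw [div_le_div_iff₀ (by linarith) (by linarith)]
  have h3 : s * max (den τ D q t) (t / k) ≤ t * max (den τ D q s) (s / k) := by
    rw [mul_max_of_nonneg _ _ h.le, mul_max_of_nonneg _ _ ht.le]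
    refine max_le_max ?_ (by rw [mul_div_assoc', mul_div_assoc', mul_comm])
    unfold den
    nlinarith [mul_nonneg (sub_nonneg.mpr hst) (mul_nonneg hD.le (sq_nonneg (q * (1 - τ * q))))]
  nlinarith

theorem capRate_antitone (hk : 0 < k) (hδ : 0 ≤ δ) {δ' : ℝ} (h : δ ≤ δ') :
    capRate τ D k δ' q s ≤ capRate τ D k δ q s := by
  rcases le_or_gt s 0 with hs | hs
  · rw [capRate_of_nonpos hs, capRate_of_nonpos hs]
  unfold capRate
  have h1 : 0 < max (den τ D q (max s 0)) (max s 0 / k) :=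
    lt_max_of_lt_right (by rw [max_eq_left hs.le]; positivity)
  exact div_le_div_of_nonneg_left (le_max_right _ _) (by linarith) (by linarith)

theorem continuousAt_capRate {p : ℝ × ℝ × ℝ}
    (h : max (den τ D p.2.1 (max p.2.2 0)) (max p.2.2 0 / k) + p.1 ≠ 0) :
    ContinuousAt (fun p : ℝ × ℝ × ℝ => capRate τ D k p.1 p.2.1 p.2.2) p := by
  unfold capRate
  refine ContinuousAt.div (by fun_prop) ?_ h
  unfold den
  fun_prop

theorem abs_capRate_sub_le (hk : 0 < k) (hδ : 0 < δ) (s t : ℝ) :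
    |capRate τ D k δ q s - capRate τ D k δ q t| ≤
      (2 + k * (|q * (1 - τ * q)| * |τ|)) / δ * |s - t| := by
  unfold capRate
  set v := max s 0
  set w := max t 0
  have hvw : |v - w| ≤ |s - t| := abs_max_sub_max_le_abs s t 0
  set G := max (den τ D q v) (v / k)
  set H := max (den τ D q w) (w / k)
  have hG : 0 ≤ G := capDen_nonneg hk
  have hH : 0 ≤ H := capDen_nonneg hk
  have hw : 0 ≤ w := le_max_right _ _
  have hwH : w ≤ k * (H + δ) := by
    have : w / k ≤ H := le_max_right _ _
    rw [div_le_iff₀ hk] at this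
    nlinarith
  have hHG : |H - G| ≤ (|q * (1 - τ * q)| * |τ| + 1 / k) * |v - w| := by
    refine (abs_max_sub_max_le_max _ _ _ _).trans (max_le ?_ ?_)
    · have : den τ D q w - den τ D q v = (q * (1 - τ * q)) * τ * (v - w) := by unfold den; ring
      rw [this, abs_mul, abs_mul]
      have : 0 ≤ 1 / k * |v - w| := by positivity
      linarith
    · have : w / k - v / k = (1 / k) * (w - v) := by ring
      rw [this, abs_mul, abs_of_pos (by positivity : 0 < 1 / k), abs_sub_comm]
      have : 0 ≤ |q * (1 - τ * q)| * |τ| * |v - w| := by positivity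
      linarith
  have hGδ : 0 < G + δ := by linarith
  have hHδ : 0 < H + δ := by linarith
  have e : v / (G + δ) - w / (H + δ) = ((v - w) * (H + δ) + w * (H - G)) / ((G + δ) * (H + δ)) := by
    field_simp; ring
  set A := |q * (1 - τ * q)| * |τ| with hA
  have hA0 : 0 ≤ A := by positivity
  have h1 : |(v - w) * (H + δ) + w * (H - G)| ≤ (2 + k * A) * |v - w| * (H + δ) := by
    refine (abs_add_le _ _).trans ?_
    rw [abs_mul, abs_mul, abs_of_pos hHδ, abs_of_nonneg hw]
    have h2 : w * |H - G| ≤ k * (H + δ) * ((A + 1 / k) * |v - w|) :=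
      mul_le_mul hwH hHG (abs_nonneg _) (by positivity)
    have h3 : k * (H + δ) * ((A + 1 / k) * |v - w|) = (1 + k * A) * |v - w| * (H + δ) := by
      field_simp; ring
    linarith
  rw [e, abs_div, abs_of_pos (mul_pos hGδ hHδ), div_le_iff₀ (mul_pos hGδ hHδ)]
  have h4 : (2 + k * A) * |v - w| ≤ (2 + k * A) / δ * |s - t| * (G + δ) := by
    have h5 : (2 + k * A) * |v - w| ≤ (2 + k * A) * |s - t| := by gcongr
    have h6 : (2 + k * A) * |s - t| = (2 + k * A) / δ * |s - t| * δ := by field_simp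
    have h7 : (2 + k * A) / δ * |s - t| * δ ≤ (2 + k * A) / δ * |s - t| * (G + δ) := by
      gcongr; linarith
    linarith
  nlinarith [mul_le_mul_of_nonneg_right h4 hHδ.le]

end TransactionCosts

/-! ### Trajectories of the capped equation -/

theorem aestronglyMeasurable_of_continuousWithinAt_off {f : ℝ → ℝ} {a b p : ℝ}
    (h : ∀ t ∈ Set.Icc a b, t ≠ p → ContinuousWithinAt f (Set.Icc a b) t) :
    MeasureTheory.AEStronglyMeasurable f (MeasureTheory.volume.restrict (Set.Icc a b)) := by
  have e : MeasureTheory.volume.restrict (Set.Icc a b \ {p}) =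
      MeasureTheory.volume.restrict (Set.Icc a b) :=
    MeasureTheory.Measure.restrict_congr_set
      (MeasureTheory.sdiff_null_ae_eq_self (by simp))
  rw [← e]
  exact ContinuousOn.aestronglyMeasurable
    (fun t ht => (h t ht.1 ht.2).mono Set.sdiff_subset)
    (measurableSet_Icc.diff (measurableSet_singleton p))

theorem intervalIntegrable_of_continuousWithinAt_off {f : ℝ → ℝ} {a b p C : ℝ} (hab : a ≤ b)
    (h : ∀ t ∈ Set.Icc a b, t ≠ p → ContinuousWithinAt f (Set.Icc a b) t)
    (hC : ∀ t ∈ Set.Icc a b, |f t| ≤ C) : IntervalIntegrable f MeasureTheory.volume a b := by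
  rw [intervalIntegrable_iff_integrableOn_Icc_of_le hab]
  exact MeasureTheory.IntegrableOn.of_bound (by simp)
    (aestronglyMeasurable_of_continuousWithinAt_off h) C
    (MeasureTheory.ae_restrict_of_forall_mem measurableSet_Icc hC)

namespace TransactionCosts

variable {τ R D ε k δ M a₀ c : ℝ}

/-- The right-hand side of the equation for `z = log n / (1 - R)`, with capped and regularized
cost rate. -/
noncomputable def capField (τ R D ε k δ t x : ℝ) : ℝ :=
  -(t / R) * capRate τ D k δ t (gap R D ε x t)

theorem abs_capField_le (hR : 0 < R) (hk : 0 < k) (hδ : 0 ≤ δ) {t x : ℝ} (ht : 0 ≤ t)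
    (htM : t ≤ M) : |capField τ R D ε k δ t x| ≤ M / R * k := by
  unfold capField
  rw [neg_mul, abs_neg, abs_mul, abs_of_nonneg (by positivity : 0 ≤ t / R),
    abs_of_nonneg (capRate_nonneg hk hδ)]
  have := capRate_le (τ := τ) (D := D) (q := t) (s := gap R D ε x t) hk hδ
  have := capRate_nonneg (τ := τ) (D := D) (q := t) (s := gap R D ε x t) hk hδ
  have : 0 ≤ M := ht.trans htM
  gcongr

theorem exists_lipschitz_crra (hR1 : R ≠ 1) (c A : ℝ) :
    ∃ C : ℝ, 0 ≤ C ∧ ∀ x ∈ Metric.closedBall c A, ∀ y ∈ Metric.closedBall c A,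
      |crra R x - crra R y| ≤ C * |x - y| := by
  obtain ⟨C, hC⟩ := (isCompact_closedBall c A).exists_bound_of_continuousOn
    (f := fun z => Real.exp ((1 - R) * z)) (by fun_prop)
  refine ⟨max C 0, le_max_right _ _, fun x hx y hy => ?_⟩
  have := (convex_closedBall c A).norm_image_sub_le_of_norm_hasDerivWithin_le
    (fun z _ => (hasDerivAt_crra hR1 z).hasDerivWithinAt)
    (fun z hz => (hC z hz).trans (le_max_left C 0)) hy hx
  simpa using this

theorem exists_regular_trajectory (ε : ℝ) (hR : 0 < R) (hR1 : R ≠ 1) (hk : 0 < k)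
    (hδ : 0 < δ) (ha₀ : 0 < a₀) (hM : a₀ ≤ M) (τ D c : ℝ) :
    ∃ z : ℝ → ℝ, z a₀ = c ∧ ∀ t ∈ Set.Icc a₀ M,
      HasDerivWithinAt z (capField τ R D ε k δ t (z t)) (Set.Icc a₀ M) t := by
  have hM0 : 0 < M := ha₀.trans_le hM
  set B : ℝ := M / R * k with hB
  have hB0 : 0 ≤ B := by positivity
  set A : ℝ := B * (M - a₀) with hA
  have hA0 : 0 ≤ A := mul_nonneg hB0 (by linarith)
  obtain ⟨C, hC0, hC⟩ := exists_lipschitz_crra hR1 c A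
  set X : ℝ := M * (1 + |τ| * M) * |τ| with hX
  set K : ℝ := M / R * ((2 + k * X) / δ * C) with hK
  have hK0 : 0 ≤ K := by positivity
  have hPL : IsPicardLindelof (capField τ R D ε k δ) (tmin := a₀) (tmax := M) ⟨a₀, le_rfl, hM⟩ c
      ⟨A, hA0⟩ 0 ⟨B, hB0⟩ ⟨K, hK0⟩ := by
    refine ⟨fun t ht => ?_, fun x _ => ?_, fun t ht x _ => ?_, ?_⟩
    · refine LipschitzOnWith.of_dist_le_mul fun x hx y hy => ?_
      have ht0 : 0 < t := ha₀.trans_le ht.1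
      rw [Real.dist_eq, Real.dist_eq]
      unfold capField
      rw [← mul_sub, neg_mul, abs_neg, abs_mul, abs_of_nonneg (by positivity : 0 ≤ t / R)]
      have h1 := abs_capRate_sub_le (τ := τ) (D := D) (q := t) hk hδ (gap R D ε x t) (gap R D ε y t)
      have h2 : gap R D ε x t - gap R D ε y t = crra R x - crra R y := by unfold gap; ring
      rw [h2] at h1
      have h3 : |t * (1 - τ * t)| * |τ| ≤ X := by
        rw [hX, abs_mul, abs_of_pos ht0]
        have : |1 - τ * t| ≤ 1 + |τ| * M := by
          refine (abs_sub _ _).trans ?_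
          rw [abs_one, abs_mul, abs_of_pos ht0]
          gcongr; exact ht.2
        gcongr; exact ht.2
      have h4 := hC x hx y hy
      calc t / R * _ ≤ t / R * ((2 + k * (|t * (1 - τ * t)| * |τ|)) / δ * |crra R x - crra R y|) := by
            gcongr
        _ ≤ M / R * ((2 + k * X) / δ * (C * |x - y|)) := by
            gcongr; exact ht.2
        _ = K * |x - y| := by rw [hK]; ring
    · unfold capField
      refine ContinuousOn.mul (by fun_prop) fun t ht => ?_
      have hg : Continuous fun t : ℝ => ((δ, t, gap R D ε x t) : ℝ × ℝ × ℝ) := by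
        unfold gap; fun_prop
      have : ContinuousAt (fun t : ℝ => capRate τ D k δ t (gap R D ε x t)) t :=
        ContinuousAt.comp (f := fun t : ℝ => ((δ, t, gap R D ε x t) : ℝ × ℝ × ℝ))
          (g := fun p : ℝ × ℝ × ℝ => capRate τ D k p.1 p.2.1 p.2.2)
          (continuousAt_capRate (by
            have := capDen_nonneg (τ := τ) (D := D) (q := t) (s := gap R D ε x t) hk
            exact (add_pos_of_nonneg_of_pos this hδ).ne')) hg.continuousAt
      exact this.continuousWithinAt
    · exact abs_capField_le hR hk hδ.le (ha₀.le.trans ht.1) ht.2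
    · simp only [sub_self, NNReal.coe_zero, sub_zero]
      rw [max_eq_left (by linarith)]
      exact le_rfl
  exact hPL.exists_eq_forall_mem_Icc_hasDerivWithinAt₀

/-- Solutions of the capped equation on `[a₀, M]` with initial value `c`; the equation need not
hold at the singular point `τ`. -/
structure IsTrajectory (τ R D ε k a₀ M c : ℝ) (z : ℝ → ℝ) : Prop where
  init : z a₀ = c
  cont : ContinuousOn z (Set.Icc a₀ M)
  deriv : ∀ t ∈ Set.Ioo a₀ M, t ≠ τ → HasDerivAt z (capField τ R D ε k 0 t (z t)) t

/-- The field decreases in the state and increases with the regularization. -/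
theorem capField_le_capField (hR : 0 < R) (hR1 : R ≠ 1) (hD : 0 < D) (hk : 0 < k) {δ' t x y : ℝ}
    (hδ : 0 ≤ δ) (hδ' : δ ≤ δ') (ht : 0 ≤ t) (hxy : x ≤ y) :
    capField τ R D ε k δ t y ≤ capField τ R D ε k δ' t x := by
  unfold capField
  have h1 : gap R D ε x t ≤ gap R D ε y t := by
    have := (crra_strictMono hR1).monotone hxy
    unfold gap; linarith
  have h2 := capRate_mono (τ := τ) (q := t) hD hk hδ h1
  have h3 := capRate_antitone (τ := τ) (D := D) (q := t) (s := gap R D ε x t) hk hδ hδ'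
  have : 0 ≤ t / R := by positivity
  nlinarith [mul_le_mul_of_nonneg_left (h3.trans h2) this]

theorem continuousWithinAt_capRate_comp {g : ℝ → ℝ} {S : Set ℝ} {t : ℝ}
    (h : max (den τ D t (max (g t) 0)) (max (g t) 0 / k) + δ ≠ 0)
    (hg : ContinuousWithinAt g S t) :
    ContinuousWithinAt (fun t => capRate τ D k δ t (g t)) S t :=
  ContinuousAt.comp_continuousWithinAt (f := fun t : ℝ => ((δ, t, g t) : ℝ × ℝ × ℝ))
    (g := fun p : ℝ × ℝ × ℝ => capRate τ D k p.1 p.2.1 p.2.2)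
    (continuousAt_capRate h)
    (continuousWithinAt_const.prodMk (continuousWithinAt_id.prodMk hg))

theorem capDen_ne_zero (hτ : τ = 1 ∨ τ = -1) (hD : 0 < D) (hk : 0 < k) {t s : ℝ} (ht : 0 < t)
    (htτ : t ≠ τ) : max (den τ D t (max s 0)) (max s 0 / k) + 0 ≠ 0 := by
  rw [add_zero]
  exact (capDen_pos hD hk (mul_ne_zero ht.ne' (one_sub_sign_mul_ne_zero hτ htτ))).ne'

/-- Trajectories exist. The capped equation is not Lipschitz near `τ`; since the field decreases
in the state, the solutions of the regularized equations decrease with the regularization, and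
their limit is a solution. -/
theorem exists_trajectory (ε : ℝ) (hτ : τ = 1 ∨ τ = -1) (hR : 0 < R) (hR1 : R ≠ 1) (hD : 0 < D)
    (hk : 0 < k) (ha₀ : 0 < a₀) (hM : a₀ ≤ M) (c : ℝ) :
    ∃ z : ℝ → ℝ, IsTrajectory τ R D ε k a₀ M c z := by
  have hM0 : 0 < M := ha₀.trans_le hM
  set d : ℕ → ℝ := fun n => 1 / ((n : ℝ) + 1) with hd
  have hd0 : ∀ n, 0 < d n := fun n => by rw [hd]; positivity
  have hdlim : Filter.Tendsto d Filter.atTop (nhds 0) := tendsto_one_div_add_atTop_nhds_zero_nat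
  choose z hz0 hz using fun n => exists_regular_trajectory (M := M) ε hR hR1 hk (hd0 n) ha₀ hM τ D c
  have hcont : ∀ n, ContinuousOn (z n) (Set.Icc a₀ M) := fun n t ht => (hz n t ht).continuousWithinAt
  have hderiv : ∀ n, ∀ t ∈ Set.Ioo a₀ M, HasDerivAt (z n) (capField τ R D ε k (d n) t (z n t)) t :=
    fun n t ht => (hz n t ⟨ht.1.le, ht.2.le⟩).hasDerivAt (Icc_mem_nhds ht.1 ht.2)
  have hlip : ∀ n, ∀ s ∈ Set.Icc a₀ M, ∀ t ∈ Set.Icc a₀ M, |z n t - z n s| ≤ M / R * k * |t - s| := by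
    intro n s hs t ht
    exact (convex_Icc a₀ M).norm_image_sub_le_of_norm_hasDerivWithin_le (hz n)
      (fun x hx => abs_capField_le hR hk (hd0 n).le (ha₀.le.trans hx.1) hx.2) hs ht
  have hanti : ∀ t ∈ Set.Icc a₀ M, Antitone fun n => z n t := by
    intro t ht n m hnm
    have := nonpos_of_hasDerivAt_nonpos_of_pos (f := fun t => z m t - z n t) τ
      ((hcont m).sub (hcont n)) (by simp [hz0]) (fun s hs _ hpos => ⟨_, ?_,
        (hderiv m s hs).sub (hderiv n s hs)⟩) t ht
    · simpa using this
    · exact sub_nonpos.mpr (capField_le_capField hR hR1 hD hk (hd0 m).le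
        (Nat.one_div_le_one_div hnm) (ha₀.le.trans hs.1.le) (sub_pos.mp hpos).le)
  have hlim : ∀ t, ∃ l, t ∈ Set.Icc a₀ M → Filter.Tendsto (fun n => z n t) Filter.atTop (nhds l) := by
    intro t
    by_cases ht : t ∈ Set.Icc a₀ M
    · refine ⟨_, fun _ => tendsto_atTop_ciInf (hanti t ht) ⟨c - M / R * k * |t - a₀|, ?_⟩⟩
      rintro _ ⟨n, rfl⟩
      have := (abs_le.mp (hlip n a₀ ⟨le_rfl, hM⟩ t ht)).1
      rw [hz0] at this
      simp only; linarith
    · exact ⟨0, fun h => absurd h ht⟩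
  choose y hy using hlim
  have hyc : ContinuousOn y (Set.Icc a₀ M) := by
    have : LipschitzOnWith ⟨M / R * k, by positivity⟩ y (Set.Icc a₀ M) :=
      LipschitzOnWith.of_dist_le_mul fun t ht s hs => by
        rw [Real.dist_eq, Real.dist_eq]
        exact le_of_tendsto ((hy t ht).sub (hy s hs)).abs
          (Filter.Eventually.of_forall fun n => hlip n s hs t ht)
    exact this.continuousOn
  have hfcont : ∀ n, ContinuousOn (fun t => capField τ R D ε k (d n) t (z n t)) (Set.Icc a₀ M) :=
    fun n t ht => ContinuousWithinAt.mul (by fun_prop) (continuousWithinAt_capRate_comp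
      (add_pos_of_nonneg_of_pos (capDen_nonneg hk) (hd0 n)).ne' (continuousOn_gap (hcont n) t ht))
  have hgcont : ∀ t ∈ Set.Icc a₀ M, t ≠ τ →
      ContinuousWithinAt (fun t => capField τ R D ε k 0 t (y t)) (Set.Icc a₀ M) t :=
    fun t ht htτ => ContinuousWithinAt.mul (by fun_prop) (continuousWithinAt_capRate_comp
      (capDen_ne_zero hτ hD hk (ha₀.trans_le ht.1) htτ) (continuousOn_gap hyc t ht))
  have hbd : ∀ δ, 0 ≤ δ → ∀ t ∈ Set.Icc a₀ M, ∀ x, |capField τ R D ε k δ t x| ≤ M / R * k :=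
    fun δ hδ t ht x => abs_capField_le hR hk hδ (ha₀.le.trans ht.1) ht.2
  have hsub : ∀ t ∈ Set.Icc a₀ M, Set.uIoc a₀ t ⊆ Set.Icc a₀ M := fun t ht => by
    rw [Set.uIoc_of_le ht.1]; exact fun x hx => ⟨hx.1.le, hx.2.trans ht.2⟩
  have hmeas : MeasureTheory.AEStronglyMeasurable (fun t => capField τ R D ε k 0 t (y t))
      (MeasureTheory.volume.restrict (Set.Icc a₀ M)) :=
    aestronglyMeasurable_of_continuousWithinAt_off hgcont
  have hint : ∀ t ∈ Set.Icc a₀ M, IntervalIntegrable (fun t => capField τ R D ε k 0 t (y t))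
      MeasureTheory.volume a₀ t := fun t ht =>
    (intervalIntegrable_of_continuousWithinAt_off hM hgcont (hbd 0 le_rfl · · _)).mono_set (by
      rw [Set.uIcc_of_le ht.1, Set.uIcc_of_le hM]; exact Set.Icc_subset_Icc le_rfl ht.2)
  have hyint : ∀ t ∈ Set.Icc a₀ M, y t = c + ∫ s in a₀..t, capField τ R D ε k 0 s (y s) := by
    intro t ht
    have h1 : ∀ n, z n t = c + ∫ s in a₀..t, capField τ R D ε k (d n) s (z n s) := by
      intro n
      rw [intervalIntegral.integral_eq_sub_of_hasDerivAt_of_le ht.1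
        ((hcont n).mono (Set.Icc_subset_Icc le_rfl ht.2))
        (fun s hs => hderiv n s ⟨hs.1, hs.2.trans_le ht.2⟩) ?_, hz0]
      · ring
      · exact ((hfcont n).mono (by
          rw [Set.uIcc_of_le ht.1]; exact Set.Icc_subset_Icc le_rfl ht.2)).intervalIntegrable
    have h2 : Filter.Tendsto (fun n => ∫ s in a₀..t, capField τ R D ε k (d n) s (z n s))
        Filter.atTop (nhds (∫ s in a₀..t, capField τ R D ε k 0 s (y s))) := by
      refine intervalIntegral.tendsto_integral_filter_of_dominated_convergence
        (fun _ => M / R * k) (Filter.Eventually.of_forall fun n => ?_)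
        (Filter.Eventually.of_forall fun n => ?_) intervalIntegrable_const ?_
      · exact ((hfcont n).mono (hsub t ht)).aestronglyMeasurable measurableSet_uIoc
      · exact Filter.Eventually.of_forall fun s hs => hbd _ (hd0 n).le s (hsub t ht hs) _
      · have : ∀ᵐ s : ℝ, s ≠ τ := MeasureTheory.Measure.ae_ne _ τ
        filter_upwards [this] with s hsτ hs
        have hs' := hsub t ht hs
        have hcA := continuousAt_capRate (τ := τ) (D := D) (k := k)
          (p := (0, s, gap R D ε (y s) s))
          (capDen_ne_zero hτ hD hk (ha₀.trans_le hs'.1) hsτ)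
        have hgl : Filter.Tendsto (fun n => gap R D ε (z n s) s) Filter.atTop
            (nhds (gap R D ε (y s) s)) := by
          have : Continuous fun x => gap R D ε x s := by
            unfold gap; have := continuous_crra (R := R); fun_prop
          exact (this.tendsto _).comp (hy s hs')
        exact (hcA.tendsto.comp (hdlim.prodMk_nhds (tendsto_const_nhds.prodMk_nhds hgl))).const_mul _
    have h3 := (h2.const_add c)
    simp only [← h1] at h3
    exact tendsto_nhds_unique (hy t ht) h3
  refine ⟨y, ?_, hyc, fun t ht htτ => ?_⟩
  · have := hyint a₀ ⟨le_rfl, hM⟩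
    simpa using this
  · have ht' : t ∈ Set.Icc a₀ M := ⟨ht.1.le, ht.2.le⟩
    have hnb : Set.Icc a₀ M ∈ nhds t := Icc_mem_nhds ht.1 ht.2
    have h1 := intervalIntegral.integral_hasDerivAt_right (hint t ht')
      ⟨Set.Icc a₀ M, hnb, hmeas⟩ ((hgcont t ht' htτ).continuousAt hnb)
    exact (h1.const_add c).congr_of_eventuallyEq (by
      filter_upwards [hnb] with s hs using hyint s hs)

end TransactionCosts

namespace TransactionCosts

/-! ### The gap along trajectories -/

namespace IsTrajectory

variable {τ R D ε k M a₀ c a : ℝ} {z : ℝ → ℝ}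

theorem contGap (T : IsTrajectory τ R D ε k a₀ M c z) :
    ContinuousOn (fun q => gap R D ε (z q) q) (Set.Icc a₀ M) := continuousOn_gap T.cont

theorem capField_nonpos (hR : 0 < R) (hk : 0 < k) {t x : ℝ} (ht : 0 ≤ t) :
    capField τ R D ε k 0 t x ≤ 0 := by
  unfold capField
  have := capRate_nonneg (τ := τ) (D := D) (q := t) (s := gap R D ε x t) hk le_rfl
  rw [neg_mul]
  exact neg_nonpos.mpr (by positivity)

theorem antitoneOn (hR : 0 < R) (hk : 0 < k) (ha₀ : 0 < a₀)
    (T : IsTrajectory τ R D ε k a₀ M c z) : AntitoneOn z (Set.Icc a₀ M) :=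
  antitoneOn_Icc_of_hasDerivAt_nonpos_off τ T.cont fun q hq hqτ =>
    ⟨_, capField_nonpos hR hk (ha₀.trans hq.1).le, T.deriv q hq hqτ⟩

theorem gap_le (hR : 0 < R) (hR1 : R ≠ 1) (hk : 0 < k) (ha₀ : 0 < a₀)
    (T : IsTrajectory τ R D ε k a₀ M c z) {p q : ℝ} (hp : p ∈ Set.Icc a₀ M)
    (hq : q ∈ Set.Icc a₀ M) (hpq : p ≤ q) :
    gap R D ε (z q) q ≤ gap R D ε (z p) p + (q - p) * (ε - D * R / 2 * (p + q)) := by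
  have := (crra_strictMono hR1).monotone (T.antitoneOn hR hk ha₀ hp hq hpq)
  unfold gap
  nlinarith

/-- Trajectories keep their order and approach each other, because the field decreases in the
state. -/
theorem le_of_init_le {c' : ℝ} {z' : ℝ → ℝ} (hR : 0 < R) (hR1 : R ≠ 1) (hD : 0 < D)
    (hk : 0 < k) (ha₀ : 0 < a₀) (T : IsTrajectory τ R D ε k a₀ M c z)
    (T' : IsTrajectory τ R D ε k a₀ M c' z') (hc : c ≤ c') {t : ℝ} (ht : t ∈ Set.Icc a₀ M) :
    z t ≤ z' t ∧ z' t - z t ≤ c' - c := by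
  constructor
  · have := nonpos_of_hasDerivAt_nonpos_of_pos (f := fun t => z t - z' t) τ
      (T.cont.sub T'.cont) (by simp [T.init, T'.init, hc]) (fun s hs hsτ hpos => ⟨_, ?_,
        (T.deriv s hs hsτ).sub (T'.deriv s hs hsτ)⟩) t ht
    · simpa using this
    · exact sub_nonpos.mpr (capField_le_capField hR hR1 hD hk le_rfl le_rfl
        (ha₀.trans hs.1).le (sub_pos.mp hpos).le)
  · have := nonpos_of_hasDerivAt_nonpos_of_pos (f := fun t => z' t - z t - (c' - c)) τ
      ((T'.cont.sub T.cont).sub continuousOn_const) (by simp [T.init, T'.init])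
      (fun s hs hsτ hpos => ⟨_, ?_,
        ((T'.deriv s hs hsτ).sub (T.deriv s hs hsτ)).sub_const (c' - c)⟩) t ht
    · simpa using this
    · exact sub_nonpos.mpr (capField_le_capField hR hR1 hD hk le_rfl le_rfl
        (ha₀.trans hs.1).le (by linarith))

/-- Trajectories depend on their initial value in a nonexpansive way. -/
theorem abs_sub_le {c' : ℝ} {z' : ℝ → ℝ} (hR : 0 < R) (hR1 : R ≠ 1) (hD : 0 < D)
    (hk : 0 < k) (ha₀ : 0 < a₀) (T : IsTrajectory τ R D ε k a₀ M c z)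
    (T' : IsTrajectory τ R D ε k a₀ M c' z') {t : ℝ} (ht : t ∈ Set.Icc a₀ M) :
    |z t - z' t| ≤ |c - c'| := by
  rcases le_total c c' with h | h
  · obtain ⟨h1, h2⟩ := le_of_init_le hR hR1 hD hk ha₀ T T' h ht
    rw [abs_of_nonpos (by linarith), abs_of_nonpos (by linarith)]; linarith
  · obtain ⟨h1, h2⟩ := le_of_init_le hR hR1 hD hk ha₀ T' T h ht
    rw [abs_of_nonneg (by linarith), abs_of_nonneg (by linarith)]; linarith

theorem continuousWithinAt_capRate (hτ : τ = 1 ∨ τ = -1) (hD : 0 < D) (hk : 0 < k) (ha₀ : 0 < a₀)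
    (T : IsTrajectory τ R D ε k a₀ M c z) {t : ℝ} (ht : t ∈ Set.Icc a₀ M) (htτ : t ≠ τ) :
    ContinuousWithinAt (fun t => capRate τ D k 0 t (gap R D ε (z t) t)) (Set.Icc a₀ M) t :=
  continuousWithinAt_capRate_comp (capDen_ne_zero hτ hD hk (ha₀.trans_le ht.1) htτ)
    (T.contGap t ht)

theorem intervalIntegrable_capRate (hτ : τ = 1 ∨ τ = -1) (hD : 0 < D) (hk : 0 < k) (ha₀ : 0 < a₀)
    (hM : a₀ ≤ M) (T : IsTrajectory τ R D ε k a₀ M c z) :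
    IntervalIntegrable (fun t => capRate τ D k 0 t (gap R D ε (z t) t))
      MeasureTheory.volume a₀ M :=
  intervalIntegrable_of_continuousWithinAt_off (p := τ) (C := k) hM
    (fun _ ht htτ => T.continuousWithinAt_capRate hτ hD hk ha₀ ht htτ)
    (fun t _ => by
      rw [abs_of_nonneg (capRate_nonneg hk le_rfl)]; exact capRate_le hk le_rfl)

/-- Outside the interval symmetric about the Merton line `ε / (D R)` on which the constant
`e ^ ((1 - R) c)` lies on the far side of `m`, the gap is not positive. -/
theorem gap_nonpos (hR : 0 < R) (hR1 : R ≠ 1) (hk : 0 < k) (ha₀ : 0 < a₀)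
    (T : IsTrajectory τ R D ε k a₀ M c z) (hc : gap R D ε c a = 0) {q : ℝ}
    (hq : q ∈ Set.Icc a₀ M) (h : 0 ≤ (q - a) * (D * R / 2 * (q + a) - ε)) :
    gap R D ε (z q) q ≤ 0 := by
  have h1 : z q ≤ c := by
    rw [← T.init]
    exact T.antitoneOn hR hk ha₀ ⟨le_rfl, hq.1.trans hq.2⟩ hq hq.1
  have h2 := (crra_strictMono hR1).monotone h1
  have : gap R D ε c q = gap R D ε c a - (q - a) * (D * R / 2 * (q + a) - ε) := by
    unfold gap; ring
  have : gap R D ε (z q) q ≤ gap R D ε c q := by unfold gap; linarith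
  linarith

theorem gap_nonpos_left (hR : 0 < R) (hR1 : R ≠ 1) (hD : 0 < D) (hk : 0 < k) (ha₀ : 0 < a₀)
    (T : IsTrajectory τ R D ε k a₀ M c z) (hc : gap R D ε c a = 0) (ha : D * R * a ≤ ε) {q : ℝ}
    (hq : q ∈ Set.Icc a₀ M) (hqa : q ≤ a) : gap R D ε (z q) q ≤ 0 := by
  refine T.gap_nonpos hR hR1 hk ha₀ hc hq (mul_nonneg_of_nonpos_of_nonpos (by linarith) ?_)
  nlinarith [mul_pos hD hR]

theorem gap_nonpos_right (hR : 0 < R) (hR1 : R ≠ 1) (hk : 0 < k) (ha₀ : 0 < a₀)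
    (T : IsTrajectory τ R D ε k a₀ M c z) (hc : gap R D ε c a = 0) {q : ℝ}
    (hq : q ∈ Set.Icc a₀ M) (hqa : a ≤ q) (h : ε ≤ D * R / 2 * (q + a)) :
    gap R D ε (z q) q ≤ 0 :=
  T.gap_nonpos hR hR1 hk ha₀ hc hq (mul_nonneg (by linarith) (by linarith))

/-- A trajectory is constant as long as its gap is nonpositive, in particular up to the point `a`
at which the constant function reaches `m`. -/
theorem eq_init (hR : 0 < R) (hR1 : R ≠ 1) (hD : 0 < D) (hk : 0 < k) (ha₀ : 0 < a₀)
    (T : IsTrajectory τ R D ε k a₀ M c z) (hc : gap R D ε c a = 0) (ha : D * R * a ≤ ε)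
    (ha' : a ∈ Set.Icc a₀ M) : z a = c := by
  refine le_antisymm ?_ ?_
  · rw [← T.init]
    exact T.antitoneOn hR hk ha₀ ⟨le_rfl, ha'.1.trans ha'.2⟩ ha' ha'.1
  · rw [← T.init]
    refine monotoneOn_Icc_of_hasDerivAt_nonneg_off (a := a₀) (b := a) τ
      (T.cont.mono (Set.Icc_subset_Icc le_rfl ha'.2)) (fun q hq hqτ => ⟨_, ?_,
        T.deriv q ⟨hq.1, hq.2.trans_le ha'.2⟩ hqτ⟩) ⟨le_rfl, ha'.1⟩ ⟨ha'.1, le_rfl⟩ ha'.1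
    have := T.gap_nonpos_left hR hR1 hD hk ha₀ hc ha ⟨hq.1.le, hq.2.le.trans ha'.2⟩ hq.2.le
    simp [capField, capRate_of_nonpos this]

theorem gap_start (hR : 0 < R) (hR1 : R ≠ 1) (hD : 0 < D) (hk : 0 < k) (ha₀ : 0 < a₀)
    (T : IsTrajectory τ R D ε k a₀ M c z) (hc : gap R D ε c a = 0) (ha : D * R * a ≤ ε)
    (ha' : a ∈ Set.Icc a₀ M) : gap R D ε (z a) a = 0 := by
  rw [T.eq_init hR hR1 hD hk ha₀ hc ha ha', hc]

theorem hasDerivAt_gap_of_nonpos (hR1 : R ≠ 1) (T : IsTrajectory τ R D ε k a₀ M c z) {q : ℝ}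
    (hq : q ∈ Set.Ioo a₀ M) (hqτ : q ≠ τ) (h : gap R D ε (z q) q ≤ 0) :
    HasDerivAt (fun q => gap R D ε (z q) q) (ε - D * R * q) q := by
  refine (hasDerivAt_gap hR1 (T.deriv q hq hqτ)).congr_deriv ?_
  simp [capField, capRate_of_nonpos h]

/-- Up to the Merton line the gap is positive. -/
theorem gap_pos_left (hR : 0 < R) (hR1 : R ≠ 1) (hD : 0 < D) (hk : 0 < k) (ha₀ : 0 < a₀)
    (T : IsTrajectory τ R D ε k a₀ M c z) (hc : gap R D ε c a = 0) (ha' : a ∈ Set.Icc a₀ M)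
    {p : ℝ} (hp : p ∈ Set.Icc a M) (hpε : D * R * p ≤ ε) :
    0 ≤ gap R D ε (z p) p ∧ ∀ q ∈ Set.Ioo a p, q ≠ τ → 0 < gap R D ε (z q) q := by
  have hDR := mul_pos hD hR
  have h0 : ∀ q ∈ Set.Icc a p, -gap R D ε (z q) q ≤ 0 := by
    refine nonpos_of_hasDerivAt_nonpos_of_pos τ
      (T.contGap.mono (Set.Icc_subset_Icc ha'.1 hp.2)).neg ?_ fun q hq hqτ hpos => ?_
    · rw [T.gap_start hR hR1 hD hk ha₀ hc (by nlinarith [hp.1]) ha', neg_zero]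
    · refine ⟨_, ?_, (T.hasDerivAt_gap_of_nonpos hR1 ⟨ha'.1.trans_lt hq.1, hq.2.trans_le hp.2⟩ hqτ
        (by linarith)).neg⟩
      nlinarith [hq.2]
  refine ⟨by linarith [h0 p ⟨hp.1, le_rfl⟩], fun q hq hqτ => ?_⟩
  by_contra hneg
  have hz : gap R D ε (z q) q = 0 := le_antisymm (not_lt.mp hneg)
    (by linarith [h0 q ⟨hq.1.le, hq.2.le⟩])
  have hd := T.hasDerivAt_gap_of_nonpos hR1 ⟨ha'.1.trans_lt hq.1, hq.2.trans_le hp.2⟩ hqτ hz.le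
  have hmin : IsLocalMin (fun q => gap R D ε (z q) q) q := by
    filter_upwards [Icc_mem_nhds hq.1 hq.2] with t ht
    rw [hz]; linarith [h0 t ht]
  have := hmin.hasDerivAt_eq_zero hd
  nlinarith [hq.2]

/-- Once the gap vanishes beyond the Merton line it never becomes positive again. -/
theorem gap_nonpos_after (hR : 0 < R) (hR1 : R ≠ 1) (hD : 0 < D) (hk : 0 < k) (ha₀ : 0 < a₀)
    (T : IsTrajectory τ R D ε k a₀ M c z) {b : ℝ} (hb : b ∈ Set.Icc a₀ M) (hbε : ε ≤ D * R * b)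
    (h : gap R D ε (z b) b ≤ 0) {q : ℝ} (hq : q ∈ Set.Icc b M) : gap R D ε (z q) q ≤ 0 := by
  refine nonpos_of_hasDerivAt_nonpos_of_pos τ (T.contGap.mono (Set.Icc_subset_Icc hb.1 le_rfl)) h
    (fun t ht htτ _ => ⟨_, ?_, hasDerivAt_gap hR1 (T.deriv t ⟨hb.1.trans_lt ht.1, ht.2⟩ htτ)⟩) q hq
  have h1 : capField τ R D ε k 0 t (z t) ≤ 0 :=
    capField_nonpos hR hk (ha₀.le.trans (hb.1.trans ht.1.le))
  have h2 := mul_nonpos_of_nonneg_of_nonpos (Real.exp_pos ((1 - R) * z t)).le h1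
  have : D * R * b < D * R * t := mul_lt_mul_of_pos_left ht.1 (mul_pos hD hR)
  linarith

/-- The trajectory returns to the quadratic at some point not below the Merton line. -/
theorem exists_return (hR : 0 < R) (hR1 : R ≠ 1) (hD : 0 < D) (hk : 0 < k) (ha₀ : 0 < a₀)
    (hM : 2 * ε / (D * R) < M) (T : IsTrajectory τ R D ε k a₀ M c z) (hc : gap R D ε c a = 0)
    (ha : a₀ ≤ a) (haε : D * R * a < ε) :
    ∃ b, a < b ∧ b < M ∧ ε ≤ D * R * b ∧ gap R D ε (z b) b = 0 ∧
      (∀ q ∈ Set.Ioo a b, q ≠ τ → 0 < gap R D ε (z q) q) ∧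
      ∀ q ∈ Set.Icc b M, gap R D ε (z q) q ≤ 0 := by
  have hDR := mul_pos hD hR
  set p := ε / (D * R) with hp
  have hpε : D * R * p = ε := by rw [hp]; field_simp
  have ha0 : 0 < a := ha₀.trans_le ha
  have hap : a < p := lt_of_mul_lt_mul_left (by linarith) hDR.le
  have hM2 : 2 * p < M := by rw [hp, ← mul_div_assoc]; exact hM
  set r := 2 * p - a with hr
  have hpr : p ≤ r := by linarith
  have hrM : r < M := by linarith
  have haM : a ∈ Set.Icc a₀ M := ⟨ha, by linarith⟩
  have hr0 : gap R D ε (z r) r ≤ 0 :=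
    T.gap_nonpos_right hR hR1 hk ha₀ hc ⟨by linarith, hrM.le⟩ (by linarith) (by
      rw [hr]; nlinarith)
  obtain ⟨hp0, hpos⟩ := T.gap_pos_left hR hR1 hD hk ha₀ hc haM (p := p)
    ⟨hap.le, by linarith⟩ hpε.le
  have hcl : IsClosed (Set.Icc p r ∩ (fun q => gap R D ε (z q) q) ⁻¹' Set.Iic 0) :=
    (T.contGap.mono (Set.Icc_subset_Icc (by linarith) hrM.le)).preimage_isClosed_of_isClosed
      isClosed_Icc isClosed_Iic
  obtain ⟨b, hb, hbm⟩ := (isCompact_Icc.of_isClosed_subset hcl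
    Set.inter_subset_left).exists_isLeast ⟨r, ⟨hpr, le_rfl⟩, hr0⟩
  have hb0 : gap R D ε (z b) b ≤ 0 := hb.2
  have hpb : p ≤ b := hb.1.1
  have hbM : b < M := hb.1.2.trans_lt hrM
  have hbpos : ∀ q ∈ Set.Ico p b, 0 < gap R D ε (z q) q := fun q hq => by
    by_contra hneg
    exact absurd (hbm ⟨⟨hq.1, hq.2.le.trans hb.1.2⟩, not_lt.mp hneg⟩) (not_le.mpr hq.2)
  have hbε : ε ≤ D * R * b := by rw [← hpε]; exact mul_le_mul_of_nonneg_left hpb hDR.le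
  refine ⟨b, hap.trans_le hpb, hbM, hbε, ?_, ?_, fun q hq =>
    T.gap_nonpos_after hR hR1 hD hk ha₀ ⟨by linarith, hbM.le⟩ hbε hb0 hq⟩
  · refine le_antisymm hb0 ?_
    rcases eq_or_lt_of_le hpb with h | h
    · rw [← h]; exact hp0
    · have hcw := (T.contGap b ⟨by linarith, hbM.le⟩).mono_left (nhdsWithin_mono b
        (fun q (hq : q ∈ Set.Ioo p b) => (⟨by linarith [hq.1], by linarith [hq.2]⟩ :
          q ∈ Set.Icc a₀ M)))
      have : (nhdsWithin b (Set.Ioo p b)).NeBot := right_nhdsWithin_Ioo_neBot h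
      exact ge_of_tendsto hcw (eventually_nhdsWithin_of_forall fun q hq =>
        (hbpos q ⟨hq.1.le, hq.2⟩).le)
  · intro q hq hqτ
    rcases lt_or_ge q p with h | h
    · exact hpos q ⟨hq.1, h⟩ hqτ
    · exact hbpos q ⟨h, hq.2⟩

end IsTrajectory
end TransactionCosts

namespace TransactionCosts

/-! ### Inactivity of the cap -/

theorem capRate_eq_cap {τ D k q s : ℝ} (hk : 0 < k) (hs : 0 < s) (h : k * den τ D q s ≤ s) :
    capRate τ D k 0 q s = k := by
  unfold capRate
  rw [max_eq_left hs.le, max_eq_right (by rw [le_div_iff₀ hk]; linarith), add_zero]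
  field_simp

theorem capRate_eq_rate {τ D k q s : ℝ} (hk : 0 < k) (hs : 0 < s) (h : s ≤ k * den τ D q s) :
    capRate τ D k 0 q s = rate τ D q s := by
  unfold capRate rate
  rw [max_eq_left hs.le, max_eq_left (by rw [div_le_iff₀ hk]; linarith), add_zero]

/-- The slope of the curve of constant cost rate `k` is at least `-D`. -/
theorem hasDerivAt_levelCurve {D k q : ℝ} (hD : 0 < D) (hk : 0 < k) (hq : 0 < q)
    (h : 0 < 1 + k * (q * (1 - q))) :
    ∃ S', -D ≤ S' ∧ HasDerivAt
      (fun q => k * (D / 2 * (q * (1 - q)) ^ 2) / (1 + k * (q * (1 - q)))) S' q := by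
  have hx : HasDerivAt (fun q : ℝ => q * (1 - q)) (1 - 2 * q) q :=
    ((hasDerivAt_id q).mul ((hasDerivAt_id q).const_sub 1)).congr_deriv (by simp; ring)
  have hd := (((hx.pow 2).const_mul (D / 2)).const_mul k).div ((hx.const_mul k).const_add 1) h.ne'
  refine ⟨_, ?_, hd⟩
  set X := k * (q * (1 - q)) with hX
  have e : (k * (D / 2 * (((2 : ℕ) : ℝ) * (q * (1 - q)) ^ (2 - 1) * (1 - 2 * q))) * (1 + X) -
      k * (D / 2 * (q * (1 - q)) ^ 2) * (k * (1 - 2 * q))) = D * ((1 - 2 * q) * (X * (1 + X / 2))) := by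
    rw [hX]; push_cast; ring
  have e' : (k * (D / 2 * ((fun q : ℝ => q * (1 - q)) ^ 2) q)) = k * (D / 2 * (q * (1 - q)) ^ 2) := rfl
  simp only [Pi.pow_apply] at *
  rw [e, le_div_iff₀ (by positivity)]
  have key : -(1 + X) ^ 2 ≤ (1 - 2 * q) * (X * (1 + X / 2)) := by
    rcases le_or_gt q 1 with h1 | h1
    · have hX0 : 0 ≤ X := by
        rw [hX]; exact mul_nonneg hk.le (mul_nonneg hq.le (by linarith))
      have : 0 ≤ X * (1 + X / 2) := by positivity
      nlinarith [mul_nonneg (by linarith : 0 ≤ 1 - q) this]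
    · have hX0 : X ≤ 0 := by
        rw [hX]; exact mul_nonpos_of_nonneg_of_nonpos hk.le
          (mul_nonpos_of_nonneg_of_nonpos hq.le (by linarith))
      have : X * (1 + X / 2) ≤ 0 := mul_nonpos_of_nonpos_of_nonneg hX0 (by linarith)
      nlinarith [sq_nonneg (1 + X), mul_nonneg_of_nonpos_of_nonpos (by linarith : 1 - 2 * q ≤ 0) this]
  nlinarith

/-- A lower bound for `n` above the curve of constant cost rate `k`. -/
theorem le_exp_of_levelCurve_lt {R D ε k ν q x : ℝ} (hR : 0 < R) (hR1 : R ≠ 1) (hD : 0 < D)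
    (hε : 0 < ε) (hk : 0 < k)
    (hν : R < 1 → 2 * ν ≤ 1 - ε * (1 - R) + D * R / 2 * (1 - R))
    (hk1 : R < 1 → (1 - R) * D ≤ 2 * ν * k) (hk2 : R < 1 → ε * (1 - R) ≤ ν * k)
    (hν2 : 2 * ν ≤ 1)
    (hq : 0 < q) (h : 0 < 1 + k * (q * (1 - q))) (hx : x ≤ 0)
    (hgap : k * (D / 2 * (q * (1 - q)) ^ 2) / (1 + k * (q * (1 - q))) < gap R D ε x q) :
    ν ≤ Real.exp ((1 - R) * x) := by
  rcases lt_or_gt_of_ne hR1 with hR' | hR'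
  · have h1R : 0 < 1 - R := by linarith
    rw [← one_add_crra hR1]
    have e : crra R x = gap R D ε x q - ε * q + D * R / 2 * q ^ 2 := by unfold gap; ring
    rw [e]
    set m1 := 1 - ε * (1 - R) + D * R / 2 * (1 - R) with hm1
    have hν' := hν hR'
    rcases le_or_gt q 1 with hq1 | hq1
    · -- on `(0, 1]` the level curve is close to the quadratic `ℓ`, which is concave
      have hx0 : 0 ≤ q * (1 - q) := mul_nonneg hq.le (by linarith)
      have hS : D / 2 * (q * (1 - q)) - D / 2 / k ≤
          k * (D / 2 * (q * (1 - q)) ^ 2) / (1 + k * (q * (1 - q))) := by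
        rw [le_div_iff₀ h]
        have : (D / 2 * (q * (1 - q)) - D / 2 / k) * (1 + k * (q * (1 - q))) =
          k * (D / 2 * (q * (1 - q)) ^ 2) - D / 2 / k := by field_simp; ring
        rw [this]
        have : 0 ≤ D / 2 / k := by positivity
        linarith
      have hν3 : (1 - R) * (D / 2 / k) ≤ ν := by
        rw [mul_div_assoc', div_le_iff₀ hk]
        linarith [hk1 hR']
      have h2 : (1 - R) * (D / 2 * (q * (1 - q)) - D / 2 / k) ≤ (1 - R) * gap R D ε x q :=
        mul_le_mul_of_nonneg_left (hS.trans hgap.le) h1R.le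
      have h3 : (1 - q) * (1 - 2 * ν) + q * (m1 - 2 * ν) + D / 2 * (1 - R) ^ 2 * (q * (1 - q)) =
        1 + (1 - R) * (D / 2 * (q * (1 - q)) - ε * q + D * R / 2 * q ^ 2) - 2 * ν := by
        rw [hm1]; ring
      have h4 : 0 ≤ (1 - q) * (1 - 2 * ν) := mul_nonneg (by linarith) (by linarith)
      have h5 : 0 ≤ q * (m1 - 2 * ν) := mul_nonneg hq.le (by linarith)
      have h6 : 0 ≤ D / 2 * (1 - R) ^ 2 * (q * (1 - q)) := by positivity
      linarith
    · -- beyond `1` the level curve is defined only close to `1`, where `m` is close to `m 1`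
      have hg : 0 < gap R D ε x q := lt_of_le_of_lt (by positivity) hgap
      have h2 : k * (q - 1) ≤ 1 := by nlinarith [mul_pos hk (by linarith : 0 < q - 1)]
      have h3 : ε * (1 - R) * (q - 1) ≤ ν := by
        have := mul_le_mul_of_nonneg_right (hk2 hR') (by linarith : 0 ≤ q - 1)
        have hν0 : 0 ≤ ν := by
          by_contra hneg
          have := hk2 hR'
          nlinarith [mul_pos hε h1R]
        nlinarith
      have h4 : 0 ≤ D * R / 2 * (1 - R) * (q ^ 2 - 1) :=
        mul_nonneg (by positivity) (by nlinarith)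
      have h5 : 0 ≤ (1 - R) * gap R D ε x q := by positivity
      have e2 : 1 + (1 - R) * (gap R D ε x q - ε * q + D * R / 2 * q ^ 2) =
        m1 - ε * (1 - R) * (q - 1) + D * R / 2 * (1 - R) * (q ^ 2 - 1) + (1 - R) * gap R D ε x q := by
        rw [hm1]; ring
      linarith
  · refine (by linarith : ν ≤ 1).trans (Real.one_le_exp ?_)
    exact mul_nonneg_of_nonpos_of_nonpos (by linarith) hx

/-- If the cap is high enough, it is never active on trajectories that start on or beyond the
quadratic `m`. For `τ = 1` a trajectory with active cap has `n` bounded below, so its gap falls at a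
speed proportional to `k`, faster than the curve on which the cost rate equals `k`: the trajectory
cannot cross that curve. -/
theorem exists_cap {τ R D ε a₀ : ℝ} (hτ : τ = 1 ∨ τ = -1) (hR : 0 < R) (hR1 : R ≠ 1) (hD : 0 < D)
    (hε : 0 < ε) (ha₀ : 0 < a₀) (ha₀1 : a₀ < 1)
    (hwell : τ = 1 → R < 1 → 0 < 1 - ε * (1 - R) + D * R / 2 * (1 - R)) :
    ∃ k > 0, ∀ M c z, c ≤ 0 → gap R D ε c a₀ ≤ 0 → IsTrajectory τ R D ε k a₀ M c z →
      ∀ q ∈ Set.Ioo a₀ M, 0 < gap R D ε (z q) q →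
        gap R D ε (z q) q ≤ k * den τ D q (gap R D ε (z q) q) := by
  rcases hτ with rfl | rfl
  · obtain ⟨ν, hν0, hν2, hν⟩ : ∃ ν : ℝ, 0 < ν ∧ 2 * ν ≤ 1 ∧
        (R < 1 → 2 * ν ≤ 1 - ε * (1 - R) + D * R / 2 * (1 - R)) := by
      rcases lt_or_gt_of_ne hR1 with h | h
      · have := hwell rfl h
        refine ⟨min 1 (1 - ε * (1 - R) + D * R / 2 * (1 - R)) / 2, ?_, ?_, fun _ => ?_⟩
        · have := lt_min one_pos this; linarith
        · linarith [min_le_left 1 (1 - ε * (1 - R) + D * R / 2 * (1 - R))]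
        · linarith [min_le_right 1 (1 - ε * (1 - R) + D * R / 2 * (1 - R))]
      · exact ⟨1 / 2, by norm_num, by norm_num, fun h' => absurd h' (not_lt.mpr h.le)⟩
    -- the three terms make `ν` a lower bound for `n` left and right of `1`, and the fall of the gap
    -- faster than `D`
    set k := |(1 - R) * D| / (2 * ν) + |ε * (1 - R)| / ν + R * (ε + D) / (a₀ * ν) with hkdef
    have hk : 0 < k := by positivity
    have hk1 : (1 - R) * D ≤ 2 * ν * k := by
      have : |(1 - R) * D| / (2 * ν) ≤ k := by
        have : 0 ≤ |ε * (1 - R)| / ν + R * (ε + D) / (a₀ * ν) := by positivity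
        linarith
      rw [div_le_iff₀ (by positivity)] at this
      linarith [le_abs_self ((1 - R) * D)]
    have hk2 : ε * (1 - R) ≤ ν * k := by
      have : |ε * (1 - R)| / ν ≤ k := by
        have : 0 ≤ |(1 - R) * D| / (2 * ν) + R * (ε + D) / (a₀ * ν) := by positivity
        linarith
      rw [div_le_iff₀ (by positivity)] at this
      linarith [le_abs_self (ε * (1 - R))]
    have hk3 : R * (ε + D) ≤ k * (a₀ * ν) := by
      have : R * (ε + D) / (a₀ * ν) ≤ k := by
        have : 0 ≤ |(1 - R) * D| / (2 * ν) + |ε * (1 - R)| / ν := by positivity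
        linarith
      rwa [div_le_iff₀ (by positivity)] at this
    refine ⟨k, hk, fun M c z hc hgc T q hq hpos => ?_⟩
    have hq0 : 0 < q := ha₀.trans hq.1
    rcases le_or_gt (1 + k * (q * (1 - q))) 0 with h | h
    · -- far beyond `1` the cost rate is below `k` for every gap
      unfold den
      have h1 : gap R D ε (z q) q * (1 + k * (q * (1 - q))) ≤ 0 :=
        mul_nonpos_of_nonneg_of_nonpos hpos.le h
      have h2 : 0 ≤ k * (D / 2 * (q * (1 - 1 * q)) ^ 2) := by positivity
      nlinarith
    · have hX : ∀ t ∈ Set.Icc a₀ q, 0 < 1 + k * (t * (1 - t)) := by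
        intro t ht
        have ht0 : 0 < t := ha₀.trans_le ht.1
        rcases le_or_gt t 1 with h1 | h1
        · have : 0 ≤ k * (t * (1 - t)) := mul_nonneg hk.le (mul_nonneg ht0.le (by linarith))
          linarith
        · have : q * (1 - q) ≤ t * (1 - t) := by nlinarith [ht.2]
          nlinarith [mul_le_mul_of_nonneg_left this hk.le]
      have hbar := nonpos_of_hasDerivAt_nonpos_of_pos (a := a₀) (b := q)
        (f := fun t => gap R D ε (z t) t -
          k * (D / 2 * (t * (1 - t)) ^ 2) / (1 + k * (t * (1 - t)))) 1 ?_ ?_ ?_ q ⟨hq.1.le, le_rfl⟩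
      · simp only [sub_nonpos] at hbar
        rw [le_div_iff₀ h] at hbar
        unfold den
        nlinarith
      · refine (T.contGap.mono (Set.Icc_subset_Icc le_rfl hq.2.le)).sub (ContinuousOn.div ?_ ?_
          fun t ht => (hX t ht).ne')
        · fun_prop
        · fun_prop
      · rw [T.init]
        have : 0 ≤ k * (D / 2 * (a₀ * (1 - a₀)) ^ 2) / (1 + k * (a₀ * (1 - a₀))) :=
          div_nonneg (by positivity) (hX a₀ ⟨le_rfl, hq.1.le⟩).le
        linarith
      · intro t ht ht1 htpos
        have htM : t ∈ Set.Ioo a₀ M := ⟨ht.1, ht.2.trans hq.2⟩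
        have ht0 : 0 < t := ha₀.trans ht.1
        have hXt := hX t ⟨ht.1.le, ht.2.le⟩
        obtain ⟨S', hS', hdS⟩ := hasDerivAt_levelCurve hD hk ht0 hXt
        refine ⟨_, ?_, (hasDerivAt_gap hR1 (T.deriv t htM ht1)).sub hdS⟩
        have hlt := sub_pos.mp htpos
        have hg : 0 < gap R D ε (z t) t := lt_of_le_of_lt (by positivity) hlt
        have hcap : capRate 1 D k 0 t (gap R D ε (z t) t) = k := by
          refine capRate_eq_cap hk hg ?_
          rw [div_lt_iff₀ hXt] at hlt
          unfold den
          nlinarith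
        have hz0 : z t ≤ 0 := by
          have := T.antitoneOn hR hk ha₀ ⟨le_rfl, (htM.1.trans htM.2).le⟩ ⟨htM.1.le, htM.2.le⟩ htM.1.le
          rw [T.init] at this
          linarith
        have hn := le_exp_of_levelCurve_lt hR hR1 hD hε hk hν (fun _ => hk1)
          (fun _ => hk2) hν2 ht0 hXt hz0 hlt
        have h1 : ν * (a₀ / R * k) ≤ Real.exp ((1 - R) * z t) * (t / R * k) := by
          have := ht.1.le
          gcongr
        have h2 : ε + D ≤ ν * (a₀ / R * k) := by
          have : ν * (a₀ / R * k) = k * (a₀ * ν) / R := by ring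
          rw [this, le_div_iff₀ hR]; linarith
        have h3 : 0 < D * R * t := by positivity
        unfold capField
        rw [hcap]
        linarith
  · refine ⟨1 / a₀, by positivity, fun M c z _ _ T q hq hpos => ?_⟩
    have hq0 : 0 < q := ha₀.trans hq.1
    unfold den
    have h1 : 0 ≤ 1 / a₀ * (D / 2 * (q * (1 - -1 * q)) ^ 2) := by positivity
    have h2 : 1 ≤ 1 / a₀ * (q * (1 + q)) := by
      rw [div_mul_eq_mul_div, le_div_iff₀ ha₀]
      nlinarith [hq.1]
    nlinarith [mul_le_mul_of_nonneg_right h2 hpos.le]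

end TransactionCosts

namespace TransactionCosts

/-! ### Trajectories as wedges -/

/-- A function bounded by a quadratic near `b` has one-sided derivative zero there. -/
theorem hasDerivWithinAt_zero_of_sq_bound {f : ℝ → ℝ} {a b C : ℝ} (hab : a < b) (hb : f b = 0)
    (h : ∀ q ∈ Set.Ioo a b, |f q| ≤ C * (b - q) ^ 2) : HasDerivWithinAt f 0 (Set.Icc a b) b := by
  have h1 : HasDerivWithinAt f 0 (Set.Ioc a b) b := by
    rw [hasDerivWithinAt_iff_tendsto_slope, Set.Ioc_sdiff_right]
    have hlim : Filter.Tendsto (fun q => |C| * (b - q)) (nhdsWithin b (Set.Ioo a b)) (nhds 0) := by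
      have : Filter.Tendsto (fun q => |C| * (b - q)) (nhds b) (nhds (|C| * (b - b))) := by
        apply Continuous.tendsto; fun_prop
      rw [sub_self, mul_zero] at this
      exact this.mono_left nhdsWithin_le_nhds
    refine squeeze_zero_norm' (eventually_nhdsWithin_of_forall fun q hq => ?_) hlim
    have hq' : 0 < b - q := by linarith [hq.2]
    rw [slope_def_field, hb, sub_zero, Real.norm_eq_abs, abs_div, abs_sub_comm q b, abs_of_pos hq',
      div_le_iff₀ hq']
    have h1 := h q hq
    have : C * (b - q) ^ 2 ≤ |C| * (b - q) ^ 2 :=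
      mul_le_mul_of_nonneg_right (le_abs_self C) (by positivity)
    nlinarith
  exact h1.mono_of_mem_nhdsWithin (by
    rw [nhdsWithin_Icc_eq_nhdsLE hab]
    exact Ioc_mem_nhdsLE hab)

namespace IsTrajectory

variable {τ R D ε k M a₀ c a : ℝ} {z : ℝ → ℝ}

/-- A trajectory on which the cap is inactive, started on `m` before the Merton line, is a wedge;
its cost is the integral of the capped rate over the whole interval. -/
theorem exists_wedge (hτ : τ = 1 ∨ τ = -1) (hR : 0 < R) (hR1 : R ≠ 1) (hD : 0 < D) (hk : 0 < k)
    (ha₀ : 0 < a₀) (hM : 2 * ε / (D * R) < M) (T : IsTrajectory τ R D ε k a₀ M c z)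
    (hcap : ∀ q ∈ Set.Ioo a₀ M, 0 < gap R D ε (z q) q →
        gap R D ε (z q) q ≤ k * den τ D q (gap R D ε (z q) q))
    (hc : gap R D ε c a = 0) (ha : a₀ < a) (haε : D * R * a < ε) :
    ∃ b, Wedge τ R D ε (∫ q in a₀..M, capRate τ D k 0 q (gap R D ε (z q) q)) z a b := by
  obtain ⟨b, hab, hbM, hbε, hb0, hpos, hneg⟩ :=
    T.exists_return hR hR1 hD hk ha₀ hM hc ha.le haε
  have ha0 : gap R D ε (z a) a = 0 :=
    T.gap_start hR hR1 hD hk ha₀ hc haε.le ⟨ha.le, (hab.trans hbM).le⟩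
  have hsub : ∀ q ∈ Set.Ioo a b, q ∈ Set.Ioo a₀ M := fun q hq => ⟨ha.trans hq.1, hq.2.trans hbM⟩
  have hrate : ∀ q ∈ Set.Ioo a b, q ≠ τ → capRate τ D k 0 q (gap R D ε (z q) q) =
      rate τ D q (gap R D ε (z q) q) := fun q hq hqτ =>
    capRate_eq_rate hk (hpos q hq hqτ) (hcap q (hsub q hq) (hpos q hq hqτ))
  have hint := T.intervalIntegrable_capRate hτ hD hk ha₀ (ha.trans (hab.trans hbM)).le
  have hint' : ∀ c d, a₀ ≤ c → c ≤ d → d ≤ M → IntervalIntegrable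
      (fun q => capRate τ D k 0 q (gap R D ε (z q) q)) MeasureTheory.volume c d :=
    fun c d hc hcd hd => hint.mono_set (by
      rw [Set.uIcc_of_le hcd, Set.uIcc_of_le (hc.trans (hcd.trans hd))]
      exact Set.Icc_subset_Icc hc hd)
  have hae : ∀ᵐ q : ℝ, q ∈ Set.uIoc a b → capRate τ D k 0 q (gap R D ε (z q) q) =
      rate τ D q (gap R D ε (z q) q) := by
    filter_upwards [MeasureTheory.Measure.ae_ne MeasureTheory.volume τ,
      MeasureTheory.Measure.ae_ne MeasureTheory.volume b] with q h1 h2 h3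
    rw [Set.uIoc_of_le hab.le] at h3
    exact hrate q ⟨h3.1, lt_of_le_of_ne h3.2 h2⟩ h1
  refine ⟨b, ha₀.trans ha, hab, T.cont.mono (Set.Icc_subset_Icc ha.le hbM.le), hpos,
    fun q hq hqτ => ?_, fun q hq hqτ => ?_, ha0, hb0, fun haτ => ?_, ?_, ?_, ?_⟩
  · have h1 := hpos q hq hqτ
    exact pos_of_mul_pos_right (h1.trans_le (hcap q (hsub q hq) h1)) hk.le
  · rw [← hrate q hq hqτ]
    exact T.deriv q (hsub q hq) hqτ
  · exact (T.hasDerivAt_gap_of_nonpos hR1 ⟨ha, hab.trans hbM⟩ haτ ha0.le).hasDerivWithinAt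
  · by_cases hbτ : b = τ
    · -- the gap vanishes to second order at the singular point, so `m` is flat there
      have hτ1 : τ = 1 := by
        rcases hτ with h | h
        · exact h
        · linarith
      subst hτ1; subst hbτ
      have hsq : ∀ q ∈ Set.Ioo a 1, gap R D ε (z q) q ≤ k * (D / 2) * (1 - q) ^ 2 := by
        intro q hq
        have h1 := hpos q hq hq.2.ne
        have h2 := hcap q (hsub q hq) h1
        unfold den at h2
        have hq0 : 0 < q := by linarith [hq.1]
        have h3 : 0 ≤ q * (1 - q) * gap R D ε (z q) q :=
          mul_nonneg (mul_nonneg hq0.le (by linarith [hq.2])) h1.le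
        have h4 : (q * (1 - 1 * q)) ^ 2 ≤ (1 - q) ^ 2 := by
          rw [one_mul, mul_pow]
          have : q ^ 2 ≤ 1 := by nlinarith [hq.2]
          nlinarith [sq_nonneg (1 - q)]
        have h5 : k * (D / 2) * (q * (1 - 1 * q)) ^ 2 ≤ k * (D / 2) * (1 - q) ^ 2 :=
          mul_le_mul_of_nonneg_left h4 (by positivity)
        have h6 := mul_nonneg hk.le h3
        nlinarith
      have heq : ε - D * R * 1 = 0 := by
        refine le_antisymm (by linarith) ?_
        have hlim : Filter.Tendsto (fun q => ε - D * R / 2 * (q + 1) + k * (D / 2) * (1 - q))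
            (nhdsWithin 1 (Set.Ioo a 1)) (nhds (ε - D * R / 2 * (1 + 1) + k * (D / 2) * (1 - 1))) := by
          refine Filter.Tendsto.mono_left (Continuous.tendsto ?_ _) nhdsWithin_le_nhds
          fun_prop
        have : (nhdsWithin 1 (Set.Ioo a 1)).NeBot := right_nhdsWithin_Ioo_neBot hab
        have := ge_of_tendsto (b := 0) hlim (eventually_nhdsWithin_of_forall fun q hq => by
          have h1 := T.gap_le hR hR1 hk ha₀ (p := q) (q := 1) ⟨(hsub q hq).1.le, (hsub q hq).2.le⟩
            ⟨(ha.trans hab).le, hbM.le⟩ hq.2.le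
          rw [hb0] at h1
          have h2 := hsq q hq
          have h3 : 0 ≤ (1 - q) * (ε - D * R / 2 * (q + 1) + k * (D / 2) * (1 - q)) := by nlinarith
          exact nonneg_of_mul_nonneg_right h3 (by linarith [hq.2]))
        linarith
      rw [heq]
      refine hasDerivWithinAt_zero_of_sq_bound (C := k * (D / 2)) hab hb0 fun q hq => ?_
      rw [abs_of_pos (hpos q hq hq.2.ne)]
      exact hsq q hq
    · exact (T.hasDerivAt_gap_of_nonpos hR1 ⟨ha.trans hab, hbM⟩ hbτ hb0.le).hasDerivWithinAt
  · exact (hint' a b ha.le hab.le hbM.le).congr_ae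
      ((MeasureTheory.ae_restrict_iff' measurableSet_uIoc).mpr hae)
  · rw [← intervalIntegral.integral_add_adjacent_intervals
      (hint' a₀ a le_rfl ha.le (hab.trans hbM).le) (hint' a M ha.le (hab.trans hbM).le le_rfl),
      ← intervalIntegral.integral_add_adjacent_intervals
      (hint' a b ha.le hab.le hbM.le) (hint' b M (ha.trans hab).le hbM.le le_rfl),
      intervalIntegral.integral_congr_ae hae]
    have h1 : ∫ q in a₀..a, capRate τ D k 0 q (gap R D ε (z q) q) = 0 := by
      rw [intervalIntegral.integral_congr (g := fun _ => 0), intervalIntegral.integral_zero]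
      intro q hq
      rw [Set.uIcc_of_le ha.le] at hq
      exact capRate_of_nonpos (T.gap_nonpos_left hR hR1 hD hk ha₀ hc haε.le
        ⟨hq.1, hq.2.trans (hab.trans hbM).le⟩ hq.2)
    have h2 : ∫ q in b..M, capRate τ D k 0 q (gap R D ε (z q) q) = 0 := by
      rw [intervalIntegral.integral_congr (g := fun _ => 0), intervalIntegral.integral_zero]
      intro q hq
      rw [Set.uIcc_of_le hbM.le] at hq
      exact capRate_of_nonpos (hneg q hq)
    rw [h1, h2]; ring

end IsTrajectory
end TransactionCosts

namespace TransactionCosts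

/-! ### Trajectories started near the origin -/

variable {τ R D ε k M a₀ c a L : ℝ} {z : ℝ → ℝ}

theorem crra_nonpos_iff (hR1 : R ≠ 1) {c : ℝ} : crra R c ≤ 0 ↔ c ≤ 0 := by
  have : crra R 0 = 0 := by simp [crra]
  simpa only [this] using (crra_strictMono hR1).le_iff_le (a := c) (b := 0)

theorem gap_log_eq_zero (hR1 : R ≠ 1) (h : 0 < 1 + (1 - R) * (D * R / 2 * a ^ 2 - ε * a)) :
    gap R D ε (Real.log (1 + (1 - R) * (D * R / 2 * a ^ 2 - ε * a)) / (1 - R)) a = 0 := by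
  have h1 : (1 - R) ≠ 0 := sub_ne_zero.mpr hR1.symm
  unfold gap crra
  rw [mul_div_cancel₀ _ h1, Real.exp_log h]
  field_simp; ring

theorem capRate_le_rate {q s : ℝ} (hs : 0 ≤ s) (hd : 0 < den τ D q s) :
    capRate τ D k 0 q s ≤ rate τ D q s := by
  unfold capRate rate
  rw [max_eq_left hs, add_zero]
  exact div_le_div_of_nonneg_left hs hd (le_max_left _ _)

theorem one_sub_sign_mul_mem (hτ : τ = 1 ∨ τ = -1) {q : ℝ} (h0 : 0 < q) (h1 : q ≤ 1 / 2) :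
    1 / 2 ≤ 1 - τ * q ∧ 1 - τ * q ≤ 3 / 2 := by
  rcases hτ with rfl | rfl <;> constructor <;> linarith

theorem le_den (hτ : τ = 1 ∨ τ = -1) (hD : 0 < D) {q s c₁ : ℝ} (h0 : 0 < q) (h1 : q ≤ 1 / 2)
    (hs : 0 ≤ s) (hsq : s ≤ c₁ * q) (hc : c₁ ≤ D / 24) : q ^ 2 * (D / 16) ≤ den τ D q s := by
  obtain ⟨hh1, hh2⟩ := one_sub_sign_mul_mem hτ h0 h1
  have hτle : τ ≤ 1 := by rcases hτ with rfl | rfl <;> norm_num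
  unfold den
  have e1 : q ^ 2 * (1 / 4) ≤ (q * (1 - τ * q)) ^ 2 := by
    rw [mul_pow]
    exact mul_le_mul_of_nonneg_left (by nlinarith) (sq_nonneg q)
  have e3 : τ * (q * (1 - τ * q)) * s ≤ 1 * (q * (1 - τ * q)) * s :=
    mul_le_mul_of_nonneg_right (mul_le_mul_of_nonneg_right hτle
      (mul_nonneg h0.le (by linarith))) hs
  have e4 : 1 * (q * (1 - τ * q)) * s ≤ q * (3 / 2) * (c₁ * q) := by
    rw [one_mul]; gcongr
  have e5 : c₁ * q ^ 2 ≤ D / 24 * q ^ 2 := mul_le_mul_of_nonneg_right hc (sq_nonneg q)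
  have e6 := mul_le_mul_of_nonneg_left e1 hD.le
  linarith

theorem den_le (hτ : τ = 1 ∨ τ = -1) (hD : 0 < D) {q s : ℝ} (h0 : 0 < q) (h1 : q ≤ 1 / 2)
    (hs : 0 ≤ s) : den τ D q s ≤ 2 * D * q ^ 2 + 2 * q * s := by
  obtain ⟨hh1, hh2⟩ := one_sub_sign_mul_mem hτ h0 h1
  have hτle : -1 ≤ τ := by rcases hτ with rfl | rfl <;> norm_num
  unfold den
  have e1 : (q * (1 - τ * q)) ^ 2 ≤ q ^ 2 * (9 / 4) := by
    rw [mul_pow]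
    exact mul_le_mul_of_nonneg_left (by nlinarith) (sq_nonneg q)
  have e3 : -1 * (q * (1 - τ * q)) * s ≤ τ * (q * (1 - τ * q)) * s :=
    mul_le_mul_of_nonneg_right (mul_le_mul_of_nonneg_right hτle
      (mul_nonneg h0.le (by linarith))) hs
  have e4 : (q * (1 - τ * q)) * s ≤ q * (3 / 2) * s := by gcongr
  have e5 : 0 ≤ q * s := by positivity
  have e6 : 0 < D * q ^ 2 := by positivity
  have e7 := mul_le_mul_of_nonneg_left e1 hD.le
  linarith

/-- Where the gap is small compared with `q`, the decay of `n` is slow. -/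
theorem exp_mul_rate_le (hτ : τ = 1 ∨ τ = -1) (hR : 0 < R) (hR1 : R ≠ 1) (hD : 0 < D) (hε : 0 < ε)
    (hk : 0 < k) {q x c₁ : ℝ} (hq0 : 0 < q) (hq1 : q ≤ 1 / 2) (hc0 : 0 < c₁) (hcD : c₁ ≤ D / 24)
    (hcN : c₁ * (64 * (1 + |1 - R| * (D + ε + D * R))) ≤ ε * R * D)
    (hsq : gap R D ε x q ≤ c₁ * q) :
    Real.exp ((1 - R) * x) * (q / R * capRate τ D k 0 q (gap R D ε x q)) ≤ ε / 4 := by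
  set N := 1 + |1 - R| * (D + ε + D * R) with hN
  have hN0 : 0 < N := by positivity
  set s := gap R D ε x q with hs
  rcases le_or_gt s 0 with h | h
  · rw [capRate_of_nonpos h]; simp; linarith
  have hden := le_den hτ hD hq0 hq1 h.le hsq hcD
  have hden0 : 0 < den τ D q s := lt_of_lt_of_le (by positivity) hden
  have hr1 : q * capRate τ D k 0 q s ≤ 16 * c₁ / D := by
    have h1 : capRate τ D k 0 q s ≤ rate τ D q s := capRate_le_rate h.le hden0
    have h2 : q * rate τ D q s ≤ 16 * c₁ / D := by
      unfold rate
      rw [mul_div_assoc', div_le_div_iff₀ hden0 hD]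
      have e1 := mul_le_mul_of_nonneg_left hden hc0.le
      have e2 : q * s * D ≤ q * (c₁ * q) * D := by gcongr
      linarith
    exact (mul_le_mul_of_nonneg_left h1 hq0.le).trans h2
  have hn : Real.exp ((1 - R) * x) ≤ N := by
    rw [← one_add_crra hR1]
    have e : crra R x = s - ε * q + D * R / 2 * q ^ 2 := by rw [hs]; unfold gap; ring
    have h1 : |crra R x| ≤ D + ε + D * R := by
      rw [e, abs_le]
      have hq1' : q ≤ 1 := by linarith
      have e1 : 0 ≤ D * R / 2 * q ^ 2 := by positivity
      have e2 : D * R / 2 * q ^ 2 ≤ D * R / 2 * 1 := by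
        gcongr; nlinarith
      have e3 : ε * q ≤ ε * 1 := by gcongr
      have e4 : c₁ * q ≤ D * 1 := mul_le_mul (by linarith) hq1' hq0.le hD.le
      have e5 : 0 < ε * q := by positivity
      have e6 : 0 < D * R := by positivity
      constructor <;> linarith
    have h2 : (1 - R) * crra R x ≤ |1 - R| * (D + ε + D * R) := by
      refine (le_abs_self _).trans ?_
      rw [abs_mul]; gcongr
    linarith
  have h3 : Real.exp ((1 - R) * x) * (q / R * capRate τ D k 0 q s) ≤ N * (16 * c₁ / D / R) := by
    have e : q / R * capRate τ D k 0 q s = q * capRate τ D k 0 q s / R := by ring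
    rw [e]
    have := capRate_nonneg (τ := τ) (D := D) (q := q) (s := s) hk le_rfl
    exact mul_le_mul hn (div_le_div_of_nonneg_right hr1 hR.le) (by positivity) hN0.le
  refine h3.trans ?_
  rw [div_div, mul_div_assoc', div_le_iff₀ (by positivity)]
  linarith

/-- Near the origin the gap is at least proportional to the distance covered. -/
theorem IsTrajectory.mul_le_gap (hτ : τ = 1 ∨ τ = -1) (hR : 0 < R) (hR1 : R ≠ 1) (hD : 0 < D)
    (hε : 0 < ε) (hk : 0 < k) (ha₀ : 0 < a₀) (T : IsTrajectory τ R D ε k a₀ M c z)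
    (hgc : gap R D ε c a₀ = 0) {δ c₁ : ℝ} (hδM : δ ≤ M) (hδ1 : δ ≤ 1 / 2)
    (hδε : D * R * δ ≤ ε / 4) (hc0 : 0 < c₁) (hcD : c₁ ≤ D / 24) (hcε : c₁ ≤ ε / 2)
    (hcN : c₁ * (64 * (1 + |1 - R| * (D + ε + D * R))) ≤ ε * R * D) {q : ℝ}
    (hq : q ∈ Set.Icc a₀ δ) : c₁ * (q - a₀) ≤ gap R D ε (z q) q := by
  refine sub_nonpos.mp (nonpos_of_hasDerivAt_nonpos_of_pos
    (f := fun q => c₁ * (q - a₀) - gap R D ε (z q) q) τ (ContinuousOn.sub (by fun_prop)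
      (T.contGap.mono (Set.Icc_subset_Icc le_rfl hδM))) ?_ (fun q hq hqτ hpos => ?_) q hq)
  · rw [T.init, hgc]; simp
  · have hqM : q ∈ Set.Ioo a₀ M := ⟨hq.1, hq.2.trans_le hδM⟩
    have hq0 : 0 < q := ha₀.trans hq.1
    have hdd := ((hasDerivAt_id q).sub_const a₀).const_mul c₁
    refine ⟨_, ?_, hdd.sub (hasDerivAt_gap hR1 (T.deriv q hqM hqτ))⟩
    have hDq : D * R * q ≤ ε / 4 :=
      (mul_le_mul_of_nonneg_left hq.2.le (mul_pos hD hR).le).trans hδε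
    have hca : 0 < c₁ * a₀ := by positivity
    have hkey := exp_mul_rate_le hτ hR hR1 hD hε hk hq0 (hq.2.le.trans hδ1) hc0 hcD hcN
      (x := z q) (by linarith)
    unfold capField
    simp only [mul_one]
    linarith

theorem inv_le_rate (hτ : τ = 1 ∨ τ = -1) (hD : 0 < D) {q s c₁ c₂ : ℝ} (h0 : 0 < q)
    (h1 : q ≤ 1 / 2) (hs : 0 < s) (hden : 0 < den τ D q s) (hg : c₁ * q / 2 ≤ s) (hc2 : 0 < c₂)
    (hc21 : c₂ * (8 * D) ≤ c₁) (hc22 : c₂ ≤ 1 / 4) : c₂ * q⁻¹ ≤ rate τ D q s := by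
  unfold rate
  rw [← div_eq_mul_inv, div_le_div_iff₀ h0 hden]
  have h1 : c₂ * den τ D q s ≤ c₂ * (2 * D * q ^ 2 + 2 * q * s) :=
    mul_le_mul_of_nonneg_left (den_le hτ hD h0 h1 hs.le) hc2.le
  have h2 : c₂ * (8 * D) * q ^ 2 ≤ c₁ * q ^ 2 := mul_le_mul_of_nonneg_right hc21 (sq_nonneg q)
  have h3 : c₂ * (q * s) ≤ 1 / 4 * (q * s) := mul_le_mul_of_nonneg_right hc22 (by positivity)
  have h4 : c₁ * q / 2 * q ≤ s * q := mul_le_mul_of_nonneg_right hg h0.le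
  linarith

/-- Trajectories started close to the origin have arbitrarily large cost: there the gap is at
least proportional to the distance covered, so the cost rate is at least of the order `1 / q`. -/
theorem exists_start (hτ : τ = 1 ∨ τ = -1) (hR : 0 < R) (hR1 : R ≠ 1) (hD : 0 < D) (hε : 0 < ε)
    (L : ℝ) {r : ℝ} (hr : 0 < r) :
    ∃ a₀, 0 < a₀ ∧ a₀ < r ∧ a₀ < 1 ∧ ∀ k > 0, ∀ M ≥ 1, ∀ c z, gap R D ε c a₀ = 0 →
      IsTrajectory τ R D ε k a₀ M c z →
      (∀ q ∈ Set.Ioo a₀ M, 0 < gap R D ε (z q) q →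
        gap R D ε (z q) q ≤ k * den τ D q (gap R D ε (z q) q)) →
      L < ∫ q in a₀..M, capRate τ D k 0 q (gap R D ε (z q) q) := by
  -- `N` bounds `n` near the origin, `c₁` is a slope the gap cannot fall below, `c₂ / q` bounds the
  -- cost rate from below, and `a₀` is so small that `c₂ * log (δ / (2 * a₀))` exceeds `L`
  set N := 1 + |1 - R| * (D + ε + D * R) with hN
  have hN0 : 0 < N := by positivity
  set c₁ := min (D / 24) (min (ε / 2) (ε * R * D / (64 * N))) with hc₁
  have hc0 : 0 < c₁ := lt_min (by positivity) (lt_min (by positivity) (by positivity))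
  have hcD : c₁ ≤ D / 24 := min_le_left _ _
  have hcε : c₁ ≤ ε / 2 := (min_le_right _ _).trans (min_le_left _ _)
  have hcN : c₁ * (64 * N) ≤ ε * R * D := by
    have : c₁ ≤ ε * R * D / (64 * N) := (min_le_right _ _).trans (min_le_right _ _)
    rwa [le_div_iff₀ (by positivity)] at this
  set δ := min (1 / 2) (ε / (4 * (D * R))) with hδ
  have hδ0 : 0 < δ := lt_min (by norm_num) (by positivity)
  have hδ1 : δ ≤ 1 / 2 := min_le_left _ _
  have hδε : D * R * δ ≤ ε / 4 := by
    have : δ ≤ ε / (4 * (D * R)) := min_le_right _ _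
    rw [le_div_iff₀ (by positivity)] at this
    linarith
  set c₂ := min (c₁ / (8 * D)) (1 / 4) with hc₂
  have hc20 : 0 < c₂ := lt_min (by positivity) (by norm_num)
  have hc21 : c₂ * (8 * D) ≤ c₁ := by
    have : c₂ ≤ c₁ / (8 * D) := min_le_left _ _
    rwa [le_div_iff₀ (by positivity)] at this
  have hc22 : c₂ ≤ 1 / 4 := min_le_right _ _
  set a₀ := min (r / 2) (δ / 2 * Real.exp (-((|L| + 1) / c₂))) with ha
  have ha0 : 0 < a₀ := lt_min (by positivity) (by positivity)
  have ha2 : 2 * a₀ ≤ δ * Real.exp (-((|L| + 1) / c₂)) := by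
    have : a₀ ≤ δ / 2 * Real.exp (-((|L| + 1) / c₂)) := min_le_right _ _
    linarith
  have haδ : 2 * a₀ < δ := by
    refine ha2.trans_lt ?_
    have : Real.exp (-((|L| + 1) / c₂)) < 1 := by
      rw [Real.exp_lt_one_iff]
      exact neg_neg_of_pos (by positivity)
    nlinarith
  have hlog : L < c₂ * Real.log (δ / (2 * a₀)) := by
    have h1 : (|L| + 1) / c₂ ≤ Real.log (δ / (2 * a₀)) := by
      rw [Real.le_log_iff_exp_le (by positivity), le_div_iff₀ (by positivity)]
      rw [Real.exp_neg] at ha2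
      have := mul_le_mul_of_nonneg_left ha2 (Real.exp_pos ((|L| + 1) / c₂)).le
      have e : Real.exp ((|L| + 1) / c₂) * (δ * (Real.exp ((|L| + 1) / c₂))⁻¹) = δ := by
        have := (Real.exp_pos ((|L| + 1) / c₂)).ne'
        field_simp
      linarith
    rw [div_le_iff₀ hc20] at h1
    linarith [le_abs_self L]
  refine ⟨a₀, ha0, (min_le_left _ _).trans_lt (by linarith), by linarith,
    fun k hk M hM c z hgc T hcap => ?_⟩
  have hδM : δ ≤ M := by linarith
  have hlow : ∀ q ∈ Set.Icc (2 * a₀) δ, c₂ * q⁻¹ ≤ capRate τ D k 0 q (gap R D ε (z q) q) := by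
    intro q hq
    have hq0 : 0 < q := by linarith [hq.1]
    have hg : c₁ * q / 2 ≤ gap R D ε (z q) q := by
      have h1 := T.mul_le_gap hτ hR hR1 hD hε hk ha0 hgc hδM hδ1 hδε hc0 hcD hcε hcN
        (q := q) ⟨by linarith [hq.1], hq.2⟩
      have h2 : c₁ * (2 * a₀) ≤ c₁ * q := mul_le_mul_of_nonneg_left hq.1 hc0.le
      linarith
    have hs0 : 0 < gap R D ε (z q) q := lt_of_lt_of_le (by positivity) hg
    have hcq := hcap q ⟨by linarith [hq.1], by linarith [hq.2]⟩ hs0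
    rw [capRate_eq_rate hk hs0 hcq]
    exact inv_le_rate hτ hD hq0 (hq.2.trans hδ1) hs0
      (pos_of_mul_pos_right (hs0.trans_le hcq) hk.le) hg hc20 hc21 hc22
  have hint := T.intervalIntegrable_capRate hτ hD hk ha0 (by linarith)
  have h1 : ∫ q in (2 * a₀)..δ, capRate τ D k 0 q (gap R D ε (z q) q) ≤
      ∫ q in a₀..M, capRate τ D k 0 q (gap R D ε (z q) q) :=
    intervalIntegral.integral_mono_interval (by linarith) haδ.le hδM
      (Filter.Eventually.of_forall fun q => capRate_nonneg hk le_rfl) hint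
  have h2 : ∫ q in (2 * a₀)..δ, c₂ * q⁻¹ ≤
      ∫ q in (2 * a₀)..δ, capRate τ D k 0 q (gap R D ε (z q) q) := by
    refine intervalIntegral.integral_mono_on haδ.le ?_ ?_ hlow
    · refine (intervalIntegral.intervalIntegrable_inv (fun q hq => ?_) continuousOn_id).const_mul c₂
      rw [Set.uIcc_of_le haδ.le] at hq
      have : 0 < q := by linarith [hq.1]
      exact this.ne'
    · exact hint.mono_set (by
        rw [Set.uIcc_of_le haδ.le, Set.uIcc_of_le (by linarith)]
        exact Set.Icc_subset_Icc (by linarith) hδM)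
  rw [intervalIntegral.integral_const_mul, integral_inv_of_pos (by linarith) hδ0] at h2
  linarith

end TransactionCosts

namespace TransactionCosts

/-! ### Shooting -/

variable {τ R D ε k M a₀ L : ℝ}

theorem continuous_integral_capRate (hτ : τ = 1 ∨ τ = -1) (hD : 0 < D) (hk : 0 < k) (ha₀ : 0 < a₀)
    (hM : a₀ ≤ M) {g : ℝ → ℝ → ℝ} (hg : ∀ c, ContinuousOn (g c) (Set.Icc a₀ M))
    (hc : ∀ q ∈ Set.Icc a₀ M, Continuous fun c => g c q) :
    Continuous fun c => ∫ q in a₀..M, capRate τ D k 0 q (g c q) := by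
  refine intervalIntegral.continuous_of_dominated_interval (bound := fun _ => k) (fun c => ?_)
    (fun c => ?_) (by simp) ?_
  · rw [Set.uIoc_of_le hM]
    refine MeasureTheory.AEStronglyMeasurable.mono_measure
      (aestronglyMeasurable_of_continuousWithinAt_off (p := τ) fun t ht htτ => ?_)
      (MeasureTheory.Measure.restrict_mono Set.Ioc_subset_Icc_self le_rfl)
    exact continuousWithinAt_capRate_comp (capDen_ne_zero hτ hD hk (ha₀.trans_le ht.1) htτ) (hg c t ht)
  · refine Filter.Eventually.of_forall fun t _ => ?_
    rw [Real.norm_eq_abs, abs_of_nonneg (capRate_nonneg hk le_rfl)]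
    exact capRate_le hk le_rfl
  · filter_upwards [MeasureTheory.Measure.ae_ne MeasureTheory.volume τ] with t htτ ht
    rw [Set.uIoc_of_le hM] at ht
    refine continuous_iff_continuousAt.mpr fun c => ?_
    exact ContinuousAt.comp (f := fun c : ℝ => ((0, t, g c t) : ℝ × ℝ × ℝ))
      (g := fun p : ℝ × ℝ × ℝ => capRate τ D k p.1 p.2.1 p.2.2)
      (continuousAt_capRate (capDen_ne_zero hτ hD hk (ha₀.trans ht.1) htτ))
      (continuousAt_const.prodMk (continuousAt_const.prodMk
        (hc t (Set.Ioc_subset_Icc_self ht)).continuousAt))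

/-- The cost depends continuously on the initial value. -/
theorem continuous_cost (hτ : τ = 1 ∨ τ = -1) (hR : 0 < R) (hR1 : R ≠ 1) (hD : 0 < D)
    (hk : 0 < k) (ha₀ : 0 < a₀) (hM : a₀ ≤ M) {Z : ℝ → ℝ → ℝ}
    (hZ : ∀ c, IsTrajectory τ R D ε k a₀ M c (Z c)) :
    Continuous fun c => ∫ q in a₀..M, capRate τ D k 0 q (gap R D ε (Z c q) q) := by
  refine continuous_integral_capRate hτ hD hk ha₀ hM (g := fun c q => gap R D ε (Z c q) q)
    (fun c => (hZ c).contGap) fun q hq => ?_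
  have h1 : LipschitzWith 1 fun c => Z c q := LipschitzWith.of_dist_le_mul fun c c' => by
    rw [Real.dist_eq, Real.dist_eq, NNReal.coe_one, one_mul]
    exact (hZ c).abs_sub_le hR hR1 hD hk ha₀ (hZ c') hq
  have h2 := continuous_crra (R := R).comp h1.continuous
  unfold gap
  exact (h2.add continuous_const).sub continuous_const

/-- The shooting argument: trajectories started on `m` near the origin cost more than `L`; if some
trajectory costs less, one in between costs exactly `L`. -/
theorem Wedge.exists_of_upper (hτ : τ = 1 ∨ τ = -1) (hR : 0 < R) (hR1 : R ≠ 1) (hD : 0 < D)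
    (hε : 0 < ε) (hwell : τ = 1 → R < 1 → 0 < 1 - ε * (1 - R) + D * R / 2 * (1 - R)) {r : ℝ}
    (hr : 0 < r)
    (hup : ∀ a₀ k : ℝ, 0 < a₀ → a₀ < r → 0 < k → ∃ a₁, a₀ < a₁ ∧ D * R * a₁ ≤ ε ∧
      (∀ a ∈ Set.Icc a₀ a₁, 0 < 1 + (1 - R) * (D * R / 2 * a ^ 2 - ε * a)) ∧
      ∀ c z, gap R D ε c a₁ = 0 → IsTrajectory τ R D ε k a₀ (2 * ε / (D * R) + 1) c z →
        ∫ q in a₀..(2 * ε / (D * R) + 1), capRate τ D k 0 q (gap R D ε (z q) q) < L) :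
    ∃ z a b, Wedge τ R D ε L z a b := by
  have hDR := mul_pos hD hR
  obtain ⟨a₀, ha0, har, ha1, hlow⟩ := exists_start hτ hR hR1 hD hε L hr
  obtain ⟨k, hk, hcap⟩ := exists_cap hτ hR hR1 hD hε ha0 ha1 hwell
  obtain ⟨a₁, ha01, ha1ε, hm, hupper⟩ := hup a₀ k ha0 har hk
  set M := 2 * ε / (D * R) + 1 with hM
  have hM1 : 1 ≤ M := by have : 0 < 2 * ε / (D * R) := by positivity
                         linarith
  have haM : a₀ ≤ M := by linarith
  choose Z hZ using fun c => exists_trajectory (τ := τ) ε hτ hR hR1 hD hk ha0 haM c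
  set C : ℝ → ℝ := fun a => Real.log (1 + (1 - R) * (D * R / 2 * a ^ 2 - ε * a)) / (1 - R) with hC
  have hCgap : ∀ a ∈ Set.Icc a₀ a₁, gap R D ε (C a) a = 0 := fun a ha => gap_log_eq_zero hR1 (hm a ha)
  have hcapC : ∀ a ∈ Set.Icc a₀ a₁, ∀ q ∈ Set.Ioo a₀ M, 0 < gap R D ε (Z (C a) q) q →
      gap R D ε (Z (C a) q) q ≤ k * den τ D q (gap R D ε (Z (C a) q) q) := by
    intro a ha
    have h0 := hCgap a ha
    have hDa : D * R * a ≤ ε := (mul_le_mul_of_nonneg_left ha.2 hDR.le).trans ha1ε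
    have haa : 0 < a := ha0.trans_le ha.1
    refine hcap M (C a) _ ((crra_nonpos_iff hR1).mp ?_) ?_ (hZ _)
    · unfold gap at h0
      nlinarith
    · have e : gap R D ε (C a) a₀ = gap R D ε (C a) a - (a - a₀) * (ε - D * R / 2 * (a + a₀)) := by
        unfold gap; ring
      rw [e, h0, zero_sub]
      have : D * R * a₀ ≤ D * R * a := mul_le_mul_of_nonneg_left ha.1 hDR.le
      exact neg_nonpos.mpr (mul_nonneg (by linarith [ha.1]) (by linarith))
  have hcont : ContinuousOn (fun a => ∫ q in a₀..M, capRate τ D k 0 q (gap R D ε (Z (C a) q) q))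
      (Set.Icc a₀ a₁) :=
    (continuous_cost hτ hR hR1 hD hk ha0 haM hZ).comp_continuousOn
      ((ContinuousOn.log (by fun_prop) fun a ha => (hm a ha).ne').div_const _)
  have hleft : a₀ ∈ Set.Icc a₀ a₁ := ⟨le_rfl, ha01.le⟩
  obtain ⟨a, ha, hL⟩ := intermediate_value_Ioo' ha01.le hcont
    ⟨hupper _ _ (hCgap a₁ ⟨ha01.le, le_rfl⟩) (hZ _),
      hlow k hk M hM1 _ _ (hCgap a₀ hleft) (hZ _) (hcapC a₀ hleft)⟩
  have ha' := Set.Ioo_subset_Icc_self ha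
  obtain ⟨b, hb⟩ := (hZ (C a)).exists_wedge hτ hR hR1 hD hk ha0 (by linarith) (hcapC a ha')
    (hCgap a ha') ha.1 ((mul_lt_mul_of_pos_left ha.2 hDR).trans_le ha1ε)
  refine ⟨Z (C a), a, b, ?_⟩
  rw [← hL]
  exact hb

/-- If `m` is positive up to the Merton line, wedges of any positive cost exist. -/
theorem Wedge.exists_of_pos (hτ : τ = 1 ∨ τ = -1) (hR : 0 < R) (hR1 : R ≠ 1) (hD : 0 < D)
    (hε : 0 < ε) (hwell : τ = 1 → R < 1 → 0 < 1 - ε * (1 - R) + D * R / 2 * (1 - R))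
    (hm : ∀ a, 0 < a → D * R * a ≤ ε → 0 < 1 + (1 - R) * (D * R / 2 * a ^ 2 - ε * a))
    (hL : 0 < L) : ∃ z a b, Wedge τ R D ε L z a b := by
  have hDR := mul_pos hD hR
  have e : D * R * (ε / (D * R)) = ε := by field_simp
  refine Wedge.exists_of_upper hτ hR hR1 hD hε hwell (r := ε / (D * R)) (by positivity)
    fun a₀ k ha0 har hk => ⟨ε / (D * R), har, e.le, fun a ha => hm a (ha0.trans_le ha.1) ?_,
      fun c z hc T => ?_⟩
  · rw [← e]; exact mul_le_mul_of_nonneg_left ha.2 hDR.le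
  · have hr0 : 0 < ε / (D * R) := ha0.trans har
    have e2 : 2 * ε / (D * R) = 2 * (ε / (D * R)) := by ring
    rw [intervalIntegral.integral_congr (g := fun _ => 0), intervalIntegral.integral_zero]
    · exact hL
    · intro q hq
      rw [Set.uIcc_of_le (by linarith)] at hq
      -- a trajectory started on the Merton line stays on the other side of `m`
      refine capRate_of_nonpos (T.gap_nonpos hR hR1 hk ha0 hc hq ?_)
      have : (q - ε / (D * R)) * (D * R / 2 * (q + ε / (D * R)) - ε) =
          D * R / 2 * (q - ε / (D * R)) ^ 2 := by
        nth_rewrite 3 [← e]; ring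
      rw [this]; positivity

/-- On the interval between the two roots of `m`, the denominator of the cost rate at `n = 0` is
positive. -/
theorem den_pos_of_roots (hτ : τ = 1 ∨ τ = -1) (hR : 0 < R) (hR1 : R < 1) (hD : 0 < D)
    (hwell : τ = 1 → R < 1 → 0 < 1 - ε * (1 - R) + D * R / 2 * (1 - R)) {p₁ p₂ q : ℝ}
    (hp : 0 < p₁) (hsum : D * R * (p₁ + p₂) = 2 * ε)
    (hm : 1 + (1 - R) * (D * R / 2 * p₁ ^ 2 - ε * p₁) = 0) (hq : q ∈ Set.Icc p₁ p₂) :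
    0 < den τ D q (D * R / 2 * ((q - p₁) * (p₂ - q))) := by
  have hR' : 0 < 1 - R := by linarith
  have hq0 : 0 < q := hp.trans_le hq.1
  set g := D * R / 2 * ((q - p₁) * (p₂ - q)) with hg
  have hg0 : 0 ≤ g := mul_nonneg (by positivity) (mul_nonneg (by linarith [hq.1]) (by linarith [hq.2]))
  have hgm : (1 - R) * g = -(1 + (1 - R) * (D * R / 2 * q ^ 2 - ε * q)) := by
    have e1 : D * R * p₂ = 2 * ε - D * R * p₁ := by linarith
    have e : g = (q - p₁) * (D * R * p₂ - D * R * q) / 2 := by rw [hg]; ring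
    rw [e, e1]
    linear_combination hm
  have hden : den τ D q g = q * (1 - τ * q) * (D / 2 * (q * (1 - τ * q)) - τ * g) := by
    unfold den; ring
  rw [hden]
  rcases hτ with rfl | rfl
  · have hw := hwell rfl hR1
    rcases lt_trichotomy q 1 with h | h | h
    · refine mul_pos (mul_pos hq0 (by linarith)) (pos_of_mul_pos_right (a := 1 - R) ?_ hR'.le)
      -- this is the quadratic `ℓ`, concave with positive values at `0` and at `1`
      have e : (1 - R) * (D / 2 * (q * (1 - 1 * q)) - 1 * g) = (1 - q) +
          q * (1 - ε * (1 - R) + D * R / 2 * (1 - R)) + D / 2 * (1 - R) ^ 2 * (q * (1 - q)) := by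
        linear_combination -hgm
      rw [e]
      have h1 : 0 < 1 - q := by linarith
      positivity
    · subst h
      nlinarith [mul_nonneg hR'.le hg0]
    · have h1 : q * (1 - 1 * q) < 0 := mul_neg_of_pos_of_neg hq0 (by linarith)
      refine mul_pos_of_neg_of_neg h1 ?_
      have := mul_neg_of_pos_of_neg (half_pos hD) h1
      linarith
  · have h1 : 0 < q * (1 - -1 * q) := mul_pos hq0 (by linarith)
    have h2 := mul_pos (half_pos hD) h1
    exact mul_pos h1 (by linarith)

/-- If `m` has positive roots `p₁ ≤ p₂`, wedges exist for every cost above the threshold. -/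
theorem Wedge.exists_of_roots (hτ : τ = 1 ∨ τ = -1) (hR : 0 < R) (hR1 : R < 1) (hD : 0 < D)
    (hε : 0 < ε) (hwell : τ = 1 → R < 1 → 0 < 1 - ε * (1 - R) + D * R / 2 * (1 - R)) {p₁ p₂ : ℝ}
    (hp : 0 < p₁) (hp12 : p₁ ≤ p₂) (hsum : D * R * (p₁ + p₂) = 2 * ε)
    (hm : 1 + (1 - R) * (D * R / 2 * p₁ ^ 2 - ε * p₁) = 0)
    (hL : ∫ q in p₁..p₂, rate τ D q (D * R / 2 * ((q - p₁) * (p₂ - q))) < L) :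
    ∃ z a b, Wedge τ R D ε L z a b := by
  have hDR := mul_pos hD hR
  have hR' : 0 < 1 - R := by linarith
  refine Wedge.exists_of_upper hτ hR hR1.ne hD hε hwell hp fun a₀ k ha0 har hk => ?_
  set M := 2 * ε / (D * R) + 1 with hM
  have hMp : p₁ + p₂ = 2 * ε / (D * R) := by rw [eq_div_iff hDR.ne']; linarith
  have hpM : p₂ ≤ M := by linarith
  have haM : a₀ ≤ M := by linarith
  -- the gap of the constant function through the point of `m` above `a` dominates the trajectory
  set g : ℝ → ℝ → ℝ := fun a q => D * R / 2 * a ^ 2 - ε * a + ε * q - D * R / 2 * q ^ 2 with hg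
  have hgp : ∀ q, g p₁ q = D * R / 2 * ((q - p₁) * (p₂ - q)) := fun q => by
    rw [hg]; linear_combination (q - p₁) / 2 * -hsum
  have hU : Continuous fun a => ∫ q in a₀..M, capRate τ D k 0 q (g a q) :=
    continuous_integral_capRate hτ hD hk ha0 haM (fun a => by rw [hg]; fun_prop)
      fun q _ => by rw [hg]; fun_prop
  have hUp : ∫ q in a₀..M, capRate τ D k 0 q (g p₁ q) < L := by
    refine lt_of_le_of_lt ?_ hL
    have hint : ∀ x y, a₀ ≤ x → x ≤ y → IntervalIntegrable
        (fun q => capRate τ D k 0 q (g p₁ q)) MeasureTheory.volume x y := fun x y hx hxy =>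
      intervalIntegrable_of_continuousWithinAt_off (p := τ) (C := k) hxy
        (fun t ht htτ => continuousWithinAt_capRate_comp
          (capDen_ne_zero hτ hD hk (ha0.trans_le (hx.trans ht.1)) htτ)
          (Continuous.continuousWithinAt (by rw [hg]; fun_prop)))
        fun t _ => by rw [abs_of_nonneg (capRate_nonneg hk le_rfl)]; exact capRate_le hk le_rfl
    rw [← intervalIntegral.integral_add_adjacent_intervals (hint a₀ p₁ le_rfl har.le)
      (hint p₁ M har.le (hp12.trans hpM)),
      ← intervalIntegral.integral_add_adjacent_intervals (hint p₁ p₂ har.le hp12)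
      (hint p₂ M (har.le.trans hp12) hpM)]
    have h1 : ∫ q in a₀..p₁, capRate τ D k 0 q (g p₁ q) = 0 := by
      rw [intervalIntegral.integral_congr (g := fun _ => 0), intervalIntegral.integral_zero]
      intro q hq
      rw [Set.uIcc_of_le har.le] at hq
      refine capRate_of_nonpos ?_
      rw [hgp]
      exact mul_nonpos_of_nonneg_of_nonpos (by positivity)
        (mul_nonpos_of_nonpos_of_nonneg (by linarith [hq.2]) (by linarith [hq.2]))
    have h2 : ∫ q in p₂..M, capRate τ D k 0 q (g p₁ q) = 0 := by
      rw [intervalIntegral.integral_congr (g := fun _ => 0), intervalIntegral.integral_zero]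
      intro q hq
      rw [Set.uIcc_of_le hpM] at hq
      refine capRate_of_nonpos ?_
      rw [hgp]
      exact mul_nonpos_of_nonneg_of_nonpos (by positivity)
        (mul_nonpos_of_nonneg_of_nonpos (by linarith [hq.1]) (by linarith [hq.1]))
    rw [h1, h2, zero_add, add_zero]
    have hdp : ∀ q ∈ Set.Icc p₁ p₂, 0 < den τ D q (D * R / 2 * ((q - p₁) * (p₂ - q))) :=
      fun q hq => den_pos_of_roots hτ hR hR1 hD hwell hp hsum hm hq
    refine intervalIntegral.integral_mono_on hp12 (hint p₁ p₂ har.le hp12) ?_ fun q hq => ?_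
    · refine ContinuousOn.intervalIntegrable_of_Icc hp12 ?_
      unfold rate
      refine ContinuousOn.div (by fun_prop) ?_ fun q hq => (hdp q hq).ne'
      unfold den; fun_prop
    · rw [hgp]
      exact capRate_le_rate (mul_nonneg (by positivity)
        (mul_nonneg (by linarith [hq.1]) (by linarith [hq.2]))) (hdp q hq)
  obtain ⟨a₁, ⟨ha1, ha1p⟩, hUa⟩ : ∃ a₁ ∈ Set.Ioo a₀ p₁,
      ∫ q in a₀..M, capRate τ D k 0 q (g a₁ q) < L := by
    have h1 := (hU.tendsto p₁).eventually_lt_const hUp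
    have h2 := (h1.filter_mono nhdsWithin_le_nhds).and (Ioo_mem_nhdsLT har)
    obtain ⟨a, h, h'⟩ := h2.exists
    exact ⟨a, h', h⟩
  refine ⟨a₁, ha1, ?_, fun a ha => ?_, fun c z hc T => lt_of_le_of_lt ?_ hUa⟩
  · have : D * R * a₁ ≤ D * R * ((p₁ + p₂) / 2) := mul_le_mul_of_nonneg_left (by linarith) hDR.le
    linarith
  · have e : 1 + (1 - R) * (D * R / 2 * a ^ 2 - ε * a) =
        (1 - R) * (D * R / 2) * ((p₁ - a) * (p₂ - a)) := by
      linear_combination hm + (1 - R) * (a - p₁) / 2 * hsum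
    rw [e]
    exact mul_pos (by positivity) (mul_pos (by linarith [ha.2]) (by linarith [ha.2]))
  · refine intervalIntegral.integral_mono_on haM (T.intervalIntegrable_capRate hτ hD hk ha0 haM)
      ?_ fun q hq => capRate_mono hD hk le_rfl ?_
    · exact intervalIntegrable_of_continuousWithinAt_off (p := τ) (C := k) haM
        (fun t ht htτ => continuousWithinAt_capRate_comp
          (capDen_ne_zero hτ hD hk (ha0.trans_le ht.1) htτ)
          (Continuous.continuousWithinAt (by rw [hg]; fun_prop)))
        fun t _ => by rw [abs_of_nonneg (capRate_nonneg hk le_rfl)]; exact capRate_le hk le_rfl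
    · have h1 := (crra_strictMono hR1.ne).monotone
        (T.init ▸ T.antitoneOn hR hk ha0 ⟨le_rfl, haM⟩ hq hq.1)
      unfold gap at hc ⊢
      rw [hg]
      dsimp only
      linarith

end TransactionCosts

/-! ### Reduction of the free-boundary problem -/

theorem HasDerivWithinAt.comp_neg_Icc {f : ℝ → ℝ} {f' a b x : ℝ}
    (h : HasDerivWithinAt f f' (Set.Icc (-b) (-a)) (-x)) :
    HasDerivWithinAt (fun q => f (-q)) (-f') (Set.Icc a b) x := by
  have := h.scomp (h := fun q : ℝ => -q) x (hasDerivAt_neg x).hasDerivWithinAt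
    (s := Set.Icc a b) (fun q (hq : q ∈ Set.Icc a b) => ⟨neg_le_neg hq.2, neg_le_neg hq.1⟩)
  simpa [Function.comp_def] using this

namespace TransactionCosts

/-- The free-boundary problem for positive drift `ε` (`τ = 1`), or for negative drift `-ε` after
the reflection `q ↦ -q` (`τ = -1`), in which the wedge lies in `q > 0`; `L` is the total cost. -/
structure ReducedSolution (τ R D ε L : ℝ) (n : ℝ → ℝ) (a b : ℝ) : Prop where
  pos : 0 < a
  lt : a < b
  cont : ContinuousOn n (Set.Icc a b)
  n_pos : ∀ q ∈ Set.Icc a b, 0 < n q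
  ode : ∀ q ∈ Set.Ioo a b, q ≠ τ → n q ≠ ellQuad R D (τ * ε) (τ * q) ∧
    HasDerivAt n (τ * odeField R D (τ * ε) (τ * q) (n q)) q
  side : ∀ q ∈ Set.Ioo a b, q ≠ τ → (1 - R) * mQuad R D (τ * ε) (τ * q) < (1 - R) * n q
  left : n a = mQuad R D (τ * ε) (τ * a)
  right : n b = mQuad R D (τ * ε) (τ * b)
  left_deriv : a ≠ τ → HasDerivWithinAt n 0 (Set.Icc a b) a
  right_deriv : HasDerivWithinAt n 0 (Set.Icc a b) b
  integrable : IntervalIntegrable (fun q => costIntegrand R D (τ * ε) (fun _ => n q) (τ * q))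
    MeasureTheory.volume a b
  cost : ∫ q in a..b, costIntegrand R D (τ * ε) (fun _ => n q) (τ * q) = L

variable {τ R D ε ξ L a b : ℝ} {n : ℝ → ℝ}

theorem IsFreeBoundarySolution.reduced (hε : 0 < ε) (S : IsFreeBoundarySolution R D ε ξ n a b) :
    ReducedSolution 1 R D ε (Real.log (1 + ξ)) n a b := by
  refine ⟨S.pos_of_pos hε, S.lt, S.continuousOn, S.pos, ?_, ?_, ?_, ?_, S.smooth_left,
    S.smooth_right, ?_, ?_⟩ <;> simp only [one_mul]
  · exact S.ode
  · exact S.side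
  · exact S.left
  · exact S.right
  · exact S.integrable
  · exact S.cost

theorem ReducedSolution.isFreeBoundarySolution (hε : 0 < ε)
    (S : ReducedSolution 1 R D ε (Real.log (1 + ξ)) n a b) :
    IsFreeBoundarySolution R D ε ξ n a b := by
  obtain ⟨hpos, hlt, hcont, hn, hode, hside, hleft, hright, hld, hrd, hint, hcost⟩ := S
  simp only [one_mul] at hode hside hleft hright hint hcost
  exact ⟨hlt, fun _ => hpos, fun h => absurd h hε.not_gt, hcont, hn, hode, hside, hleft, hright,
    hld, hrd, hint, hcost⟩

/-- The reflection exchanges the two ends of the wedge. -/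
theorem IsFreeBoundarySolution.reduced_neg (hε : 0 < ε)
    (S : IsFreeBoundarySolution R D (-ε) ξ n (-b) (-a)) :
    ReducedSolution (-1) R D ε (Real.log (1 + ξ)) (fun q => n (-q)) a b := by
  have hlt : a < b := neg_lt_neg_iff.mp S.lt
  have hI : ∀ q ∈ Set.Icc a b, -q ∈ Set.Icc (-b) (-a) :=
    fun q hq => ⟨neg_le_neg hq.2, neg_le_neg hq.1⟩
  have hI' : ∀ q ∈ Set.Ioo a b, -q ∈ Set.Ioo (-b) (-a) :=
    fun q hq => ⟨neg_lt_neg hq.2, neg_lt_neg hq.1⟩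
  have hne : ∀ q : ℝ, q ≠ -1 → -q ≠ 1 := fun q hq h => hq (by linarith)
  have hpos : 0 < a := neg_neg_iff_pos.mp (S.neg_of_neg (neg_neg_iff_pos.mpr hε))
  refine ⟨hpos, hlt, S.continuousOn.comp continuous_neg.continuousOn hI, fun q hq => S.pos _ (hI q hq),
    ?_, ?_, ?_, ?_, fun _ => ?_, ?_, ?_, ?_⟩ <;> try simp only [neg_mul, one_mul]
  · intro q hq hq1
    obtain ⟨h1, h2⟩ := S.ode _ (hI' q hq) (hne q hq1)
    refine ⟨h1, ?_⟩
    have := h2.scomp (h := fun q : ℝ => -q) q (hasDerivAt_neg q)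
    simpa [Function.comp_def] using this
  · exact fun q hq hq1 => S.side _ (hI' q hq) (hne q hq1)
  · exact S.right
  · exact S.left
  · simpa using S.smooth_right.comp_neg_Icc
  · simpa using (S.smooth_left (by linarith)).comp_neg_Icc
  · have := S.integrable
    rw [IntervalIntegrable.iff_comp_neg, neg_neg, neg_neg] at this
    exact this.symm
  · rw [← S.cost]
    exact intervalIntegral.integral_comp_neg (fun q => costIntegrand R D (-ε) n q)

theorem ReducedSolution.isFreeBoundarySolution_neg (hε : 0 < ε)
    (S : ReducedSolution (-1) R D ε (Real.log (1 + ξ)) n a b) :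
    IsFreeBoundarySolution R D (-ε) ξ (fun q => n (-q)) (-b) (-a) := by
  obtain ⟨hpos, hlt, hcont, hn, hode, hside, hleft, hright, hld, hrd, hint, hcost⟩ := S
  simp only [neg_mul, one_mul] at hode hside hleft hright hint hcost
  have hI : ∀ q ∈ Set.Icc (-b) (-a), -q ∈ Set.Icc a b :=
    fun q hq => ⟨by linarith [hq.2], by linarith [hq.1]⟩
  have hI' : ∀ q ∈ Set.Ioo (-b) (-a), -q ∈ Set.Ioo a b :=
    fun q hq => ⟨by linarith [hq.2], by linarith [hq.1]⟩
  have hne : ∀ q : ℝ, q ≠ 1 → -q ≠ -1 := fun q hq h => hq (by linarith)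
  refine ⟨neg_lt_neg hlt, fun h => by linarith, fun _ => by linarith,
    hcont.comp continuous_neg.continuousOn hI, fun q hq => hn _ (hI q hq), ?_, ?_, ?_, ?_,
    fun _ => ?_, ?_, ?_, ?_⟩
  · intro q hq hq1
    obtain ⟨h1, h2⟩ := hode _ (hI' q hq) (hne q hq1)
    rw [neg_neg] at h1 h2
    refine ⟨h1, ?_⟩
    have := h2.scomp (h := fun q : ℝ => -q) q (hasDerivAt_neg q)
    simpa [Function.comp_def] using this
  · intro q hq hq1
    have := hside _ (hI' q hq) (hne q hq1)
    rwa [neg_neg] at this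
  · simpa using hright
  · simpa using hleft
  · have := HasDerivWithinAt.comp_neg_Icc (f := n) (f' := 0) (a := -b) (b := -a) (x := -b)
      (by simpa only [neg_neg] using hrd)
    simpa using this
  · have := HasDerivWithinAt.comp_neg_Icc (f := n) (f' := 0) (a := -b) (b := -a) (x := -a)
      (by simpa only [neg_neg] using hld (by linarith))
    simpa using this
  · rw [IntervalIntegrable.iff_comp_neg, neg_neg, neg_neg]
    simpa only [costIntegrand, neg_neg] using hint.symm
  · rw [← hcost, ← intervalIntegral.integral_comp_neg]
    simp only [costIntegrand, neg_neg]

theorem sub_mQuad (hτ : τ = 1 ∨ τ = -1) (hR1 : R ≠ 1) {z q : ℝ} :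
    Real.exp ((1 - R) * z) - mQuad R D (τ * ε) (τ * q) = (1 - R) * gap R D ε z q := by
  rw [← one_add_crra hR1]
  unfold mQuad gap
  rcases hτ with rfl | rfl <;> ring

theorem ellQuad_sub (hτ : τ = 1 ∨ τ = -1) (hR1 : R ≠ 1) {z q : ℝ} :
    ellQuad R D (τ * ε) (τ * q) - Real.exp ((1 - R) * z) =
      (1 - R) * (τ * (D / 2 * (q * (1 - τ * q)) - τ * gap R D ε z q)) := by
  rw [← one_add_crra hR1]
  unfold ellQuad gap
  rcases hτ with rfl | rfl <;> ring

theorem den_eq_mul {q s : ℝ} :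
    den τ D q s = q * (1 - τ * q) * (D / 2 * (q * (1 - τ * q)) - τ * s) := by
  unfold den; ring

theorem costIntegrand_eq_rate (hτ : τ = 1 ∨ τ = -1) (hR1 : R ≠ 1) {z q : ℝ} :
    costIntegrand R D (τ * ε) (fun _ => Real.exp ((1 - R) * z)) (τ * q) =
      rate τ D q (gap R D ε z q) := by
  have h1 : 1 - R ≠ 0 := sub_ne_zero.mpr hR1.symm
  unfold costIntegrand rate
  rw [sub_mQuad hτ hR1, ellQuad_sub hτ hR1, den_eq_mul, mul_div_mul_left _ _ h1, div_mul_div_comm]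
  congr 1
  · ring
  · rcases hτ with rfl | rfl <;> ring

theorem odeField_eq (hτ : τ = 1 ∨ τ = -1) (hR1 : R ≠ 1) {z q : ℝ} (hq : q ≠ 0) :
    τ * odeField R D (τ * ε) (τ * q) (Real.exp ((1 - R) * z)) =
      Real.exp ((1 - R) * z) * ((1 - R) * (-(q / R) * rate τ D q (gap R D ε z q))) := by
  have h1 : 1 - R ≠ 0 := sub_ne_zero.mpr hR1.symm
  have hτ0 : τ ≠ 0 := by rcases hτ with rfl | rfl <;> norm_num
  unfold odeField rate
  rw [← neg_sub (Real.exp ((1 - R) * z)) (mQuad R D _ _), sub_mQuad hτ hR1, ellQuad_sub hτ hR1,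
    den_eq_mul, neg_div, mul_div_mul_left _ _ h1]
  generalize D / 2 * (q * (1 - τ * q)) - τ * gap R D ε z q = X
  rw [mul_assoc q, ← div_div (gap R D ε z q) q, ← div_div (gap R D ε z q) τ]
  field_simp

theorem hasDerivAt_mQuad (hτ : τ = 1 ∨ τ = -1) (q : ℝ) :
    HasDerivAt (fun q => mQuad R D (τ * ε) (τ * q)) (-(1 - R) * (ε - D * R * q)) q := by
  have e : (fun q => mQuad R D (τ * ε) (τ * q)) =
      fun q => 1 + (1 - R) * (D * R / 2 * q ^ 2 - ε * q) := by
    funext q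
    unfold mQuad
    rcases hτ with rfl | rfl <;> ring
  rw [e]
  refine (((((hasDerivAt_id q).pow 2).const_mul (D * R / 2)).sub
    ((hasDerivAt_id q).const_mul ε)).const_mul (1 - R)).const_add 1 |>.congr_deriv ?_
  simp; ring

theorem Wedge.reducedSolution (hτ : τ = 1 ∨ τ = -1) (hR1 : R ≠ 1) {z : ℝ → ℝ}
    (W : Wedge τ R D ε L z a b) :
    ReducedSolution τ R D ε L (fun q => Real.exp ((1 - R) * z q)) a b := by
  have h1 : 1 - R ≠ 0 := sub_ne_zero.mpr hR1.symm
  have hsub := fun q => sub_mQuad (D := D) (ε := ε) hτ hR1 (z := z q) (q := q)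
  have hn : ∀ q, Real.exp ((1 - R) * z q) =
      mQuad R D (τ * ε) (τ * q) + (1 - R) * gap R D ε (z q) q := fun q => by rw [← hsub q]; ring
  have hsmooth : ∀ p, HasDerivWithinAt (fun q => gap R D ε (z q) q) (ε - D * R * p) (Set.Icc a b) p →
      HasDerivWithinAt (fun q => Real.exp ((1 - R) * z q)) 0 (Set.Icc a b) p := by
    intro p hp
    rw [funext hn]
    exact ((hasDerivAt_mQuad hτ p).hasDerivWithinAt.add (hp.const_mul (1 - R))).congr_deriv (by ring)
  refine ⟨W.pos, W.lt, (continuousOn_const.mul W.cont).rexp, fun q _ => Real.exp_pos _,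
    fun q hq hqτ => ⟨fun h => ?_, ?_⟩, fun q hq hqτ => ?_, ?_, ?_,
    fun ha => hsmooth a (W.left_deriv ha), hsmooth b W.right_deriv, ?_, ?_⟩
  · have hd := W.den_pos q hq hqτ
    have h2 := ellQuad_sub (D := D) (ε := ε) hτ hR1 (z := z q) (q := q)
    rw [← h, sub_self, eq_comm, mul_eq_zero, mul_eq_zero] at h2
    rw [den_eq_mul] at hd
    rcases h2 with h2 | h2 | h2
    · exact h1 h2
    · rcases hτ with rfl | rfl <;> norm_num at h2
    · rw [h2, mul_zero] at hd; exact lt_irrefl _ hd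
  · rw [odeField_eq hτ hR1 (W.pos.trans hq.1).ne']
    exact ((W.deriv q hq hqτ).const_mul (1 - R)).exp
  · have h2 := mul_pos (sq_pos_of_ne_zero h1) (W.gap_pos q hq hqτ)
    rw [hn q]
    nlinarith
  · have := hn a
    rw [W.left] at this; linarith
  · have := hn b
    rw [W.right] at this; linarith
  · simp only [costIntegrand_eq_rate hτ hR1]; exact W.integrable
  · simp only [costIntegrand_eq_rate hτ hR1]; exact W.cost

/-- Between the left end of the wedge and the singular point, `n` starts on the right side of `ℓ`
and never crosses it. -/
theorem den_pos_of_ne {s : ℝ → ℝ} {τ D a b : ℝ} (hτ : τ = 1 ∨ τ = -1) (hD : 0 < D) (ha : 0 < a)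
    (hs : ContinuousOn s (Set.Icc a b)) (h0 : s a = 0) (hpos : ∀ q ∈ Set.Ioo a b, q ≠ τ → 0 < s q)
    (hne : ∀ q ∈ Set.Ioo a b, q ≠ τ → D / 2 * (q * (1 - τ * q)) - τ * s q ≠ 0) {q : ℝ}
    (hq : q ∈ Set.Ioo a b) (hqτ : q ≠ τ) : 0 < den τ D q (s q) := by
  have hq0 : 0 < q := ha.trans hq.1
  have hs0 := hpos q hq hqτ
  rw [den_eq_mul]
  rcases hτ with rfl | rfl
  · rcases lt_or_gt_of_ne hqτ with h | h
    · refine mul_pos (mul_pos hq0 (by linarith)) ?_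
      by_contra hcon
      have hlt := lt_of_le_of_ne (not_lt.mp hcon) (hne q hq hqτ)
      have hc : ContinuousOn (fun q => D / 2 * (q * (1 - 1 * q)) - 1 * s q) (Set.Icc a q) :=
        ContinuousOn.sub (by fun_prop)
          (continuousOn_const.mul (hs.mono (Set.Icc_subset_Icc le_rfl hq.2.le)))
      have ha1 : 0 < 1 - a := by linarith [hq.1]
      obtain ⟨p, hp, hp0⟩ := intermediate_value_Ioo' hq.1.le hc
        ⟨hlt, by rw [h0, one_mul, mul_zero, sub_zero]; positivity⟩
      exact hne p ⟨hp.1, hp.2.trans hq.2⟩ (by linarith [hp.2]) hp0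
    · have h1 : q * (1 - 1 * q) < 0 := mul_neg_of_pos_of_neg hq0 (by linarith)
      refine mul_pos_of_neg_of_neg h1 ?_
      have := mul_neg_of_pos_of_neg (half_pos hD) h1
      linarith
  · have h1 : 0 < q * (1 - -1 * q) := mul_pos hq0 (by linarith)
    have h2 := mul_pos (half_pos hD) h1
    exact mul_pos h1 (by linarith)

theorem ReducedSolution.wedge (hτ : τ = 1 ∨ τ = -1) (hR1 : R ≠ 1) (hD : 0 < D)
    (S : ReducedSolution τ R D ε L n a b) :
    Wedge τ R D ε L (fun q => Real.log (n q) / (1 - R)) a b := by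
  have h1 : 1 - R ≠ 0 := sub_ne_zero.mpr hR1.symm
  set z : ℝ → ℝ := fun q => Real.log (n q) / (1 - R) with hz
  have hexp : ∀ q ∈ Set.Icc a b, Real.exp ((1 - R) * z q) = n q := fun q hq => by
    rw [hz]; dsimp only
    rw [mul_div_cancel₀ _ h1, Real.exp_log (S.n_pos q hq)]
  have hgap : ∀ q ∈ Set.Icc a b, gap R D ε (z q) q = (n q - mQuad R D (τ * ε) (τ * q)) / (1 - R) :=
    fun q hq => by
      rw [eq_div_iff h1, ← hexp q hq, sub_mQuad hτ hR1]; ring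
  have hcont : ContinuousOn z (Set.Icc a b) :=
    (S.cont.log fun q hq => (S.n_pos q hq).ne').div_const _
  have hpos : ∀ q ∈ Set.Ioo a b, q ≠ τ → 0 < gap R D ε (z q) q := fun q hq hqτ => by
    have h2 := S.side q hq hqτ
    rw [hgap q (Set.Ioo_subset_Icc_self hq), ← mul_div_mul_left _ _ h1]
    exact div_pos (by linarith) (mul_self_pos.mpr h1)
  have hl : a ∈ Set.Icc a b := ⟨le_rfl, S.lt.le⟩
  have hr : b ∈ Set.Icc a b := ⟨S.lt.le, le_rfl⟩
  have hleft : gap R D ε (z a) a = 0 := by rw [hgap a hl, S.left, sub_self, zero_div]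
  have hsmooth : ∀ p ∈ Set.Icc a b, HasDerivWithinAt n 0 (Set.Icc a b) p →
      HasDerivWithinAt (fun q => gap R D ε (z q) q) (ε - D * R * p) (Set.Icc a b) p := by
    intro p hp h
    refine ((h.sub (hasDerivAt_mQuad hτ p).hasDerivWithinAt).div_const (1 - R)).congr_deriv ?_ |>.congr
      hgap (hgap p hp)
    field_simp; ring
  have hae : ∀ q ∈ Set.uIcc a b, costIntegrand R D (τ * ε) (fun _ => n q) (τ * q) =
      rate τ D q (gap R D ε (z q) q) := fun q hq => by
    rw [Set.uIcc_of_le S.lt.le] at hq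
    rw [← hexp q hq, costIntegrand_eq_rate hτ hR1]
  refine ⟨S.pos, S.lt, hcont, hpos, fun q hq hqτ => ?_, fun q hq hqτ => ?_, hleft, ?_,
    fun ha => hsmooth a hl (S.left_deriv ha), hsmooth b hr S.right_deriv, ?_, ?_⟩
  · refine den_pos_of_ne hτ hD S.pos (continuousOn_gap hcont) hleft hpos (fun p hp hpτ h => ?_) hq hqτ
    have h2 := ellQuad_sub (D := D) (ε := ε) hτ hR1 (z := z p) (q := p)
    rw [h, hexp p (Set.Ioo_subset_Icc_self hp), mul_zero, mul_zero, sub_eq_zero] at h2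
    exact (S.ode p hp hpτ).1 h2.symm
  · have hq' := Set.Ioo_subset_Icc_self hq
    have h2 := (S.ode q hq hqτ).2
    rw [← hexp q hq', odeField_eq hτ hR1 (S.pos.trans hq.1).ne'] at h2
    refine ((h2.log (S.n_pos q hq').ne').div_const (1 - R)).congr_deriv ?_
    rw [← hexp q hq']
    field_simp
  · rw [hgap b hr, S.right, sub_self, zero_div]
  · exact (intervalIntegrable_congr fun q hq => hae q (Set.uIoc_subset_uIcc hq)).mp S.integrable
  · rw [← S.cost]; exact (intervalIntegral.integral_congr hae).symm

end TransactionCosts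

namespace TransactionCosts

/-! ### Free boundaries: uniqueness, comparison and existence -/

variable {τ R D ε ξ a b : ℝ}

theorem IsFreeBoundary.exists_wedge (hR1 : R ≠ 1) (hD : 0 < D) (hε : 0 < ε)
    (h : IsFreeBoundary R D ε ξ a b) : ∃ z, Wedge 1 R D ε (Real.log (1 + ξ)) z a b := by
  rcases h with ⟨h, -, -⟩ | ⟨-, n, S⟩
  · exact absurd h hε.ne'
  · exact ⟨_, (S.reduced hε).wedge (Or.inl rfl) hR1 hD⟩

theorem IsFreeBoundary.exists_wedge_neg (hR1 : R ≠ 1) (hD : 0 < D) (hε : ε < 0)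
    (h : IsFreeBoundary R D ε ξ a b) :
    ∃ z, Wedge (-1) R D (-ε) (Real.log (1 + ξ)) z (-b) (-a) := by
  rcases h with ⟨h, -, -⟩ | ⟨-, n, S⟩
  · exact absurd h hε.ne
  · have hS : IsFreeBoundarySolution R D (- -ε) ξ n (- -a) (- -b) := by
      simpa only [neg_neg] using S
    exact ⟨_, (hS.reduced_neg (neg_pos.mpr hε)).wedge (Or.inr rfl) hR1 hD⟩

theorem IsFreeBoundary.eq_zero (h : IsFreeBoundary R D 0 ξ a b) : a = 0 ∧ b = 0 := by
  rcases h with ⟨-, h⟩ | ⟨h, -⟩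
  · exact h
  · exact absurd rfl h

/-- The wedge lies on the side of the origin given by the sign of the drift. -/
theorem IsFreeBoundary.pos (hε : 0 < ε) (h : IsFreeBoundary R D ε ξ a b) : 0 < a ∧ 0 < b := by
  rcases h with ⟨h, -, -⟩ | ⟨-, n, S⟩
  · exact absurd h hε.ne'
  · exact ⟨S.pos_of_pos hε, (S.pos_of_pos hε).trans S.lt⟩

theorem IsFreeBoundary.neg (hε : ε < 0) (h : IsFreeBoundary R D ε ξ a b) : a < 0 ∧ b < 0 := by
  rcases h with ⟨h, -, -⟩ | ⟨-, n, S⟩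
  · exact absurd h hε.ne
  · exact ⟨S.lt.trans (S.neg_of_neg hε), S.neg_of_neg hε⟩

theorem IsFreeBoundary.unique (hR : 0 < R) (hR1 : R ≠ 1) (hD : 0 < D) {a' b' : ℝ}
    (h : IsFreeBoundary R D ε ξ a b) (h' : IsFreeBoundary R D ε ξ a' b') : a = a' ∧ b = b' := by
  rcases lt_trichotomy ε 0 with hε | rfl | hε
  · obtain ⟨z, W⟩ := h.exists_wedge_neg hR1 hD hε
    obtain ⟨z', W'⟩ := h'.exists_wedge_neg hR1 hD hε
    obtain ⟨h1, h2⟩ := Wedge.unique (Or.inr rfl) hR hR1 hD W W'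
    exact ⟨neg_injective h2, neg_injective h1⟩
  · obtain ⟨h1, h2⟩ := h.eq_zero
    obtain ⟨h1', h2'⟩ := h'.eq_zero
    exact ⟨h1.trans h1'.symm, h2.trans h2'.symm⟩
  · obtain ⟨z, W⟩ := h.exists_wedge hR1 hD hε
    obtain ⟨z', W'⟩ := h'.exists_wedge hR1 hD hε
    exact Wedge.unique (Or.inl rfl) hR hR1 hD W W'

theorem IsFreeBoundary.lt_and_lt (hR : 0 < R) (hR1 : R ≠ 1) (hD : 0 < D) {ε' a' b' : ℝ}
    (h : IsFreeBoundary R D ε ξ a b) (h' : IsFreeBoundary R D ε' ξ a' b') (hlt : ε < ε') :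
    a < a' ∧ b < b' := by
  rcases lt_trichotomy ε 0 with hε | rfl | hε
  · obtain ⟨ha, hb⟩ := h.neg hε
    rcases lt_trichotomy ε' 0 with hε' | rfl | hε'
    · obtain ⟨z, W⟩ := h.exists_wedge_neg hR1 hD hε
      obtain ⟨z', W'⟩ := h'.exists_wedge_neg hR1 hD hε'
      obtain ⟨h1, h2⟩ := Wedge.lt_and_lt (Or.inr rfl) hR hR1 hD W' W (neg_lt_neg hlt)
      exact ⟨neg_lt_neg_iff.mp h2, neg_lt_neg_iff.mp h1⟩
    · obtain ⟨rfl, rfl⟩ := h'.eq_zero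
      exact ⟨ha, hb⟩
    · obtain ⟨ha', hb'⟩ := h'.pos hε'
      exact ⟨ha.trans ha', hb.trans hb'⟩
  · obtain ⟨rfl, rfl⟩ := h.eq_zero
    exact h'.pos hlt
  · obtain ⟨z, W⟩ := h.exists_wedge hR1 hD hε
    obtain ⟨z', W'⟩ := h'.exists_wedge hR1 hD (hε.trans hlt)
    exact Wedge.lt_and_lt (Or.inl rfl) hR hR1 hD W W' hlt

/-- Between the roots of `m`, the integrand of the cost threshold is the cost rate at `n = 0`. -/
theorem costThreshold_integrand_eq (hτ : τ = 1 ∨ τ = -1) (hR : 0 < R) (hR1 : R < 1) (hD : 0 < D)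
    {p₁ p₂ q : ℝ} (hsum : D * R * (p₁ + p₂) = 2 * ε)
    (hm : 1 + (1 - R) * (D * R / 2 * p₁ ^ 2 - ε * p₁) = 0) (hq : q ∈ Set.Icc p₁ p₂) :
    1 / (τ * q * (1 - τ * q)) * (|mQuad R D (τ * ε) (τ * q)| / ellQuad R D (τ * ε) (τ * q)) =
      rate τ D q (D * R / 2 * ((q - p₁) * (p₂ - q))) := by
  have hR' : 0 < 1 - R := by linarith
  have e1 : mQuad R D (τ * ε) (τ * q) = -((1 - R) * (D * R / 2 * ((q - p₁) * (p₂ - q)))) := by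
    have : mQuad R D (τ * ε) (τ * q) = 1 + (1 - R) * (D * R / 2 * q ^ 2 - ε * q) := by
      unfold mQuad
      rcases hτ with rfl | rfl <;> ring
    rw [this]
    linear_combination hm + (1 - R) * (q - p₁) / 2 * hsum
  have hg0 : 0 ≤ D * R / 2 * ((q - p₁) * (p₂ - q)) :=
    mul_nonneg (by positivity) (mul_nonneg (by linarith [hq.1]) (by linarith [hq.2]))
  generalize D * R / 2 * ((q - p₁) * (p₂ - q)) = g at e1 hg0
  have e2 : ellQuad R D (τ * ε) (τ * q) = (1 - R) * (τ * (D / 2 * (q * (1 - τ * q)) - τ * g)) := by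
    have : ellQuad R D (τ * ε) (τ * q) = mQuad R D (τ * ε) (τ * q) +
        (1 - R) * (τ * (D / 2 * (q * (1 - τ * q)))) := by
      unfold ellQuad mQuad
      rcases hτ with rfl | rfl <;> ring
    rw [this, e1]
    rcases hτ with rfl | rfl <;> ring
  rw [e2, e1, abs_neg, abs_of_nonneg (mul_nonneg hR'.le hg0), rate, den_eq_mul,
    mul_div_mul_left _ _ hR'.ne', div_mul_div_comm]
  congr 1
  · ring
  · rcases hτ with rfl | rfl <;> ring

/-- The condition on the cost in `WellPosed`, in reduced coordinates. If `|ε|` is at most the square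
root, the roots of `m` coincide and the integral is zero. -/
theorem integral_rate_lt (hτ : τ = 1 ∨ τ = -1) (hR : 0 < R) (hR1 : R < 1) (hD : 0 < D)
    (hξ : 0 < ξ) (hbig : 2 * D * R / (1 - R) ≤ ε ^ 2)
    (hw : |τ * ε| ≤ Real.sqrt (2 * D * R / (1 - R)) ∨ costThreshold R D (τ * ε) < ξ)
    (hsum : D * R * (mRootMinus R D ε + mRootPlus R D ε) = 2 * ε)
    (hm : 1 + (1 - R) * (D * R / 2 * mRootMinus R D ε ^ 2 - ε * mRootMinus R D ε) = 0)
    (h12 : mRootMinus R D ε ≤ mRootPlus R D ε) :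
    ∫ q in (mRootMinus R D ε)..(mRootPlus R D ε), rate τ D q
      (D * R / 2 * ((q - mRootMinus R D ε) * (mRootPlus R D ε - q))) < Real.log (1 + ξ) := by
  rcases hw with h | h
  · have h1 : |τ * ε| = |ε| := by rcases hτ with rfl | rfl <;> simp
    rw [h1, Real.le_sqrt (abs_nonneg _), sq_abs] at h
    · have h2 : mRootMinus R D ε = mRootPlus R D ε := by
        unfold mRootMinus mRootPlus
        rw [le_antisymm h hbig, sub_self, Real.sqrt_zero, sub_zero, add_zero]
      rw [h2, intervalIntegral.integral_same]
      exact Real.log_pos (by linarith)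
    · have : 0 < 1 - R := by linarith
      positivity
  · have h1 : ∫ q in (mRootMinus R D (τ * ε))..(mRootPlus R D (τ * ε)),
        1 / (q * (1 - q)) * (|mQuad R D (τ * ε) q| / ellQuad R D (τ * ε) q) < Real.log (1 + ξ) := by
      rw [Real.lt_log_iff_exp_lt (by linarith)]
      unfold costThreshold at h
      linarith
    refine lt_of_eq_of_lt ?_ h1
    have h2 : ∫ q in (mRootMinus R D ε)..(mRootPlus R D ε), rate τ D q
        (D * R / 2 * ((q - mRootMinus R D ε) * (mRootPlus R D ε - q))) =
        ∫ q in (mRootMinus R D ε)..(mRootPlus R D ε), 1 / (τ * q * (1 - τ * q)) *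
          (|mQuad R D (τ * ε) (τ * q)| / ellQuad R D (τ * ε) (τ * q)) := by
      refine intervalIntegral.integral_congr fun q hq => ?_
      rw [Set.uIcc_of_le h12] at hq
      exact (costThreshold_integrand_eq hτ hR hR1 hD hsum hm hq).symm
    rw [h2]
    rcases hτ with rfl | rfl
    · simp only [one_mul]
    · have e1 : mRootMinus R D (-1 * ε) = -mRootPlus R D ε := by
        unfold mRootMinus mRootPlus
        rw [show (-1 * ε) ^ 2 = ε ^ 2 by ring]; ring
      have e2 : mRootPlus R D (-1 * ε) = -mRootMinus R D ε := by
        unfold mRootMinus mRootPlus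
        rw [show (-1 * ε) ^ 2 = ε ^ 2 by ring]; ring
      rw [e1, e2, ← intervalIntegral.integral_comp_neg]
      simp only [neg_one_mul]

/-- Existence: either `m` is positive, or it has roots and the cost exceeds the threshold. -/
theorem WellPosed.exists_wedge (hτ : τ = 1 ∨ τ = -1) (hR : 0 < R) (hR1 : R ≠ 1) (hD : 0 < D)
    (hε : 0 < ε) (hξ : 0 < ξ) (hw : WellPosed R D (τ * ε) ξ) :
    ∃ z a b, Wedge τ R D ε (Real.log (1 + ξ)) z a b := by
  have hDR := mul_pos hD hR
  have hL : 0 < Real.log (1 + ξ) := Real.log_pos (by linarith)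
  rcases hw with h | ⟨h, hw1, hw2⟩
  · refine Wedge.exists_of_pos hτ hR hR1 hD hε (fun _ h' => absurd h h'.not_gt) (fun a ha haε => ?_) hL
    have h1 : 0 ≤ (R - 1) * (a * (ε - D * R / 2 * a)) :=
      mul_nonneg (by linarith) (mul_nonneg ha.le (by nlinarith))
    linarith
  have hR' : 0 < 1 - R := by linarith
  have hwell : τ = 1 → R < 1 → 0 < 1 - ε * (1 - R) + D * R / 2 * (1 - R) := by
    rintro rfl -
    rw [one_mul, ← sub_pos] at hw1
    have := mul_pos hw1 hR'
    have e : (1 / (1 - R) + D * R / 2 - ε) * (1 - R) = 1 - ε * (1 - R) + D * R / 2 * (1 - R) := by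
      field_simp; ring
    linarith
  rcases lt_or_ge (ε ^ 2) (2 * D * R / (1 - R)) with hlt | hge
  · refine Wedge.exists_of_pos hτ hR hR1 hD hε hwell (fun a ha haε => ?_) hL
    rw [lt_div_iff₀ hR'] at hlt
    refine pos_of_mul_pos_right (a := 2 * (D * R)) ?_ (by positivity)
    have e : 2 * (D * R) * (1 + (1 - R) * (D * R / 2 * a ^ 2 - ε * a)) =
        (2 * D * R - ε ^ 2 * (1 - R)) + (1 - R) * (D * R * a - ε) ^ 2 := by ring
    rw [e]
    have : 0 ≤ (1 - R) * (D * R * a - ε) ^ 2 := by positivity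
    linarith
  · have hs0 := Real.sqrt_nonneg (ε ^ 2 - 2 * D * R / (1 - R))
    have hss := Real.sq_sqrt (sub_nonneg.mpr hge)
    have hm0 : D * R * mRootMinus R D ε = ε - Real.sqrt (ε ^ 2 - 2 * D * R / (1 - R)) := by
      unfold mRootMinus; field_simp
    have hp0 : D * R * mRootPlus R D ε = ε + Real.sqrt (ε ^ 2 - 2 * D * R / (1 - R)) := by
      unfold mRootPlus; field_simp
    set s := Real.sqrt (ε ^ 2 - 2 * D * R / (1 - R)) with hs
    have hsum : D * R * (mRootMinus R D ε + mRootPlus R D ε) = 2 * ε := by linarith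
    have hsε : s < ε := by
      refine lt_of_pow_lt_pow_left₀ 2 hε.le ?_
      have : 0 < 2 * D * R / (1 - R) := by positivity
      linarith
    have hm : 1 + (1 - R) * (D * R / 2 * mRootMinus R D ε ^ 2 - ε * mRootMinus R D ε) = 0 := by
      have e1 : (1 - R) * (2 * D * R / (1 - R)) = 2 * D * R := by field_simp
      have e2 : 2 * (D * R) * (1 + (1 - R) * (D * R / 2 * mRootMinus R D ε ^ 2 -
          ε * mRootMinus R D ε)) = 0 := by
        linear_combination (1 - R) * (D * R * mRootMinus R D ε - ε - s) * hm0 + (1 - R) * hss - e1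
      exact (mul_eq_zero.mp e2).resolve_left (by positivity)
    have hp : 0 < mRootMinus R D ε := pos_of_mul_pos_right (a := D * R) (by linarith) hDR.le
    have h12 : mRootMinus R D ε ≤ mRootPlus R D ε := le_of_mul_le_mul_left (by linarith) hDR
    exact Wedge.exists_of_roots hτ hR h hD hε hwell hp h12 hsum hm
      (integral_rate_lt hτ hR h hD hξ hge hw2 hsum hm h12)

theorem WellPosed.exists_isFreeBoundary (hR : 0 < R) (hR1 : R ≠ 1) (hD : 0 < D) (hξ : 0 < ξ)
    (hw : WellPosed R D ε ξ) : ∃ a b, IsFreeBoundary R D ε ξ a b := by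
  rcases lt_trichotomy ε 0 with hε | rfl | hε
  · have hε' := neg_pos.mpr hε
    obtain ⟨z, a, b, W⟩ := WellPosed.exists_wedge (τ := -1) (ε := -ε) (Or.inr rfl) hR hR1 hD hε' hξ
      (by simpa using hw)
    have S := (W.reducedSolution (Or.inr rfl) hR1).isFreeBoundarySolution_neg hε'
    rw [neg_neg] at S
    exact ⟨_, _, Or.inr ⟨hε.ne, _, S⟩⟩
  · exact ⟨0, 0, Or.inl ⟨rfl, rfl, rfl⟩⟩
  · obtain ⟨z, a, b, W⟩ := WellPosed.exists_wedge (τ := 1) (Or.inl rfl) hR hR1 hD hε hξ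
      (by simpa using hw)
    exact ⟨a, b, Or.inr ⟨hε.ne', _,
      (W.reducedSolution (Or.inl rfl) hR1).isFreeBoundarySolution hε⟩⟩

/-! ### The boundaries in terms of paper wealth -/

/-- A purchase point beyond `1` cannot be far from `1`, given the cost. -/
theorem IsFreeBoundary.purchase_pos (hR1 : R ≠ 1) (hD : 0 < D) {lam : ℝ} (hlam : 0 ≤ lam)
    (hξ : 0 < ξ) (hle : lam ≤ ξ) (h : IsFreeBoundary R D ε ξ a b) : 0 < 1 + lam - lam * a := by
  rcases le_or_gt a 1 with ha | ha
  · nlinarith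
  · have hε : 0 < ε := by
      by_contra hcon
      rcases (not_lt.mp hcon).lt_or_eq with hε | rfl
      · linarith [(h.neg hε).1]
      · linarith [h.eq_zero.1]
    obtain ⟨z, W⟩ := h.exists_wedge hR1 hD hε
    have h1 := W.cost_lt (Or.inl rfl) hD ha
    rw [one_mul, ← Real.log_div (by linarith) (by linarith),
      Real.log_lt_log_iff (by linarith) (div_pos (by linarith) (by linarith)),
      lt_div_iff₀ (by linarith)] at h1
    have h2 : lam * (a - 1) ≤ ξ * (a - 1) := mul_le_mul_of_nonneg_right hle (by linarith)
    linarith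

/-- A negative sale point cannot be far from the origin, given the cost. -/
theorem IsFreeBoundary.sale_pos (hR1 : R ≠ 1) (hD : 0 < D) {gam : ℝ} (hgam : 0 ≤ gam)
    (hgam1 : gam < 1) (hξ : 0 < ξ) (hle : gam ≤ ξ * (1 - gam)) (h : IsFreeBoundary R D ε ξ a b) :
    0 < 1 - gam + gam * b := by
  rcases le_or_gt 0 b with hb | hb
  · nlinarith
  · have hε : ε < 0 := by
      by_contra hcon
      rcases (not_lt.mp hcon).lt_or_eq with hε | rfl
      · linarith [(h.pos hε).2]
      · linarith [h.eq_zero.2]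
    obtain ⟨z, W⟩ := h.exists_wedge_neg hR1 hD hε
    have h1 := W.cost_lt (Or.inr rfl) hD (by linarith)
    have e : -1 * (Real.log (-b) - Real.log (-b - -1)) = Real.log (-b - -1) - Real.log (-b) := by ring
    rw [e, ← Real.log_div (by linarith) (by linarith),
      Real.log_lt_log_iff (by linarith) (div_pos (by linarith) (by linarith)),
      lt_div_iff₀ (by linarith)] at h1
    have h2 : gam * -b ≤ ξ * (1 - gam) * -b := mul_le_mul_of_nonneg_right hle (by linarith)
    have h3 : (ξ * -b) * (1 - gam) < 1 * (1 - gam) :=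
      mul_lt_mul_of_pos_right (by linarith) (by linarith)
    linarith

theorem purchaseBoundary_lt {lam x y : ℝ} (hlam : 0 ≤ lam) (hx : 0 < 1 + lam - lam * x)
    (hy : 0 < 1 + lam - lam * y) (h : x < y) : purchaseBoundary lam x < purchaseBoundary lam y := by
  unfold purchaseBoundary
  rw [div_lt_div_iff₀ hx hy]
  nlinarith

theorem saleBoundary_lt {gam x y : ℝ} (hgam1 : gam < 1) (hx : 0 < 1 - gam + gam * x)
    (hy : 0 < 1 - gam + gam * y) (h : x < y) : saleBoundary gam x < saleBoundary gam y := by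
  unfold saleBoundary
  rw [div_lt_div_iff₀ hx hy]
  nlinarith

end TransactionCosts

theorem mainTheorem5 (β σ R lam gam : ℝ) (hβ : 0 < β) (hσ : 0 < σ) (hR : 0 < R) (hR1 : R ≠ 1)
    (hlam : 0 ≤ lam) (hgam : 0 ≤ gam) (hgam1 : gam < 1) (hcost : 0 < lam + gam) :
    ∃ qLower qUpper : ℝ → ℝ,
      (∀ ε : ℝ, TransactionCosts.WellPosed R (σ ^ 2 / β) ε (TransactionCosts.roundTrip lam gam) →
        ∀ a b : ℝ, TransactionCosts.IsFreeBoundary R (σ ^ 2 / β) ε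
            (TransactionCosts.roundTrip lam gam) a b ↔
          a = qLower ε ∧ b = qUpper ε) ∧
      StrictMonoOn qLower {ε : ℝ |
        TransactionCosts.WellPosed R (σ ^ 2 / β) ε (TransactionCosts.roundTrip lam gam)} ∧
      StrictMonoOn qUpper {ε : ℝ |
        TransactionCosts.WellPosed R (σ ^ 2 / β) ε (TransactionCosts.roundTrip lam gam)} ∧
      StrictMonoOn (fun μ : ℝ => TransactionCosts.purchaseBoundary lam (qLower (μ / β))) {μ : ℝ |
        TransactionCosts.WellPosed R (σ ^ 2 / β) (μ / β) (TransactionCosts.roundTrip lam gam)} ∧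
      StrictMonoOn (fun μ : ℝ => TransactionCosts.saleBoundary gam (qUpper (μ / β))) {μ : ℝ |
        TransactionCosts.WellPosed R (σ ^ 2 / β) (μ / β) (TransactionCosts.roundTrip lam gam)} := by

  have hD : 0 < σ ^ 2 / β := by positivity
  have hg : 0 < 1 - gam := by linarith
  set ξ := TransactionCosts.roundTrip lam gam with hξdef
  have hξg : ξ * (1 - gam) = lam + gam := by
    rw [hξdef, TransactionCosts.roundTrip, div_mul_cancel₀ _ hg.ne']
  have hξ : 0 < ξ := div_pos hcost hg
  have hlamξ : lam ≤ ξ := by nlinarith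
  have hgamξ : gam ≤ ξ * (1 - gam) := by linarith
  set D := σ ^ 2 / β with hDdef
  have hex : ∀ ε : ℝ, ∃ p : ℝ × ℝ, TransactionCosts.WellPosed R D ε ξ →
      TransactionCosts.IsFreeBoundary R D ε ξ p.1 p.2 := fun ε => by
    by_cases hw : TransactionCosts.WellPosed R D ε ξ
    · obtain ⟨a, b, h⟩ := hw.exists_isFreeBoundary hR hR1 hD hξ
      exact ⟨(a, b), fun _ => h⟩
    · exact ⟨0, fun h => absurd h hw⟩
  choose p hp using hex
  have hlt : ∀ ε ε', TransactionCosts.WellPosed R D ε ξ → TransactionCosts.WellPosed R D ε' ξ →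
      ε < ε' → (p ε).1 < (p ε').1 ∧ (p ε).2 < (p ε').2 :=
    fun ε ε' h h' hεε' => (hp ε h).lt_and_lt hR hR1 hD (hp ε' h') hεε'
  refine ⟨fun ε => (p ε).1, fun ε => (p ε).2, fun ε hw a b => ⟨fun h => ?_, ?_⟩,
    fun ε h ε' h' hεε' => (hlt ε ε' h h' hεε').1, fun ε h ε' h' hεε' => (hlt ε ε' h h' hεε').2,
    fun μ h μ' h' hμ => ?_, fun μ h μ' h' hμ => ?_⟩
  · exact h.unique hR hR1 hD (hp ε hw)
  · rintro ⟨rfl, rfl⟩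
    exact hp ε hw
  · exact TransactionCosts.purchaseBoundary_lt hlam ((hp _ h).purchase_pos hR1 hD hlam hξ hlamξ)
      ((hp _ h').purchase_pos hR1 hD hlam hξ hlamξ)
      (hlt _ _ h h' (div_lt_div_of_pos_right hμ hβ)).1
  · exact TransactionCosts.saleBoundary_lt hgam1 ((hp _ h).sale_pos hR1 hD hgam hgam1 hξ hgamξ)
      ((hp _ h').sale_pos hR1 hD hgam hgam1 hξ hgamξ)
      (hlt _ _ h h' (div_lt_div_of_pos_right hμ hβ)).2
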